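/- Setting. A spin chain algebra $\mathcal A$ is the $C^*$-inductive limit of the algebras $\mathcal A_S=\bigotimes_{j\in S}\mathcal A_j$, $S\subset\mathbb Z$ finite, where $\mathcal A_j\cong M_{n_j}(\mathbb C)$, $n_j\ge 1$. Let $\mathcal F$ be the class of non-increasing strictly positive functions $f$ on $\{1,2,\dots\}$ with $r^pf(r)\to0$ as $r\to\infty$ for every $p>0$. An interaction is a family $H=(H_S)$, indexed by the finite $S\subset\mathbb Z$, with $H_S=H_S^*\in\mathcal A_S$ and $\|H\|_f=\sup_{j}\sum_{S\ni j}\|H_S\|/f(1+\mathrm{diam}\,S)<\infty$ for some $f\in\mathcal F$. A time-dependent interaction (TDI) is a family $(H(s))_{s\in[0,1]}$ of interactions that, for some $f\in\mathcal F$, is bounded and strongly measurable in $\|\cdot\|_f$ (almost everywhere the $\|\cdot\|_f$-limit of a sequence of simple functions). It generates the almost local evolution $\alpha_H(s)$, $s\in[0,1]$: the $*$-automorphisms given by the pointwise norm limit, as the finite sets $\Lambda$ increase to $\mathbb Z$, of the strongly continuous families of $*$-automorphisms $\alpha^\Lambda(s)$ that solve $$\alpha^\Lambda(s)[A]=A+i\int_0^s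 \alpha^\Lambda(u)\Big[\sum_{S\subset\Lambda}[H_S(u),A]\Big]\,du,\qquad A\in\mathcal A .$$ A state $\phi$ on $\mathcal A$ is a product state if $\phi\big(\prod_{j\in S}A_j\big)=\prod_{j\in S}\phi(A_j)$ for all finite $S$ and $A_j\in\mathcal A_j$. A pure state $\psi$ on $\mathcal A$ is invertible if there are a spin chain algebra $\mathcal A'$, a pure state $\overline\psi$ on $\mathcal A'$, a TDI $E$ on the spin chain algebra $\mathcal A\otimes\mathcal A'$ (with site algebras $\mathcal A_j\otimes\mathcal A'_j$) and a product state $\phi$ on $\mathcal A\otimes\mathcal A'$ with $\psi\otimes\overline\psi=\phi\circ\alpha_E(1)$. A loop generated by a TDI $H$ is a family $(\psi(s))_{s\in[0,1]}$ of pure states on $\mathcal A$ with $\psi(s)=\psi(0)\circ\alpha_H(s)$ for all $s\in[0,1]$ and $\psi(1)=\psi(0)$. Proposition. Let $\psi(\cdot)$ be a loop on a spin chain algebra $\mathcal A$ generated by a TDI $H$, and let $H'$ be the truncation of $H$ to the left half-line: $H'_S(s)=H_S(s)$ if $S\subset\{\dots,-2,-1,0\}$ and $H'_S(s)=0$ otherwise.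 If the basepoint $\psi(0)$ is invertible, then (the almost local evolution $\alpha_{H'}$ exists and) the pumped state $\psi'=\psi(0)\circ\alpha_{H'}(1)$ is normal with respect to $\psi(0)$: if $(\mathcal H,\Omega,\pi)$ is the GNS representation of $\psi(0)$, there is a density matrix $\rho$ on $\mathcal H$ (a positive operator of trace one) such that $\psi'(A)=\mathrm{Tr}_{\mathcal H}(\rho\,\pi(A))$ for all $A\in\mathcal A$. -/

import Mathlib

open MeasureTheory Filter Topology Set
open scoped ComplexOrder ENNReal InnerProductSpace

noncomputable section

namespace SpinChain

/-! ### The spin chain algebra -/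

section Algebra

variable (σ : ℤ → Type)

/-- Configurations of the chain: a basis label of the site space `ℂ ^ (σ j)` for every site `j`. -/
abbrev Config := ∀ j : ℤ, σ j

/-- Configurations of a finite set `S` of sites. -/
abbrev LocalConfig (S : Finset ℤ) := ∀ j : S, σ j

/-- The Hilbert space `ℓ²(Config)`, which carries a faithful representation of every local algebra
`⨂_{j ∈ S} M_{σ j}(ℂ)`, and hence of their inductive limit. -/
abbrev ConfigSpace := lp (fun _ : Config σ => ℂ) 2

variable {σ}

/-- The restriction of a configuration to `S`. -/
def restr (S : Finset ℤ) (m : Config σ) : LocalConfig σ S := fun j => m j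

/-- The configuration that equals `k` on `S` and `m` off `S`. -/
def override (S : Finset ℤ) (m : Config σ) (k : LocalConfig σ S) : Config σ :=
  fun j => if h : j ∈ S then k ⟨j, h⟩ else m j

theorem restr_override (S : Finset ℤ) (m : Config σ) (k : LocalConfig σ S) :
    restr S (override S m k) = k := by
  funext j
  simp [restr, override]

theorem override_override (S : Finset ℤ) (m : Config σ) (k l : LocalConfig σ S) :
    override S (override S m k) l = override S m l := by
  funext j
  by_cases h : j ∈ S <;> simp [override, h]

theorem override_restr (S : Finset ℤ) (m : Config σ) : override S m (restr S m) = m := by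
  funext j
  by_cases h : j ∈ S <;> simp [override, restr, h]

theorem override_inj {S : Finset ℤ} {k l : LocalConfig σ S} {m m' : Config σ}
    (hm : restr S m = k) (hm' : restr S m' = k) (h : override S m l = override S m' l) :
    m = m' := by
  rw [← override_restr S m, ← override_restr S m', hm, hm', ← override_override S m l k, h,
    override_override]

variable [∀ j, DecidableEq (σ j)]

theorem unit_summable (S : Finset ℤ) (k l : LocalConfig σ S) (ξ : ConfigSpace σ) :
    Summable (fun m : Config σ => ‖if restr S m = k then ξ (override S m l) else 0‖ ^ (2 : ℝ)) ∧
    ∑' m : Config σ, ‖if restr S m = k then ξ (override S m l) else 0‖ ^ (2 : ℝ)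
      ≤ ∑' m : Config σ, ‖ξ m‖ ^ (2 : ℝ) := by
  have hs : Summable (fun m : Config σ => ‖ξ m‖ ^ (2 : ℝ)) := by
    simpa using (lp.memℓp ξ).summable (by simp)
  have hinj : Function.Injective
      (fun m : {m : Config σ // restr S m = k} => override S m.1 l) := by
    intro m m' h
    exact Subtype.ext (override_inj m.2 m'.2 h)
  have hfun : (fun m : Config σ =>
      ‖if restr S m = k then ξ (override S m l) else 0‖ ^ (2 : ℝ)) =
      Set.indicator {m : Config σ | restr S m = k}
        (fun m => ‖ξ (override S m l)‖ ^ (2 : ℝ)) := by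
    funext m
    by_cases h : restr S m = k <;> simp [Set.indicator, h]
  have h1 := hs.comp_injective hinj
  constructor
  · rw [hfun]
    exact summable_subtype_iff_indicator.mp h1
  · rw [hfun, ← tsum_subtype]
    exact tsum_comp_le_tsum_of_inj hs (fun m => by positivity) hinj

/-- The matrix unit `|k⟩⟨l|` on the sites in `S`, tensored with the identity elsewhere. -/
def matrixUnit (S : Finset ℤ) (k l : LocalConfig σ S) :
    ConfigSpace σ →L[ℂ] ConfigSpace σ :=
  LinearMap.mkContinuous
    { toFun := fun ξ => ⟨fun m => if restr S m = k then ξ (override S m l) else 0,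
        memℓp_gen (by simpa using (unit_summable S k l ξ).1)⟩
      map_add' := by
        intro ξ η
        ext m
        change (if restr S m = k then ξ (override S m l) + η (override S m l) else 0) =
          (if restr S m = k then ξ (override S m l) else 0) +
            (if restr S m = k then η (override S m l) else 0)
        by_cases h : restr S m = k <;> simp [h]
      map_smul' := by
        intro c ξ
        ext m
        by_cases h : restr S m = k <;> simp [h] } 1 (by
    intro ξ
    rw [one_mul]
    refine lp.norm_le_of_tsum_le (by simp) (norm_nonneg ξ) ?_
    rw [lp.norm_rpow_eq_tsum (by simp) ξ]
    simpa using (unit_summable S k l ξ).2)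

theorem matrixUnit_apply (S : Finset ℤ) (k l : LocalConfig σ S) (ξ : ConfigSpace σ)
    (m : Config σ) :
    matrixUnit S k l ξ m = if restr S m = k then ξ (override S m l) else 0 := rfl

theorem matrixUnit_inner (S : Finset ℤ) (k l : LocalConfig σ S) (ξ η : ConfigSpace σ) :
    ⟪matrixUnit S k l ξ, η⟫_ℂ = ⟪ξ, matrixUnit S l k η⟫_ℂ := by
  rw [lp.inner_eq_tsum, lp.inner_eq_tsum]
  have h1 : ∀ m : Config σ, ⟪matrixUnit S k l ξ m, η m⟫_ℂ =
      Set.indicator {m : Config σ | restr S m = k}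
        (fun m => ⟪ξ (override S m l), η m⟫_ℂ) m := by
    intro m
    by_cases h : restr S m = k <;> simp [matrixUnit_apply, h]
  have h2 : ∀ m : Config σ, ⟪ξ m, matrixUnit S l k η m⟫_ℂ =
      Set.indicator {m : Config σ | restr S m = l}
        (fun m => ⟪ξ m, η (override S m k)⟫_ℂ) m := by
    intro m
    by_cases h : restr S m = l <;> simp [matrixUnit_apply, h]
  simp_rw [h1, h2]
  rw [← tsum_subtype, ← tsum_subtype]
  let e : {m : Config σ | restr S m = k} ≃ {m : Config σ | restr S m = l} :=
    { toFun := fun m => ⟨override S m.1 l, restr_override S _ _⟩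
      invFun := fun m => ⟨override S m.1 k, restr_override S _ _⟩
      left_inv := by
        rintro ⟨m, hm⟩
        refine Subtype.ext ?_
        have hm' : restr S m = k := hm
        simp only [override_override]
        rw [← hm', override_restr]
      right_inv := by
        rintro ⟨m, hm⟩
        refine Subtype.ext ?_
        have hm' : restr S m = l := hm
        simp only [override_override]
        rw [← hm', override_restr] }
  rw [← e.tsum_eq]
  refine tsum_congr ?_
  rintro ⟨m, hm⟩
  have hm' : restr S m = k := hm
  have hk : override S m k = m := by rw [← hm', override_restr]
  change ⟪ξ (override S m l), η m⟫_ℂ = ⟪ξ (override S m l), η (override S (override S m l) k)⟫_ℂ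
  rw [override_override, hk]

variable [∀ j, Fintype (σ j)]

/-- The operator `a ⊗ 1`, with the matrix `a` acting on the sites in `S`. -/
def localOp (S : Finset ℤ) (a : Matrix (LocalConfig σ S) (LocalConfig σ S) ℂ) :
    ConfigSpace σ →L[ℂ] ConfigSpace σ :=
  ∑ k, ∑ l, a k l • matrixUnit S k l

theorem localOp_apply (S : Finset ℤ) (a : Matrix (LocalConfig σ S) (LocalConfig σ S) ℂ)
    (ξ : ConfigSpace σ) (m : Config σ) :
    localOp S a ξ m = ∑ l, a (restr S m) l * ξ (override S m l) := by
  have h : localOp S a ξ m = ∑ k, ∑ l, a k l * matrixUnit S k l ξ m := by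
    have h' : ∀ (ι : Type) (s : Finset ι) (g : ι → ConfigSpace σ),
        (∑ i ∈ s, g i : ConfigSpace σ) m = ∑ i ∈ s, g i m := fun ι s g => by
      rw [lp.coeFn_sum]
      exact Finset.sum_apply m s _
    simp only [localOp, sum_apply, h', smul_apply]
    rfl
  rw [h, Finset.sum_eq_single (restr S m)]
  · simp [matrixUnit_apply]
  · intro k _ hk
    simp [matrixUnit_apply, Ne.symm hk]
  · simp

/-- The representation `a ↦ a ⊗ 1` of the local matrix algebra `⨂_{j ∈ S} M_{σ j}(ℂ)`, that is,
of the matrices over the configurations of `S`. -/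
def localRep (S : Finset ℤ) :
    Matrix (LocalConfig σ S) (LocalConfig σ S) ℂ →⋆ₐ[ℂ]
      (ConfigSpace σ →L[ℂ] ConfigSpace σ) where
  toFun := localOp S
  map_one' := by
    ext ξ m
    rw [localOp_apply]
    simp [Matrix.one_apply, override_restr]
  map_mul' a b := by
    ext ξ m
    rw [mul_apply_eq_comp, localOp_apply, localOp_apply]
    simp_rw [localOp_apply, restr_override, override_override, Matrix.mul_apply, Finset.sum_mul,
      Finset.mul_sum]
    rw [Finset.sum_comm]
    simp_rw [mul_assoc]
  map_zero' := by simp [localOp]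
  map_add' a b := by simp [localOp, add_smul, Finset.sum_add_distrib]
  commutes' r := by
    ext ξ m
    rw [localOp_apply]
    simp [Matrix.algebraMap_matrix_apply, override_restr, Algebra.algebraMap_eq_smul_one]
  map_star' a := by
    rw [ContinuousLinearMap.star_eq_adjoint, ContinuousLinearMap.eq_adjoint_iff]
    intro ξ η
    simp only [localOp, sum_apply, sum_inner, inner_sum,
      smul_apply, inner_smul_left, inner_smul_right, matrixUnit_inner,
      Matrix.star_apply]
    rw [Finset.sum_comm]
    simp

variable (σ)

/-- The closed `*`-subalgebra of bounded operators generated by all local algebras. -/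
def quasiLocal : StarSubalgebra ℂ (ConfigSpace σ →L[ℂ] ConfigSpace σ) :=
  (⨆ S : Finset ℤ, (localRep (σ := σ) S).range).topologicalClosure

/-- The spin chain `C*`-algebra with site algebras `M_{σ j}(ℂ)`: the inductive limit of the local
algebras, realised as the norm closure of their union. -/
def SpinAlgebra : Type := quasiLocal σ

instance : IsClosed (quasiLocal σ : Set (ConfigSpace σ →L[ℂ] ConfigSpace σ)) :=
  StarSubalgebra.isClosed_topologicalClosure _

instance : CStarAlgebra (SpinAlgebra σ) := inferInstanceAs (CStarAlgebra (quasiLocal σ))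

/-- The usual order of a `C*`-algebra, with positive elements `star a * a`. -/
instance : PartialOrder (SpinAlgebra σ) := CStarAlgebra.spectralOrder (SpinAlgebra σ)

instance : StarOrderedRing (SpinAlgebra σ) := CStarAlgebra.spectralOrderedRing (SpinAlgebra σ)

variable {σ}

/-- The embedding of the local matrix algebra over `S` in the spin chain algebra. -/
def localEmb (S : Finset ℤ) :
    Matrix (LocalConfig σ S) (LocalConfig σ S) ℂ →⋆ₐ[ℂ] SpinAlgebra σ :=
  (localRep S).codRestrict (quasiLocal σ) (fun a =>
    StarSubalgebra.le_topologicalClosure _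
      (le_iSup (fun S : Finset ℤ => (localRep (σ := σ) S).range) S ⟨a, rfl⟩))

/-- The elementary tensor `⨂_{j ∈ S} a j` as an element of the spin chain algebra. -/
def elemTensor (S : Finset ℤ) (a : ∀ j, Matrix (σ j) (σ j) ℂ) : SpinAlgebra σ :=
  localEmb S (Matrix.of fun m k => ∏ j : S, a j (m j) (k j))

end Algebra

/-! ### Interactions -/

/-- The class of non-increasing, strictly positive functions on `{1, 2, …}` that decay faster than
any power. -/
structure FastDecay (f : ℕ+ → ℝ) : Prop where
  antitone : Antitone f
  pos : ∀ r, 0 < f r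
  decay : ∀ p : ℝ, 0 < p → Tendsto (fun r : ℕ+ => (r : ℝ) ^ p * f r) atTop (𝓝 0)

/-- The diameter of a finite set of sites. -/
def diam (S : Finset ℤ) : ℕ := (S ×ˢ S).sup fun p => (p.1 - p.2).natAbs

section Interactions

variable {σ : ℤ → Type} [∀ j, Fintype (σ j)] [∀ j, DecidableEq (σ j)]

/-- `‖H‖_f = sup_j ∑_{S ∋ j} ‖H_S‖ / f (1 + diam S)`. -/
def interactionNorm (f : ℕ+ → ℝ) (H : Finset ℤ → SpinAlgebra σ) : ℝ≥0∞ :=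
  ⨆ j : ℤ, ∑' S : {S : Finset ℤ // j ∈ S}, ‖H S‖ₑ / ENNReal.ofReal (f (diam S).succPNat)

/-- An interaction with finite `f`-norm: self-adjoint terms `H_S` in the local algebra of `S`. -/
structure IsInteraction (f : ℕ+ → ℝ) (H : Finset ℤ → SpinAlgebra σ) : Prop where
  isSelfAdjoint : ∀ S, IsSelfAdjoint (H S)
  mem_local : ∀ S, H S ∈ (localEmb S).range
  norm_lt_top : interactionNorm f H < ∞

/-- Time-dependent interactions on the time interval `[0, 1]`: for some fast decaying `f`, the
family is bounded in the `f`-norm and strongly measurable, that is, almost everywhere the limit, in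
the `f`-norm, of a sequence of simple functions with values in the interactions. Values at times
outside `[0, 1]` play no role. -/
def IsTDI (H : ℝ → Finset ℤ → SpinAlgebra σ) : Prop :=
  ∃ f : ℕ+ → ℝ, FastDecay f ∧ (∀ s ∈ Icc (0 : ℝ) 1, IsInteraction f (H s)) ∧
    (⨆ s ∈ Icc (0 : ℝ) 1, interactionNorm f (H s)) < ∞ ∧
    ∃ u : ℕ → SimpleFunc ℝ (Finset ℤ → SpinAlgebra σ), (∀ n s, IsInteraction f (u n s)) ∧
      ∀ᵐ s ∂(volume.restrict (Icc (0 : ℝ) 1)),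
        Tendsto (fun n => interactionNorm f (H s - u n s)) atTop (𝓝 0)

/-! ### Almost local evolutions -/

/-- The sum of the terms of the interaction that are supported in the finite set `Λ`. -/
def localHamiltonian (H : ℝ → Finset ℤ → SpinAlgebra σ) (Λ : Finset ℤ) (s : ℝ) : SpinAlgebra σ :=
  ∑ S ∈ Λ.powerset, H s S

/-- `β` is a strongly continuous family of `*`-automorphisms that solves, on `[0, 1]`, the
Heisenberg equation `β_s(a) = a + i ∫_0^s β_u([h(u), a]) du`. -/
def IsHeisenbergSolution (h : ℝ → SpinAlgebra σ) (β : ℝ → SpinAlgebra σ ≃⋆ₐ[ℂ] SpinAlgebra σ) :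
    Prop :=
  ∀ a : SpinAlgebra σ, ContinuousOn (fun s => β s a) (Icc 0 1) ∧
    ∀ s ∈ Icc (0 : ℝ) 1,
      IntervalIntegrable (fun u => β u (h u * a - a * h u)) volume 0 s ∧
      β s a = a + Complex.I • ∫ u in (0 : ℝ)..s, β u (h u * a - a * h u)

/-- `α` is the almost local evolution generated by `H` on `[0, 1]`: the pointwise norm limit of the
finite volume evolutions, along the finite sets `Λ` ordered by inclusion. -/
def IsAlmostLocalEvolution (H : ℝ → Finset ℤ → SpinAlgebra σ)
    (α : ℝ → SpinAlgebra σ ≃⋆ₐ[ℂ] SpinAlgebra σ) : Prop :=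
  ∃ β : Finset ℤ → ℝ → SpinAlgebra σ ≃⋆ₐ[ℂ] SpinAlgebra σ,
    (∀ Λ, IsHeisenbergSolution (localHamiltonian H Λ) (β Λ)) ∧
    ∀ s ∈ Icc (0 : ℝ) 1, ∀ a, Tendsto (fun Λ => β Λ s a) atTop (𝓝 (α s a))

/-- The almost local evolution `α_H`. For a time-dependent interaction it exists and is determined
at all times in `[0, 1]` by `IsAlmostLocalEvolution`. -/
def evolution (H : ℝ → Finset ℤ → SpinAlgebra σ) : ℝ → SpinAlgebra σ ≃⋆ₐ[ℂ] SpinAlgebra σ :=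
  Classical.epsilon (IsAlmostLocalEvolution H)

/-- The truncation of `H` to the left half-line `{…, -1, 0}`. -/
def truncate (H : ℝ → Finset ℤ → SpinAlgebra σ) : ℝ → Finset ℤ → SpinAlgebra σ :=
  fun s S => if ∀ j ∈ S, j ≤ 0 then H s S else 0

/-! ### States -/

/-- States: normalised positive linear functionals. -/
def IsState (ψ : SpinAlgebra σ →ₚ[ℂ] ℂ) : Prop := ψ 1 = 1

/-- Pure states: extremal points of the convex set of states. -/
def IsPureState (ψ : SpinAlgebra σ →ₚ[ℂ] ℂ) : Prop :=
  IsState ψ ∧ ∀ φ₁ φ₂ : SpinAlgebra σ →ₚ[ℂ] ℂ, IsState φ₁ → IsState φ₂ →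
    ∀ t ∈ Ioo (0 : ℝ) 1, (∀ a, ψ a = t * φ₁ a + (1 - t) * φ₂ a) → φ₁ = ψ ∧ φ₂ = ψ

/-- Product states: the state factorises over the sites. -/
def IsProductState (φ : SpinAlgebra σ →ₚ[ℂ] ℂ) : Prop :=
  IsState φ ∧ ∀ (S : Finset ℤ) (a : ∀ j, Matrix (σ j) (σ j) ℂ),
    φ (elemTensor S a) = ∏ j ∈ S, φ (elemTensor {j} a)

/-- `Ψ = ψ ⊗ ψ'` on the tensor product of two spin chain algebras, which is the spin chain algebra
with site algebras `M_{σ j}(ℂ) ⊗ M_{τ j}(ℂ) = M_{σ j × τ j}(ℂ)`. -/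
def IsTensorState {τ : ℤ → Type} [∀ j, Fintype (τ j)] [∀ j, DecidableEq (τ j)]
    (ψ : SpinAlgebra σ →ₚ[ℂ] ℂ) (ψ' : SpinAlgebra τ →ₚ[ℂ] ℂ)
    (Ψ : SpinAlgebra (fun j => σ j × τ j) →ₚ[ℂ] ℂ) : Prop :=
  ∀ (S : Finset ℤ) (a : ∀ j, Matrix (σ j) (σ j) ℂ) (b : ∀ j, Matrix (τ j) (τ j) ℂ),
    Ψ (elemTensor S fun j => Matrix.kronecker (a j) (b j)) =
      ψ (elemTensor S a) * ψ' (elemTensor S b)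

/-- Invertible states: there are a pure state `ψ'` on a second spin chain algebra, with site
dimensions `d j`, a time-dependent interaction `E` and a product state `φ` on the tensor product
algebra such that `ψ ⊗ ψ' = φ ∘ α_E(1)`. -/
def IsInvertible (ψ : SpinAlgebra σ →ₚ[ℂ] ℂ) : Prop :=
  IsPureState ψ ∧ ∃ d : ℤ → ℕ, (∀ j, 0 < d j) ∧
    ∃ ψ' : SpinAlgebra (fun j => Fin (d j)) →ₚ[ℂ] ℂ, IsPureState ψ' ∧
    ∃ Ψ : SpinAlgebra (fun j => σ j × Fin (d j)) →ₚ[ℂ] ℂ, IsTensorState ψ ψ' Ψ ∧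
    ∃ E : ℝ → Finset ℤ → SpinAlgebra (fun j => σ j × Fin (d j)), IsTDI E ∧
    ∃ φ : SpinAlgebra (fun j => σ j × Fin (d j)) →ₚ[ℂ] ℂ, IsProductState φ ∧
      ∀ a, Ψ a = φ (evolution E 1 a)

/-- `ψ` is a loop of pure states on `[0, 1]` that is generated by the time-dependent
interaction `H`. -/
structure IsLoopGeneratedBy (ψ : ℝ → SpinAlgebra σ →ₚ[ℂ] ℂ)
    (H : ℝ → Finset ℤ → SpinAlgebra σ) : Prop where
  isTDI : IsTDI H
  pure : ∀ s ∈ Icc (0 : ℝ) 1, IsPureState (ψ s)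
  path : ∀ s ∈ Icc (0 : ℝ) 1, ∀ a, ψ s a = ψ 0 (evolution H s a)
  closed : ψ 0 = ψ 1

end Interactions

/-! ### Normality -/

/-- The bounded operator `T` has trace `t`: in every orthonormal basis the diagonal matrix elements
are (unconditionally) summable, with sum `t`. -/
def HasTrace {E : Type} [NormedAddCommGroup E] [InnerProductSpace ℂ E] (T : E →L[ℂ] E) (t : ℂ) :
    Prop :=
  ∀ (ι : Type) (b : HilbertBasis ι ℂ E), HasSum (fun i => ⟪b i, T (b i)⟫_ℂ) t

/-- Density matrices: positive operators of trace one. -/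
def IsDensityMatrix {E : Type} [NormedAddCommGroup E] [InnerProductSpace ℂ E] [CompleteSpace E]
    (ρ : E →L[ℂ] E) : Prop :=
  ρ.IsPositive ∧ HasTrace ρ 1

/-- The functional `ω` is normal with respect to `ψ`: with `π` the GNS representation of `ψ`,
there is a density matrix `ρ` on the GNS Hilbert space such that `ω(a) = Tr (ρ π(a))`. -/
def IsNormalWrt {σ : ℤ → Type} [∀ j, Fintype (σ j)] [∀ j, DecidableEq (σ j)]
    (ω : SpinAlgebra σ → ℂ) (ψ : SpinAlgebra σ →ₚ[ℂ] ℂ) : Prop :=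
  ∃ ρ : ψ.GNS →L[ℂ] ψ.GNS, IsDensityMatrix ρ ∧
    ∀ a : SpinAlgebra σ, HasTrace (ρ * ψ.gnsStarAlgHom a) (ω a)

end SpinChain

end

/-!
Cut the chain between the sites `0` and `1`. For an interaction `H` with rapidly decaying terms, the
terms that cross the cut have a finite total norm, and the Lieb–Robinson bound keeps them almost
local under the dynamics. Hence the evolution of `H` is an inner automorphism composed with the
evolution of the decoupled interaction, in which the crossing terms are omitted
(`exists_unitary_evolution_decouple`); the decoupled evolution acts on the two half-lines
separately. On the left half-line it agrees with the evolution `λ` of the truncated interaction,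
and `λ` is trivial on the right half-line.

Let `ψ` be the basepoint of the loop and `Ψ = ψ ⊗ ψ'` the product with its inverse, a state of the
chain with doubled sites. The evolution of `H ⊗ 1` leaves `Ψ` invariant, because the path is a
loop, and `Ψ` arises from a product state by the evolution of some `E`. Modulo inner automorphisms,
therefore, `Ψ` is invariant under the decoupled evolution of `H ⊗ 1`, and `Ψ` itself may be replaced
by a state `Θ` that factorises over the two half-lines; `Θ` is a vector state of the GNS
representation of `Ψ`, given by a vector `Ω'`.

Let `η` be the vector that implements `Θ` composed with the decoupled evolution. The projection onto
the subspace generated from `Ω'` by the observables of the left half-line commutes with these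
observables, and cyclicity of `Ω'` provides an observable `y` of the right half-line such that the
projection `ξ` of `π(y) η` is not zero (`exists_compression`). The functional of `ξ` factorises, with
the same right factor as `Θ ∘ λ`, since `ξ` is a limit of vectors `π(x) Ω'` with `x` in the left
half-line; and on the left half-line it is at most a multiple of `Θ ∘ λ`, since `π(y)` commutes with
the observables there. The difference of the two is a product of positive functionals, so the
domination holds on the whole algebra (`product_domination`). Undoing the inner automorphism gives a
vector `ζ` whose functional is at most a multiple of `Ψ ∘ λ`
(`exists_vector_dominated_by_pumped`).

A second compression, to the subspace generated from the GNS vacuum by the first factor of the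
doubled chain, yields a vector in a copy of the GNS space of `ψ` whose functional is at most a
multiple of the pumped state `ψ ∘ λ`. The pumped state is pure, so the two are proportional
(`IsPureState.eq_smul_of_le`), and the pumped state is a vector state in the GNS representation
of `ψ` (`isNormalWrt_of_vector`).

The existence of the evolutions and the Lieb–Robinson bound are proved from the Heisenberg equation
in finite volume. The bound controls the oscillations of an evolved observable, that is, the mean
norms of its commutators with the elements of a finite group that generates the algebra of a site,
by a weighted Gronwall argument (`sum_weight_osc_evolution_le`).
-/

noncomputable section

namespace SpinChain

/-! ### Primitives of bounded measurable functions on the unit interval -/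

section Calculus

variable {E : Type*} [NormedAddCommGroup E]

/-- A function that is bounded on `[0, 1]` and almost everywhere strongly measurable there. -/
structure IsBddMeas (f : ℝ → E) : Prop where
  bdd : ∃ C, 0 ≤ C ∧ ∀ u ∈ Icc (0 : ℝ) 1, ‖f u‖ ≤ C
  meas : AEStronglyMeasurable f (volume.restrict (Icc (0 : ℝ) 1))

theorem IsBddMeas.of_bdd {f : ℝ → E} {C : ℝ} (h : ∀ u ∈ Icc (0 : ℝ) 1, ‖f u‖ ≤ C)
    (hm : AEStronglyMeasurable f (volume.restrict (Icc (0 : ℝ) 1))) : IsBddMeas f :=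
  ⟨⟨C, (norm_nonneg _).trans (h 0 (by simp)), h⟩, hm⟩

theorem IsBddMeas.of_continuousOn {f : ℝ → E} (h : ContinuousOn f (Icc 0 1)) : IsBddMeas f := by
  obtain ⟨C, hC⟩ := isCompact_Icc.exists_bound_of_continuousOn h
  exact .of_bdd hC (h.aestronglyMeasurable measurableSet_Icc)

theorem IsBddMeas.integrableOn {f : ℝ → E} (h : IsBddMeas f) :
    IntegrableOn f (Icc (0 : ℝ) 1) volume := by
  obtain ⟨C, -, hC⟩ := h.bdd
  refine Integrable.of_bound h.meas C ?_
  exact (ae_restrict_iff' measurableSet_Icc).2 (Eventually.of_forall hC)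

theorem IsBddMeas.intervalIntegrable {f : ℝ → E} (h : IsBddMeas f) {a b : ℝ}
    (ha : a ∈ Icc (0 : ℝ) 1) (hb : b ∈ Icc (0 : ℝ) 1) : IntervalIntegrable f volume a b := by
  refine (h.integrableOn.mono_set ?_).intervalIntegrable
  exact (convex_Icc (0 : ℝ) 1).ordConnected.uIcc_subset ha hb

theorem IsBddMeas.add {f g : ℝ → E} (hf : IsBddMeas f) (hg : IsBddMeas g) :
    IsBddMeas fun u => f u + g u := by
  obtain ⟨C, h0, hC⟩ := hf.bdd
  obtain ⟨C', h0', hC'⟩ := hg.bdd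
  exact .of_bdd (C := C + C') (fun u hu => (norm_add_le _ _).trans
    (add_le_add (hC u hu) (hC' u hu))) (hf.meas.add hg.meas)

theorem IsBddMeas.sub {f g : ℝ → E} (hf : IsBddMeas f) (hg : IsBddMeas g) :
    IsBddMeas fun u => f u - g u := by
  obtain ⟨C, h0, hC⟩ := hf.bdd
  obtain ⟨C', h0', hC'⟩ := hg.bdd
  exact .of_bdd (C := C + C') (fun u hu => (norm_sub_le _ _).trans
    (add_le_add (hC u hu) (hC' u hu))) (hf.meas.sub hg.meas)

theorem IsBddMeas.sum {ι : Type*} (s : Finset ι) {f : ι → ℝ → E}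
    (hf : ∀ i ∈ s, IsBddMeas (f i)) : IsBddMeas fun u => ∑ i ∈ s, f i u := by
  classical
  induction s using Finset.induction_on with
  | empty => simpa using IsBddMeas.of_continuousOn (f := fun _ => (0 : E)) continuousOn_const
  | insert i s hi ih =>
    simp only [Finset.sum_insert hi]
    exact (hf i (by simp)).add (ih fun j hj => hf j (by simp [hj]))

theorem IsBddMeas.mul {R : Type*} [NormedRing R] {f g : ℝ → R}
    (hf : IsBddMeas f) (hg : IsBddMeas g) : IsBddMeas fun u => f u * g u := by
  obtain ⟨C, h0, hC⟩ := hf.bdd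
  obtain ⟨C', h0', hC'⟩ := hg.bdd
  exact .of_bdd (C := C * C') (fun u hu => (norm_mul_le _ _).trans
    (mul_le_mul (hC u hu) (hC' u hu) (norm_nonneg _) h0)) (hf.meas.mul hg.meas)

theorem IsBddMeas.const_smul [NormedSpace ℂ E] {f : ℝ → E}
    (hf : IsBddMeas f) (c : ℂ) : IsBddMeas fun u => c • f u := by
  obtain ⟨C, h0, hC⟩ := hf.bdd
  refine .of_bdd (C := ‖c‖ * C) (fun u hu => ?_) (hf.meas.const_smul c)
  rw [norm_smul]
  gcongr
  exact hC u hu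

theorem IsBddMeas.norm {f : ℝ → E} (hf : IsBddMeas f) : IsBddMeas fun u => ‖f u‖ := by
  obtain ⟨C, h0, hC⟩ := hf.bdd
  exact .of_bdd (C := C) (fun u hu => by simpa using hC u hu) hf.meas.norm

variable [NormedSpace ℝ E]

theorem IsBddMeas.clm_comp {E' : Type*} [NormedAddCommGroup E'] [NormedSpace ℝ E'] {f : ℝ → E}
    (h : IsBddMeas f) (L : E →L[ℝ] E') : IsBddMeas fun u => L (f u) := by
  obtain ⟨C, h0, hC⟩ := h.bdd
  refine .of_bdd (C := ‖L‖ * C) (fun u hu => (L.le_opNorm _).trans ?_)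
    (L.continuous.comp_aestronglyMeasurable h.meas)
  gcongr
  exact hC u hu

/-- `F` is on `[0, 1]` a primitive of the bounded measurable function `f`. -/
structure IsPrim (F f : ℝ → E) : Prop extends IsBddMeas f where
  eq : ∀ s ∈ Icc (0 : ℝ) 1, F s = F 0 + ∫ u in (0 : ℝ)..s, f u

theorem IsPrim.sub_eq {F f : ℝ → E} (h : IsPrim F f) {a b : ℝ} (ha : a ∈ Icc (0 : ℝ) 1)
    (hb : b ∈ Icc (0 : ℝ) 1) : F b - F a = ∫ u in a..b, f u := by
  rw [h.eq b hb, h.eq a ha, add_sub_add_left_eq_sub, intervalIntegral.integral_interval_sub_left]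
  · exact h.intervalIntegrable (by simp) hb
  · exact h.intervalIntegrable (by simp) ha

theorem IsPrim.exists_lipschitz {F f : ℝ → E} (h : IsPrim F f) :
    ∃ K, LipschitzOnWith K F (Icc 0 1) := by
  obtain ⟨C, h0, hC⟩ := h.bdd
  refine ⟨⟨C, h0⟩, LipschitzOnWith.of_dist_le_mul fun b hb a ha => ?_⟩
  rw [dist_eq_norm, h.sub_eq ha hb, Real.dist_eq]
  refine intervalIntegral.norm_integral_le_of_norm_le_const fun u hu => hC u ?_
  exact (convex_Icc (0 : ℝ) 1).ordConnected.uIcc_subset ha hb (uIoc_subset_uIcc hu)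

theorem IsPrim.continuousOn {F f : ℝ → E} (h : IsPrim F f) : ContinuousOn F (Icc 0 1) :=
  h.exists_lipschitz.choose_spec.continuousOn

theorem IsPrim.ae_hasDerivAt [CompleteSpace E] {F f : ℝ → E} (h : IsPrim F f) :
    ∀ᵐ u, u ∈ Icc (0 : ℝ) 1 → HasDerivAt F (f u) u := by
  have h1 := (h.intervalIntegrable (a := 0) (b := 1) (by simp) (by simp)).ae_hasDerivAt_integral
  have e0 : ∀ᵐ x : ℝ, x ≠ 0 := by simp [ae_iff, measure_singleton]
  have e1 : ∀ᵐ x : ℝ, x ≠ 1 := by simp [ae_iff, measure_singleton]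
  filter_upwards [h1, e0, e1] with u hu hu0 hu1 hmem
  have hd := (hu (by simpa using hmem) 0 (by simp)).const_add (F 0)
  refine hd.congr_of_eventuallyEq ?_
  have hn : Icc (0 : ℝ) 1 ∈ 𝓝 u :=
    Icc_mem_nhds (lt_of_le_of_ne hmem.1 (Ne.symm hu0)) (lt_of_le_of_ne hmem.2 hu1)
  filter_upwards [hn] with s hs using h.eq s hs

/-- A Lipschitz function is a primitive of its almost everywhere derivative. -/
theorem IsPrim.of_lipschitz [CompleteSpace E] {F f : ℝ → E} {K : NNReal}
    (hF : LipschitzOnWith K F (Icc 0 1)) (hf : IsBddMeas f)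
    (hd : ∀ᵐ u, u ∈ Icc (0 : ℝ) 1 → HasDerivAt F (f u) u) : IsPrim F f := by
  set G : ℝ → E := fun s => ∫ u in (0 : ℝ)..s, f u with hG
  have hGp : IsPrim G f := ⟨hf, fun s hs => by simp [hG]⟩
  obtain ⟨K', hK'⟩ := hGp.exists_lipschitz
  have hac := ((hF.sub hK').mono (s := uIcc (0 : ℝ) 1) (by simp)).absolutelyContinuousOnInterval
  obtain ⟨C, hC⟩ := hac.const_of_ae_hasDerivAt_zero (by
    filter_upwards [hd, hGp.ae_hasDerivAt] with u h1 h2 hu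
    have hu' : u ∈ Icc (0 : ℝ) 1 := by simpa using hu
    have h3 := (h1 hu').sub (h2 hu')
    rwa [sub_self] at h3)
  refine ⟨hf, fun s hs => ?_⟩
  have hs1 := hC s (by simpa using hs)
  have hs0 := hC 0 (by simp)
  simp only [hG, intervalIntegral.integral_same, sub_zero] at hs0 hs1
  rw [hs0, ← hs1]
  abel

/-- The product rule. -/
theorem IsPrim.mul {R : Type*} [NormedRing R] [NormedAlgebra ℝ R] [CompleteSpace R]
    {F f G g : ℝ → R} (hF : IsPrim F f) (hG : IsPrim G g) :
    IsPrim (fun s => F s * G s) (fun s => f s * G s + F s * g s) := by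
  obtain ⟨K, hK⟩ := hF.exists_lipschitz
  obtain ⟨K', hK'⟩ := hG.exists_lipschitz
  obtain ⟨C, hC0, hC⟩ := (IsBddMeas.of_continuousOn hF.continuousOn).bdd
  obtain ⟨C', hC0', hC'⟩ := (IsBddMeas.of_continuousOn hG.continuousOn).bdd
  have hL : LipschitzOnWith (C.toNNReal * K' + K * C'.toNNReal) (fun s => F s * G s) (Icc 0 1) := by
    refine LipschitzOnWith.of_dist_le_mul fun x hx y hy => ?_
    have e : F x * G x - F y * G y = F x * (G x - G y) + (F x - F y) * G y := by noncomm_ring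
    rw [dist_eq_norm, e]
    calc ‖F x * (G x - G y) + (F x - F y) * G y‖
        ≤ ‖F x‖ * ‖G x - G y‖ + ‖F x - F y‖ * ‖G y‖ :=
          (norm_add_le _ _).trans (add_le_add (norm_mul_le _ _) (norm_mul_le _ _))
      _ ≤ C * (K' * dist x y) + (K * dist x y) * C' := by
          have h1 := hK.dist_le_mul x hx y hy
          have h2 := hK'.dist_le_mul x hx y hy
          rw [dist_eq_norm] at h1 h2
          gcongr
          · exact hC x hx
          · exact hC' y hy
      _ = _ := by push_cast; rw [Real.coe_toNNReal _ hC0, Real.coe_toNNReal _ hC0']; ring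
  refine .of_lipschitz hL ?_ ?_
  · exact (hF.toIsBddMeas.mul (.of_continuousOn hG.continuousOn)).add
      ((IsBddMeas.of_continuousOn hF.continuousOn).mul hG.toIsBddMeas)
  · filter_upwards [hF.ae_hasDerivAt, hG.ae_hasDerivAt] with u h1 h2 hu
    exact (h1 hu).mul (h2 hu)

theorem IsPrim.congr {F f g : ℝ → E} (h : IsPrim F f) (hg : IsBddMeas g)
    (hfg : ∀ u ∈ Icc (0 : ℝ) 1, f u = g u) : IsPrim F g := by
  refine ⟨hg, fun s hs => ?_⟩
  rw [h.eq s hs]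
  congr 1
  refine intervalIntegral.integral_congr fun u hu => hfg u ?_
  rw [uIcc_of_le hs.1] at hu
  exact ⟨hu.1, hu.2.trans hs.2⟩

theorem IsPrim.congr' {F f g : ℝ → E} (h : IsPrim F f)
    (hfg : ∀ u ∈ Icc (0 : ℝ) 1, f u = g u) : IsPrim F g := by
  obtain ⟨C, h0, hC⟩ := h.bdd
  refine h.congr (.of_bdd (C := C) (fun u hu => by rw [← hfg u hu]; exact hC u hu) ?_) hfg
  refine h.meas.congr ?_
  exact (ae_restrict_iff' measurableSet_Icc).2 (Eventually.of_forall hfg)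

theorem IsPrim.clm_comp [CompleteSpace E] {E' : Type*} [NormedAddCommGroup E'] [NormedSpace ℝ E']
    [CompleteSpace E'] {F f : ℝ → E} (h : IsPrim F f) (L : E →L[ℝ] E') :
    IsPrim (fun u => L (F u)) (fun u => L (f u)) := by
  refine ⟨h.toIsBddMeas.clm_comp L, fun s hs => ?_⟩
  rw [h.eq s hs, map_add, L.intervalIntegral_comp_comm (h.intervalIntegrable (by simp) hs)]

theorem IsPrim.sub [CompleteSpace E] {F f G g : ℝ → E} (h : IsPrim F f) (h' : IsPrim G g) :
    IsPrim (fun u => F u - G u) (fun u => f u - g u) := by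
  refine ⟨h.toIsBddMeas.sub h'.toIsBddMeas, fun s hs => ?_⟩
  rw [h.eq s hs, h'.eq s hs, intervalIntegral.integral_sub (h.intervalIntegrable (by simp) hs)
    (h'.intervalIntegrable (by simp) hs)]
  abel

theorem IsPrim.const (x : E) : IsPrim (fun _ => x) (fun _ => (0 : E)) :=
  ⟨.of_continuousOn continuousOn_const, by simp⟩

theorem IsPrim.star {R : Type*} [CStarAlgebra R] {F f : ℝ → R} (h : IsPrim F f) :
    IsPrim (fun u => star (F u)) (fun u => star (f u)) :=
  h.clm_comp (starL' ℝ : R ≃L[ℝ] R).toContinuousLinearMap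

theorem IsPrim.norm_sub_le {F f : ℝ → E} (h : IsPrim F f) {C a b : ℝ} (ha : a ∈ Icc (0 : ℝ) 1)
    (hb : b ∈ Icc (0 : ℝ) 1) (hC : ∀ u ∈ Icc (0 : ℝ) 1, ‖f u‖ ≤ C) : ‖F b - F a‖ ≤ C := by
  have h0 : 0 ≤ C := (norm_nonneg _).trans (hC 0 (by simp))
  rw [h.sub_eq ha hb]
  refine (intervalIntegral.norm_integral_le_of_norm_le_const (C := C) fun u hu => hC u ?_).trans ?_
  · exact (convex_Icc (0 : ℝ) 1).ordConnected.uIcc_subset ha hb (uIoc_subset_uIcc hu)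
  · refine mul_le_of_le_one_right h0 ?_
    rw [abs_le]
    constructor <;> linarith [ha.1, ha.2, hb.1, hb.2]

/-- Grönwall's inequality in integral form, forward in time. -/
theorem gronwall_forward {φ : ℝ → ℝ} (hφ : Continuous φ) {c K L : ℝ} (hK : 0 ≤ K)
    (h : ∀ u ∈ Icc 0 L, φ u ≤ c + K * ∫ r in (0 : ℝ)..u, φ r) :
    ∀ u ∈ Icc 0 L, φ u ≤ c * Real.exp (K * u) := by
  intro u hu
  have hd : ∀ x, HasDerivAt (fun u => c + K * ∫ r in (0 : ℝ)..u, φ r) (K * φ x) x := fun x =>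
    ((hφ.integral_hasStrictDerivAt 0 x).hasDerivAt.const_mul K).const_add c
  have := le_gronwallBound_of_liminf_deriv_right_le (f := fun u => c + K * ∫ r in (0 : ℝ)..u, φ r)
    (f' := fun x => K * φ x) (δ := c) (K := K) (ε := 0) (a := 0) (b := L)
    (fun x _ => (hd x).continuousAt.continuousWithinAt)
    (fun x _ r hr => (hd x).hasDerivWithinAt.liminf_right_slope_le hr)
    (by simp) (fun x hx => by
      rw [add_zero]
      exact mul_le_mul_of_nonneg_left (h x ⟨hx.1, hx.2.le⟩) hK) u hu
  rw [gronwallBound_ε0, sub_zero] at this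
  exact (h u hu).trans this

/-- Grönwall's inequality in integral form on `[0, 1]`, with base point `t`. -/
theorem gronwall_Icc {φ : ℝ → ℝ} (hφ : ContinuousOn φ (Icc 0 1)) {c K t : ℝ} (hK : 0 ≤ K)
    (hc : 0 ≤ c) (ht : t ∈ Icc (0 : ℝ) 1)
    (h : ∀ u ∈ Icc (0 : ℝ) 1, φ u ≤ c + K * |∫ r in t..u, φ r|)
    (h0 : ∀ u ∈ Icc (0 : ℝ) 1, 0 ≤ φ u) :
    ∀ u ∈ Icc (0 : ℝ) 1, φ u ≤ c * Real.exp K := by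
  set Φ : ℝ → ℝ := IccExtend zero_le_one ((Icc (0 : ℝ) 1).domRestrict φ) with hΦ
  have hΦc : Continuous Φ := (continuousOn_iff_continuous_domRestrict.1 hφ).Icc_extend'
  have hΦe : ∀ u ∈ Icc (0 : ℝ) 1, Φ u = φ u := fun u hu => by
    rw [hΦ, IccExtend_of_mem _ _ hu]; rfl
  have hΦ0 : ∀ u, 0 ≤ Φ u := fun u => h0 _ (Subtype.prop _)
  have hΦi : ∀ u ∈ Icc (0 : ℝ) 1, ∫ r in t..u, φ r = ∫ r in t..u, Φ r := fun u hu =>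
    intervalIntegral.integral_congr fun r hr =>
      (hΦe r ((convex_Icc (0 : ℝ) 1).ordConnected.uIcc_subset ht hu hr)).symm
  intro u hu
  rcases le_total t u with htu | htu
  · have := gronwall_forward (φ := fun x => Φ (t + x)) (by fun_prop) (c := c) (L := 1 - t) hK
      (fun x hx => by
        have hx' : t + x ∈ Icc (0 : ℝ) 1 := ⟨by linarith [ht.1, hx.1], by linarith [hx.2]⟩
        rw [intervalIntegral.integral_comp_add_left (fun r => Φ r), hΦe _ hx', add_zero,
          ← hΦi _ hx']
        refine (h _ hx').trans_eq ?_
        rw [abs_of_nonneg]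
        rw [hΦi _ hx']
        exact intervalIntegral.integral_nonneg (by linarith [hx.1]) fun r _ => hΦ0 r) (u - t)
      ⟨by linarith, by linarith [hu.2]⟩
    rw [show t + (u - t) = u by ring, hΦe u hu] at this
    refine this.trans ?_
    gcongr
    nlinarith [hu.2, ht.1]
  · have := gronwall_forward (φ := fun x => Φ (t - x)) (by fun_prop) (c := c) (L := t) hK
      (fun x hx => by
        have hx' : t - x ∈ Icc (0 : ℝ) 1 := ⟨by linarith [hx.2], by linarith [hx.1, ht.2]⟩
        rw [intervalIntegral.integral_comp_sub_left (fun r => Φ r), hΦe _ hx', sub_zero]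
        refine (h _ hx').trans_eq ?_
        rw [hΦi _ hx', intervalIntegral.integral_symm, abs_neg, abs_of_nonneg]
        exact intervalIntegral.integral_nonneg (by linarith [hx.1]) fun r _ => hΦ0 r) (t - u)
      ⟨by linarith, by linarith [hu.1]⟩
    rw [show t - (t - u) = u by ring, hΦe u hu] at this
    refine this.trans ?_
    gcongr
    nlinarith [hu.1, ht.2]

/-- Uniqueness for linear Volterra equations with a strongly continuous family of maps. The
generator `D u` needs to be bounded only on a set `P` that it maps to itself. -/
theorem volterra_eq_zero {X Y : Type*} [NormedAddCommGroup X] [NormedAddCommGroup Y]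
    [NormedSpace ℝ Y] (P : Set X) (T : ℝ → X → Y) (D : ℝ → X → X) {C M : ℝ}
    (hT : ∀ s ∈ Icc (0 : ℝ) 1, ∀ x ∈ P, ‖T s x‖ ≤ C * ‖x‖)
    (hC : 0 ≤ C) (hM : 0 ≤ M)
    (hP : ∀ s ∈ Icc (0 : ℝ) 1, ∀ x ∈ P, D s x ∈ P)
    (hD : ∀ s ∈ Icc (0 : ℝ) 1, ∀ x ∈ P, ‖D s x‖ ≤ M * ‖x‖)
    (heq : ∀ s ∈ Icc (0 : ℝ) 1, ∀ x ∈ P, T s x = ∫ u in (0 : ℝ)..s, T u (D u x)) :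
    ∀ s ∈ Icc (0 : ℝ) 1, ∀ x ∈ P, T s x = 0 := by
  have key : ∀ n : ℕ, ∀ s ∈ Icc (0 : ℝ) 1, ∀ x ∈ P,
      ‖T s x‖ ≤ C * ‖x‖ * ((M * s) ^ n / n.factorial) := by
    intro n
    induction n with
    | zero => simpa using hT
    | succ n ih =>
      intro s hs x hx
      have hb : ∀ u ∈ Ioc 0 s, ‖T u (D u x)‖ ≤
          C * ‖x‖ * (M ^ (n + 1) / n.factorial) * u ^ n := by
        intro u hu
        have hu' : u ∈ Icc (0 : ℝ) 1 := ⟨hu.1.le, hu.2.trans hs.2⟩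
        refine (ih u hu' _ (hP u hu' x hx)).trans ?_
        have hp : 0 ≤ (M * u) ^ n / n.factorial :=
          div_nonneg (pow_nonneg (mul_nonneg hM hu'.1) _) (by positivity)
        calc C * ‖D u x‖ * ((M * u) ^ n / n.factorial)
            ≤ C * (M * ‖x‖) * ((M * u) ^ n / n.factorial) := by
              gcongr
              exact hD u hu' x hx
          _ = _ := by rw [mul_pow]; ring
      rw [heq s hs x hx]
      refine (intervalIntegral.norm_integral_le_of_norm_le hs.1
        (Eventually.of_forall fun u hu => hb u hu)
        (Continuous.intervalIntegrable (by fun_prop) _ _)).trans_eq ?_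
      rw [intervalIntegral.integral_const_mul, integral_pow, Nat.factorial_succ]
      push_cast
      have : (n.factorial : ℝ) ≠ 0 := by positivity
      have : (n : ℝ) + 1 ≠ 0 := by positivity
      field_simp
      simp [mul_pow, mul_assoc]
  intro s hs x hx
  have hlim : Tendsto (fun n : ℕ => C * ‖x‖ * ((M * s) ^ n / n.factorial)) atTop (𝓝 0) := by
    simpa using (FloorSemiring.tendsto_pow_div_factorial_atTop (M * s)).const_mul (C * ‖x‖)
  exact norm_le_zero_iff.1 (ge_of_tendsto' hlim fun n => key n s hs x hx)

end Calculus

/-! ### The time-ordered exponential -/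

section Dyson

variable {R : Type*} [CStarAlgebra R]

/-- The terms of the Dyson series. -/
def dysonTerm (h : ℝ → R) : ℕ → ℝ → R
  | 0 => fun _ => 1
  | n + 1 => fun s => ∫ u in (0 : ℝ)..s, dysonTerm h n u * h u

theorem dysonTerm_zero_right (h : ℝ → R) (n : ℕ) : dysonTerm h (n + 1) 0 = 0 := by
  simp [dysonTerm]

theorem isPrim_dysonTerm {h : ℝ → R} (hh : IsBddMeas h) (n : ℕ) :
    IsPrim (dysonTerm h (n + 1)) (fun u => dysonTerm h n u * h u) := by
  induction n with
  | zero =>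
    refine ⟨?_, fun s hs => by simp only [dysonTerm, intervalIntegral.integral_same, zero_add]⟩
    simpa [dysonTerm] using hh
  | succ n ih =>
    exact ⟨(IsBddMeas.of_continuousOn ih.continuousOn).mul hh,
      fun s hs => by simp only [dysonTerm, intervalIntegral.integral_same, zero_add]⟩

theorem continuousOn_dysonTerm {h : ℝ → R} (hh : IsBddMeas h) (n : ℕ) :
    ContinuousOn (dysonTerm h n) (Icc 0 1) := by
  cases n with
  | zero => exact continuousOn_const
  | succ n => exact (isPrim_dysonTerm hh n).continuousOn

theorem norm_dysonTerm_le {h : ℝ → R} {M : ℝ} (hM0 : 0 ≤ M)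
    (hM : ∀ u ∈ Icc (0 : ℝ) 1, ‖h u‖ ≤ M) (n : ℕ) :
    ∀ s ∈ Icc (0 : ℝ) 1, ‖dysonTerm h n s‖ ≤ ‖(1 : R)‖ * (M ^ n / n.factorial) * s ^ n := by
  induction n with
  | zero => intro s hs; simp [dysonTerm]
  | succ n ih =>
    intro s hs
    refine (intervalIntegral.norm_integral_le_of_norm_le hs.1
      (g := fun u => ‖(1 : R)‖ * (M ^ n / n.factorial) * M * u ^ n)
      (Eventually.of_forall fun u hu => ?_)
      (Continuous.intervalIntegrable (by fun_prop) _ _)).trans_eq ?_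
    · have hu' : u ∈ Icc (0 : ℝ) 1 := ⟨hu.1.le, hu.2.trans hs.2⟩
      refine (norm_mul_le _ _).trans ?_
      calc ‖dysonTerm h n u‖ * ‖h u‖
          ≤ (‖(1 : R)‖ * (M ^ n / n.factorial) * u ^ n) * M := by
            have := hu'.1
            gcongr
            · exact ih u hu'
            · exact hM u hu'
        _ = _ := by ring
    · rw [intervalIntegral.integral_const_mul, integral_pow, Nat.factorial_succ]
      push_cast
      have : (n.factorial : ℝ) ≠ 0 := by positivity
      have : (n : ℝ) + 1 ≠ 0 := by positivity
      field_simp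
      simp [pow_succ]
      ring_nf

/-- Existence for the linear equation `V' = V h` in a Banach algebra. -/
theorem exists_isPrim_mul {h : ℝ → R} (hh : IsBddMeas h) :
    ∃ V : ℝ → R, V 0 = 1 ∧ IsPrim V (fun u => V u * h u) := by
  obtain ⟨M, hM0, hM⟩ := hh.bdd
  set B : ℕ → ℝ := fun n => ‖(1 : R)‖ * (M ^ n / n.factorial) with hB
  have hBs : Summable B := (Real.summable_pow_div_factorial M).mul_left _
  have hle : ∀ n, ∀ s ∈ Icc (0 : ℝ) 1, ‖dysonTerm h n s‖ ≤ B n := fun n s hs =>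
    (norm_dysonTerm_le hM0 hM n s hs).trans
      (mul_le_of_le_one_right (by positivity) (pow_le_one₀ hs.1 hs.2))
  have hsum : ∀ s ∈ Icc (0 : ℝ) 1, Summable fun n => dysonTerm h n s := fun s hs =>
    Summable.of_norm_bounded hBs fun n => hle n s hs
  set V : ℝ → R := fun s => ∑' n, dysonTerm h n s with hV
  have hVc : ContinuousOn V (Icc 0 1) :=
    continuousOn_tsum (fun n => continuousOn_dysonTerm hh n) hBs hle
  have hV0 : V 0 = 1 := by
    simp only [hV]
    rw [tsum_eq_single 0]
    · rfl
    · intro n hn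
      obtain ⟨m, rfl⟩ := Nat.exists_eq_succ_of_ne_zero hn
      exact dysonTerm_zero_right h m
  refine ⟨V, hV0, (IsBddMeas.of_continuousOn hVc).mul hh, fun s hs => ?_⟩
  have hi : HasSum (fun n => ∫ u in (0 : ℝ)..s, dysonTerm h n u * h u)
      (∫ u in (0 : ℝ)..s, V u * h u) := by
    have hsub : uIoc 0 s ⊆ Icc (0 : ℝ) 1 := by
      rw [uIoc_of_le hs.1]
      exact fun u hu => ⟨hu.1.le, hu.2.trans hs.2⟩
    refine intervalIntegral.hasSum_integral_of_dominated_convergence (fun n _ => B n * M)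
      (fun n => ?_) (fun n => ?_) ?_ ?_ ?_
    · exact (((IsBddMeas.of_continuousOn (continuousOn_dysonTerm hh n)).mul hh).meas).mono_measure
        (Measure.restrict_mono hsub le_rfl)
    · refine Eventually.of_forall fun u hu => (norm_mul_le _ _).trans ?_
      exact mul_le_mul (hle n u (hsub hu)) (hM u (hsub hu)) (norm_nonneg _)
        ((norm_nonneg _).trans (hle n u (hsub hu)))
    · exact Eventually.of_forall fun u hu => hBs.mul_right M
    · exact intervalIntegrable_const
    · exact Eventually.of_forall fun u hu => (hsum u (hsub hu)).hasSum.mul_right (h u)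
  rw [hV0, ← hi.tsum_eq]
  exact (hsum s hs).tsum_eq_zero_add

/-- The time-ordered exponential of a bounded measurable family of self-adjoint elements:
a unitary solution of `V' = i V h`. -/
theorem exists_unitary_isPrim {h : ℝ → R} (hh : IsBddMeas h)
    (hsa : ∀ u ∈ Icc (0 : ℝ) 1, IsSelfAdjoint (h u)) :
    ∃ V : ℝ → R, V 0 = 1 ∧ (∀ s ∈ Icc (0 : ℝ) 1, V s ∈ unitary R) ∧
      IsPrim V (fun u => Complex.I • (V u * h u)) := by
  obtain ⟨V, hV0, hV⟩ := exists_isPrim_mul (hh.const_smul Complex.I)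
  obtain ⟨M, hM0, hM⟩ := hh.bdd
  have hVc := hV.continuousOn
  have hst : IsPrim (fun u => star (V u)) (fun u => -(Complex.I • (h u * star (V u)))) :=
    hV.star.congr' fun u hu => by
      rw [star_mul, star_smul, (hsa u hu).star_eq]
      simp
  have h1 : ∀ s ∈ Icc (0 : ℝ) 1, V s * star (V s) = 1 := by
    intro s hs
    have hp := (hV.mul hst).congr' (g := fun _ => 0) fun u hu => by
      simp [mul_assoc]
    have := hp.eq s hs
    simpa [hV0] using this
  have h2 : ∀ s ∈ Icc (0 : ℝ) 1, star (V s) * V s = 1 := by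
    set X : ℝ → R := fun s => star (V s) * V s - 1 with hX
    have hp : IsPrim X (fun u => Complex.I • (X u * h u - h u * X u)) :=
      ((hst.mul hV).sub (IsPrim.const 1)).congr' fun u hu => by
        simp only [hX]
        simp only [mul_assoc, mul_smul_comm, smul_mul_assoc, sub_zero, neg_mul, sub_mul, mul_sub,
          one_mul, mul_one, smul_sub]
        abel
    have hXc := hp.continuousOn
    have hX0 : X 0 = 0 := by simp [hX, hV0]
    have := gronwall_Icc hXc.norm (c := 0) (K := 2 * M) (t := 0) (by positivity) le_rfl (by simp)
      (fun u hu => by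
        rw [hp.eq u hu, hX0, zero_add, zero_add]
        have hb : ∀ r ∈ Ioc 0 u, ‖Complex.I • (X r * h r - h r * X r)‖ ≤ 2 * M * ‖X r‖ := by
          intro r hr
          have hr' : r ∈ Icc (0 : ℝ) 1 := ⟨hr.1.le, hr.2.trans hu.2⟩
          rw [norm_smul, Complex.norm_I, one_mul]
          refine (norm_sub_le _ _).trans ?_
          have e1 := norm_mul_le (X r) (h r)
          have e2 := norm_mul_le (h r) (X r)
          nlinarith [hM r hr', norm_nonneg (X r)]
        refine (intervalIntegral.norm_integral_le_of_norm_le hu.1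
          (Eventually.of_forall fun r hr => hb r hr) ?_).trans ?_
        · exact ((IsBddMeas.of_continuousOn hXc.norm).intervalIntegrable
            (by simp) hu).const_mul (2 * M)
        · rw [intervalIntegral.integral_const_mul]
          gcongr
          exact le_abs_self _)
      (fun u _ => norm_nonneg _)
    intro s hs
    have h3 := this s hs
    rw [zero_mul, norm_le_zero_iff] at h3
    exact sub_eq_zero.1 h3
  refine ⟨V, hV0, fun s hs => ⟨h2 s hs, h1 s hs⟩, hV.congr' fun u _ => by simp⟩

end Dyson

/-! ### Local subalgebras of the spin chain algebra -/

section Local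

variable {σ : ℤ → Type} [∀ j, Fintype (σ j)] [∀ j, DecidableEq (σ j)]

/-- The inclusion of the spin chain algebra in the bounded operators on `ℓ²(Config)`. -/
def toOp : SpinAlgebra σ →⋆ₐ[ℂ] (ConfigSpace σ →L[ℂ] ConfigSpace σ) := (quasiLocal σ).subtype

theorem toOp_injective : Function.Injective (toOp (σ := σ)) := Subtype.val_injective

theorem toOp_localEmb (S : Finset ℤ) (a : Matrix (LocalConfig σ S) (LocalConfig σ S) ℂ) :
    toOp (localEmb S a) = localOp S a := rfl

theorem localEmb_ext {S : Finset ℤ} {a : Matrix (LocalConfig σ S) (LocalConfig σ S) ℂ}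
    {x : SpinAlgebra σ} (h : ∀ ξ m, toOp x ξ m = ∑ l, a (restr S m) l * ξ (override S m l)) :
    x = localEmb S a := by
  apply toOp_injective
  ext ξ m
  rw [h, toOp_localEmb, localOp_apply]

/-- The local algebra of the finite set `S` of sites. -/
def localAlg (S : Finset ℤ) : StarSubalgebra ℂ (SpinAlgebra σ) := (localEmb S).range

theorem localEmb_mem (S : Finset ℤ) (a : Matrix (LocalConfig σ S) (LocalConfig σ S) ℂ) :
    localEmb S a ∈ localAlg S := ⟨a, rfl⟩

theorem localAlg_mono {S T : Finset ℤ} (h : S ⊆ T) :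
    localAlg (σ := σ) S ≤ localAlg T := by
  rintro _ ⟨a, rfl⟩
  set r : LocalConfig σ T → LocalConfig σ S := fun k j => k ⟨j, h j.2⟩
  refine ⟨Matrix.of fun k l => if (∀ j : T, (j : ℤ) ∉ S → k j = l j) then a (r k) (r l) else 0, ?_⟩
  symm
  refine localEmb_ext fun ξ m => ?_
  change toOp (localEmb S a) ξ m = _
  rw [toOp_localEmb, localOp_apply]
  refine Fintype.sum_of_injective (fun l => restr T (override S m l)) ?_ _ _ ?_ ?_
  · intro l l' hl
    funext j
    have := congrFun hl ⟨j, h j.2⟩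
    simpa [restr, override] using this
  · intro k hk
    rw [Matrix.of_apply, if_neg, zero_mul]
    intro hk'
    refine hk ⟨r k, ?_⟩
    funext j
    by_cases hj : (j : ℤ) ∈ S
    · simp [restr, override, hj, r]
    · simp [restr, override, hj, ← hk' j hj]
  · intro l
    have e1 : override T m (restr T (override S m l)) = override S m l := by
      funext j
      by_cases hj : j ∈ T
      · simp [override, restr, hj]
      · have : j ∉ S := fun hS => hj (h hS)
        simp [override, hj, this]
    have e2 : r (restr T (override S m l)) = l := by
      funext j
      simp [r, restr, override]
    have e3 : r (restr T m) = restr S m := rfl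
    rw [Matrix.of_apply, if_pos, e1, e2, e3]
    intro j hj
    simp [restr, override, hj]

theorem commute_of_disjoint {S T : Finset ℤ} (h : Disjoint S T) {x y : SpinAlgebra σ}
    (hx : x ∈ localAlg S) (hy : y ∈ localAlg T) : Commute x y := by
  obtain ⟨a, rfl⟩ := hx
  obtain ⟨b, rfl⟩ := hy
  have hr : ∀ {S T : Finset ℤ}, Disjoint S T → ∀ (m : Config σ) (l : LocalConfig σ S),
      restr T (override S m l) = restr T m := by
    intro S T h m l
    funext j
    have : (j : ℤ) ∉ S := fun hj => Finset.disjoint_left.1 h hj j.2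
    simp [restr, override, this]
  have ho : ∀ (m : Config σ) (l : LocalConfig σ S) (k : LocalConfig σ T),
      override T (override S m l) k = override S (override T m k) l := by
    intro m l k
    funext j
    by_cases hS : j ∈ S
    · simp [override, hS, Finset.disjoint_left.1 h hS]
    · simp [override, hS]
  apply toOp_injective
  ext ξ m
  change toOp (localEmb S a * localEmb T b) ξ m = toOp (localEmb T b * localEmb S a) ξ m
  rw [map_mul, map_mul]
  change toOp (localEmb S a) (toOp (localEmb T b) ξ) m
    = toOp (localEmb T b) (toOp (localEmb S a) ξ) m
  simp only [toOp_localEmb, localOp_apply, Finset.mul_sum, hr h, hr h.symm]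
  rw [Finset.sum_comm]
  refine Finset.sum_congr rfl fun k _ => Finset.sum_congr rfl fun l _ => ?_
  rw [ho]
  ring

theorem localEmb_eq_sum (S : Finset ℤ) (a : Matrix (LocalConfig σ S) (LocalConfig σ S) ℂ) :
    localEmb S a = ∑ k, ∑ l, a k l • localEmb S (Matrix.single k l 1) := by
  conv_lhs => rw [Matrix.matrix_eq_sum_single a]
  simp only [map_sum]
  refine Finset.sum_congr rfl fun k _ => Finset.sum_congr rfl fun l _ => ?_
  rw [← map_smul, Matrix.smul_single, smul_eq_mul, mul_one]

theorem toOp_localEmb_single (S : Finset ℤ) (k l : LocalConfig σ S) :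
    toOp (localEmb S (Matrix.single k l 1)) = matrixUnit S k l := by
  ext ξ m
  change toOp (localEmb S (Matrix.single k l 1)) ξ m = _
  rw [toOp_localEmb, localOp_apply, matrixUnit_apply, Finset.sum_eq_single l]
  · by_cases h : restr S m = k
    · simp [Matrix.single, h]
    · simp [Matrix.single, h, Ne.symm h]
  · intro l' _ hl'
    simp [Matrix.single, Ne.symm hl']
  · simp

theorem localEmb_single_insert {S : Finset ℤ} {i : ℤ} (hi : i ∉ S)
    (k l : LocalConfig σ (insert i S)) :
    localEmb (insert i S) (Matrix.single k l 1) =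
      localEmb {i} (Matrix.single (fun j => k ⟨j, by simp [Finset.mem_singleton.1 j.2]⟩)
        (fun j => l ⟨j, by simp [Finset.mem_singleton.1 j.2]⟩) 1) *
      localEmb S (Matrix.single (fun j => k ⟨j, Finset.mem_insert_of_mem j.2⟩)
        (fun j => l ⟨j, Finset.mem_insert_of_mem j.2⟩) 1) := by
  apply toOp_injective
  rw [map_mul, toOp_localEmb_single, toOp_localEmb_single, toOp_localEmb_single]
  ext ξ m
  rw [mul_apply_eq_comp, matrixUnit_apply, matrixUnit_apply, matrixUnit_apply, ← ite_and]
  refine if_congr ?_ ?_ rfl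
  · constructor
    · intro h
      subst h
      refine ⟨rfl, ?_⟩
      funext j
      have : (j : ℤ) ≠ i := fun h => hi (h ▸ j.2)
      simp [restr, override, this]
    · rintro ⟨h1, h2⟩
      funext ⟨j, hj⟩
      rcases Finset.mem_insert.1 hj with rfl | hj'
      · exact congrFun h1 ⟨j, by simp⟩
      · have hne : j ≠ i := fun h => hi (h ▸ hj')
        have := congrFun h2 ⟨j, hj'⟩
        simpa [restr, override, hne] using this
  · refine congrArg (fun c => ξ c) ?_
    funext j
    by_cases hj : j ∈ S
    · have hne : j ≠ i := fun h => hi (h ▸ hj)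
      simp [override, hj]
    · by_cases hji : j = i
      · subst hji
        simp [override, hj]
      · simp [override, hj, hji]

/-- The commutant of the algebras of the sites in `S` is the commutant of the algebra of `S`. -/
theorem commute_localAlg_of_sites {S : Finset ℤ} {x : SpinAlgebra σ}
    (h : ∀ i ∈ S, ∀ y ∈ localAlg {i}, Commute x y) : ∀ y ∈ localAlg S, Commute x y := by
  have key : ∀ k l : LocalConfig σ S, Commute x (localEmb S (Matrix.single k l 1)) := by
    induction S using Finset.induction_on with
    | empty =>
      intro k l
      have : (Matrix.single k l 1 : Matrix (LocalConfig σ ∅) (LocalConfig σ ∅) ℂ) = 1 := by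
        ext i j
        rw [Matrix.single_apply, if_pos ⟨Subsingleton.elim _ _, Subsingleton.elim _ _⟩,
          Matrix.one_apply, if_pos (Subsingleton.elim _ _)]
      rw [this, map_one]
      exact Commute.one_right x
    | insert i S hi ih =>
      intro k l
      rw [localEmb_single_insert hi]
      exact (h i (by simp) _ (localEmb_mem _ _)).mul_right
        (ih (fun j hj => h j (by simp [hj])) _ _)
  rintro _ ⟨a, rfl⟩
  change Commute x (localEmb S a)
  rw [localEmb_eq_sum]
  exact Commute.sum_right _ _ _ fun k _ => Commute.sum_right _ _ _ fun l _ =>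
    (key k l).smul_right _

theorem commute_of_mem_localAlg_empty {y : SpinAlgebra σ} (hy : y ∈ localAlg ∅)
    (x : SpinAlgebra σ) : Commute x y :=
  commute_localAlg_of_sites (S := ∅) (by simp) y hy

/-! ### Algebras of regions -/

/-- The `C*`-algebra of the observables in a possibly infinite set `Z` of sites. -/
def regionAlg (Z : Set ℤ) : StarSubalgebra ℂ (SpinAlgebra σ) :=
  (⨆ S : {S : Finset ℤ // (S : Set ℤ) ⊆ Z}, localAlg S.1).topologicalClosure

theorem directed_localAlg (Z : Set ℤ) :
    Directed (· ≤ ·) fun S : {S : Finset ℤ // (S : Set ℤ) ⊆ Z} => localAlg (σ := σ) S.1 := by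
  intro S T
  refine ⟨⟨S.1 ∪ T.1, by simp [S.2, T.2]⟩, localAlg_mono ?_, localAlg_mono ?_⟩
  · exact Finset.subset_union_left
  · exact Finset.subset_union_right

theorem coe_regionAlg (Z : Set ℤ) :
    (regionAlg (σ := σ) Z : Set (SpinAlgebra σ)) =
      closure {x | ∃ S : Finset ℤ, (S : Set ℤ) ⊆ Z ∧ x ∈ localAlg S} := by
  have : Nonempty {S : Finset ℤ // (S : Set ℤ) ⊆ Z} := ⟨⟨∅, by simp⟩⟩
  rw [regionAlg, StarSubalgebra.topologicalClosure_coe,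
    StarSubalgebra.coe_iSup_of_directed (directed_localAlg Z)]
  congr 1
  ext x
  simp

theorem isClosed_regionAlg (Z : Set ℤ) : IsClosed (regionAlg (σ := σ) Z : Set (SpinAlgebra σ)) :=
  StarSubalgebra.isClosed_topologicalClosure _

theorem localAlg_le_regionAlg {Z : Set ℤ} {S : Finset ℤ} (h : (S : Set ℤ) ⊆ Z) :
    localAlg (σ := σ) S ≤ regionAlg Z := by
  intro x hx
  rw [← SetLike.mem_coe, coe_regionAlg]
  exact subset_closure ⟨S, h, hx⟩

/-- A closed property that holds for the local observables in `Z` holds for the algebra of `Z`. -/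
theorem regionAlg_induction {Z : Set ℤ} {p : SpinAlgebra σ → Prop} (hp : IsClosed {x | p x})
    (h : ∀ S : Finset ℤ, (S : Set ℤ) ⊆ Z → ∀ x ∈ localAlg S, p x) :
    ∀ x ∈ regionAlg Z, p x := by
  intro x hx
  rw [← SetLike.mem_coe, coe_regionAlg] at hx
  refine closure_minimal (s := {x | ∃ S : Finset ℤ, (S : Set ℤ) ⊆ Z ∧ x ∈ localAlg S}) ?_ hp hx
  rintro y ⟨S, hS, hy⟩
  exact h S hS y hy

theorem exists_local_approx (x : SpinAlgebra σ) {ε : ℝ} (hε : 0 < ε) :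
    ∃ S : Finset ℤ, ∃ y ∈ localAlg S, ‖x - y‖ < ε := by
  obtain ⟨x, hx⟩ := x
  have hd : Directed (· ≤ ·) fun S : Finset ℤ => (localRep (σ := σ) S).range := by
    intro S T
    refine ⟨S ∪ T, ?_, ?_⟩
    · rintro _ ⟨a, rfl⟩
      obtain ⟨b, hb⟩ := localAlg_mono (σ := σ) (Finset.subset_union_left (s₁ := S) (s₂ := T))
        (localEmb_mem S a)
      exact ⟨b, congrArg toOp hb⟩
    · rintro _ ⟨a, rfl⟩
      obtain ⟨b, hb⟩ := localAlg_mono (σ := σ) (Finset.subset_union_right (s₁ := S) (s₂ := T))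
        (localEmb_mem T a)
      exact ⟨b, congrArg toOp hb⟩
  have hx' := hx
  rw [quasiLocal, ← SetLike.mem_coe, StarSubalgebra.topologicalClosure_coe,
    StarSubalgebra.coe_iSup_of_directed hd, Metric.mem_closure_iff] at hx'
  obtain ⟨y, hy, hxy⟩ := hx' ε hε
  obtain ⟨S, hS⟩ := mem_iUnion.1 hy
  obtain ⟨a, rfl⟩ := hS
  refine ⟨S, localEmb S a, localEmb_mem S a, ?_⟩
  rwa [dist_eq_norm] at hxy

theorem mem_regionAlg_univ (x : SpinAlgebra σ) : x ∈ regionAlg (univ : Set ℤ) := by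
  rw [← SetLike.mem_coe, coe_regionAlg, Metric.mem_closure_iff]
  intro ε hε
  obtain ⟨S, y, hy, hxy⟩ := exists_local_approx x hε
  exact ⟨y, ⟨S, subset_univ _, hy⟩, by rwa [dist_eq_norm]⟩

theorem spinAlgebra_induction {p : SpinAlgebra σ → Prop} (hp : IsClosed {x | p x})
    (h : ∀ S : Finset ℤ, ∀ x ∈ localAlg S, p x) (x : SpinAlgebra σ) : p x :=
  regionAlg_induction (Z := univ) hp (fun S _ => h S) x (mem_regionAlg_univ x)

theorem commute_regionAlg {Z Z' : Set ℤ} (h : Disjoint Z Z') {x y : SpinAlgebra σ}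
    (hx : x ∈ regionAlg Z) (hy : y ∈ regionAlg Z') : Commute x y := by
  refine regionAlg_induction (p := fun x => Commute x y) ?_ ?_ x hx
  · exact isClosed_eq (by fun_prop) (by fun_prop)
  · intro S hS x hx
    refine regionAlg_induction (p := fun y => Commute x y) ?_ ?_ y hy
    · exact isClosed_eq (by fun_prop) (by fun_prop)
    · intro T hT y hy
      refine commute_of_disjoint ?_ hx hy
      rw [← Finset.disjoint_coe]
      exact h.mono hS hT

/-! ### Elementary tensors -/

theorem elemTensor_single (S : Finset ℤ) (k l : LocalConfig σ S) :
    elemTensor S (fun j => if h : j ∈ S then Matrix.single (k ⟨j, h⟩) (l ⟨j, h⟩) 1 else 1) =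
      localEmb S (Matrix.single k l 1) := by
  unfold elemTensor
  congr 1
  ext m n
  rw [Matrix.of_apply, Matrix.single_apply]
  have : ∀ j : S, (if h : (j : ℤ) ∈ S then Matrix.single (k ⟨j, h⟩) (l ⟨j, h⟩) (1 : ℂ) else 1)
      (m j) (n j) = if k j = m j ∧ l j = n j then 1 else 0 := by
    intro j
    rw [dif_pos j.2]
    exact Matrix.single_apply ..
  simp_rw [this]
  rw [Finset.prod_ite_zero]
  simp [funext_iff, forall_and]

theorem elemTensor_mem (S : Finset ℤ) (a : ∀ j, Matrix (σ j) (σ j) ℂ) :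
    elemTensor S a ∈ localAlg S := localEmb_mem _ _

theorem elemTensor_congr {S : Finset ℤ} {a b : ∀ j, Matrix (σ j) (σ j) ℂ} (h : ∀ j ∈ S, a j = b j) :
    elemTensor S a = elemTensor S b := by
  unfold elemTensor
  congr 1
  ext m k
  exact Finset.prod_congr rfl fun j _ => by rw [h j j.2]

/-- The elementary tensors span the local algebras. -/
theorem localAlg_induction {S : Finset ℤ} {p : SpinAlgebra σ → Prop}
    (h : ∀ a, p (elemTensor S a)) (h0 : p 0) (hadd : ∀ x y, p x → p y → p (x + y))
    (hsmul : ∀ (c : ℂ) x, p x → p (c • x)) : ∀ x ∈ localAlg S, p x := by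
  rintro _ ⟨a, rfl⟩
  change p (localEmb S a)
  rw [localEmb_eq_sum]
  have hs : ∀ (s : Finset (LocalConfig σ S)) (f : LocalConfig σ S → SpinAlgebra σ),
      (∀ i ∈ s, p (f i)) → p (∑ i ∈ s, f i) := fun s f hf =>
    Finset.sum_induction f p hadd h0 hf
  refine hs _ _ fun k _ => hs _ _ fun l _ => hsmul _ _ ?_
  rw [← elemTensor_single]
  exact h _

theorem elemTensor_mul (S : Finset ℤ) (a b : ∀ j, Matrix (σ j) (σ j) ℂ) :
    elemTensor S a * elemTensor S b = elemTensor S fun j => a j * b j := by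
  unfold elemTensor
  rw [← map_mul]
  congr 1
  ext m n
  simp only [Matrix.mul_apply, Matrix.of_apply]
  rw [Finset.prod_univ_sum, ← Fintype.piFinset_univ]
  simp [Finset.prod_mul_distrib]

theorem elemTensor_one (S : Finset ℤ) : elemTensor (σ := σ) S (fun _ => 1) = 1 := by
  unfold elemTensor
  rw [← map_one (localEmb S)]
  congr 1
  ext m n
  simp only [Matrix.of_apply, Matrix.one_apply]
  rw [Finset.prod_ite_zero]
  simp [funext_iff]

theorem toOp_elemTensor_apply (S : Finset ℤ) (a : ∀ j, Matrix (σ j) (σ j) ℂ) (ξ : ConfigSpace σ)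
    (m : Config σ) : toOp (elemTensor S a) ξ m =
      ∑ l : LocalConfig σ S, (∏ j : S, a j (m j) (l j)) * ξ (override S m l) :=
  localOp_apply ..

/-- Padding an elementary tensor with identities. -/
theorem elemTensor_subset {S T : Finset ℤ} (h : S ⊆ T) (a : ∀ j, Matrix (σ j) (σ j) ℂ)
    (ha : ∀ j, j ∉ S → a j = 1) : elemTensor T a = elemTensor S a := by
  symm
  refine localEmb_ext fun ξ m => ?_
  rw [toOp_elemTensor_apply]
  refine Fintype.sum_of_injective (fun l => restr T (override S m l)) ?_ _ _ ?_ ?_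
  · intro l l' hl
    funext j
    have := congrFun hl ⟨j, h j.2⟩
    simpa [restr, override] using this
  · intro k hk
    rw [Matrix.of_apply, mul_eq_zero]
    left
    by_contra hne
    refine hk ⟨fun j => k ⟨j, h j.2⟩, ?_⟩
    funext j
    by_cases hj : (j : ℤ) ∈ S
    · simp [restr, override, hj]
    · have := Finset.prod_ne_zero_iff.1 hne j (Finset.mem_univ _)
      rw [ha _ hj, Matrix.one_apply] at this
      simp only [restr, override, hj, dite_false]
      by_contra hc
      exact this (if_neg hc)
  · intro l
    have e1 : override T m (restr T (override S m l)) = override S m l := by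
      funext j
      by_cases hj : j ∈ T
      · simp [override, restr, hj]
      · have : j ∉ S := fun hS => hj (h hS)
        simp [override, hj, this]
    rw [Matrix.of_apply, e1]
    congr 1
    refine Finset.prod_of_injOn (fun j => ⟨j, h j.2⟩) ?_ (by simp) ?_ ?_
    · intro x _ y _ hxy
      exact Subtype.ext (congrArg (fun z : T => (z : ℤ)) hxy)
    · intro j _ hj
      have hj' : (j : ℤ) ∉ S := fun hS => hj ⟨⟨j, hS⟩, by simp⟩
      have e : restr T (override S m l) j = restr T m j := by simp [restr, override, hj']
      rw [ha _ hj', e]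
      exact Matrix.one_apply_eq _
    · intro j _
      simp [restr, override]

end Local

/-! ### Single-site averages and oscillations -/

section Oscillation

variable {σ : ℤ → Type} [∀ j, Fintype (σ j)] [∀ j, DecidableEq (σ j)]

/-- The group of unitary integer matrices, that is, of signed permutation matrices. It is finite,
and its complex linear span consists of all matrices. -/
abbrev SignedPerm (ι : Type*) [Fintype ι] [DecidableEq ι] := Matrix.unitaryGroup ι ℤ

/-- The complexification of integer matrices. -/
def toComplexMatrix (ι : Type*) [Fintype ι] [DecidableEq ι] :
    Matrix ι ι ℤ →+* Matrix ι ι ℂ := (Int.castRingHom ℂ).mapMatrix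

theorem star_toComplexMatrix {ι : Type*} [Fintype ι] [DecidableEq ι] (g : Matrix ι ι ℤ) :
    star (toComplexMatrix ι g) = toComplexMatrix ι (star g) := by
  ext i j
  simp [toComplexMatrix, Matrix.star_apply]

instance {ι : Type*} [Fintype ι] [DecidableEq ι] : Finite (SignedPerm ι) := by
  have hb : ∀ (g : SignedPerm ι) (i j : ι), (g.1 i j) ∈ Icc (-1 : ℤ) 1 := by
    intro g i j
    have h : toComplexMatrix ι g.1 ∈ Matrix.unitaryGroup ι ℂ := by
      rw [Matrix.mem_unitaryGroup_iff, star_toComplexMatrix, ← map_mul,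
        Matrix.mem_unitaryGroup_iff.1 g.2, map_one]
    have := entry_norm_bound_of_unitary h i j
    have e : toComplexMatrix ι g.1 i j = ((g.1 i j : ℤ) : ℂ) := rfl
    rw [e, Complex.norm_intCast] at this
    have h2 : |g.1 i j| ≤ 1 := by exact_mod_cast this
    exact abs_le.1 h2
  refine Finite.of_injective (β := ι → ι → Icc (-1 : ℤ) 1)
    (fun g i j => ⟨g.1 i j, hb g i j⟩) fun g g' h => ?_
  ext i j
  have := congrFun (congrFun h i) j
  simpa using this

instance {ι : Type*} [Fintype ι] [DecidableEq ι] : Fintype (SignedPerm ι) := Fintype.ofFinite _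

/-- A subalgebra of the complex matrices that contains all signed permutation matrices contains
everything. -/
theorem mem_of_signedPerm_mem {ι : Type*} [Fintype ι] [DecidableEq ι]
    (M : Subalgebra ℂ (Matrix ι ι ℂ)) (h : ∀ g : SignedPerm ι, toComplexMatrix ι g.1 ∈ M)
    (a : Matrix ι ι ℂ) : a ∈ M := by
  have hd : ∀ k, Matrix.single k k (1 : ℂ) ∈ M := by
    intro k
    set d : Matrix ι ι ℤ := Matrix.diagonal fun i => if i = k then -1 else 1
    have hd : d ∈ Matrix.unitaryGroup ι ℤ := by
      rw [Matrix.mem_unitaryGroup_iff, Matrix.star_eq_conjTranspose, Matrix.diagonal_conjTranspose,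
        Matrix.diagonal_mul_diagonal, ← Matrix.diagonal_one]
      congr 1
      funext i
      by_cases hi : i = k <;> simp [hi]
    have e : Matrix.single k k (1 : ℂ) = (1 / 2 : ℂ) • (1 - toComplexMatrix ι d) := by
      ext i j
      by_cases hij : i = j
      · subst hij
        by_cases hi : i = k
        · subst hi
          simp [toComplexMatrix, d]
          norm_num
        · simp [toComplexMatrix, d, hi, Ne.symm hi]
      · have : ¬(k = i ∧ k = j) := fun h => hij (h.1.symm.trans h.2)
        simp [toComplexMatrix, d, hij, this]
    rw [e]
    exact M.smul_mem (M.sub_mem M.one_mem (h ⟨d, hd⟩)) _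
  have hs : ∀ k l, Matrix.single k l (1 : ℂ) ∈ M := by
    intro k l
    set p : Matrix ι ι ℤ := (Equiv.swap k l).permMatrix ℤ
    have hp : p ∈ Matrix.unitaryGroup ι ℤ := by
      rw [Matrix.mem_unitaryGroup_iff, Matrix.star_eq_conjTranspose,
        Matrix.conjTranspose_permMatrix, ← Matrix.permMatrix_mul]
      simp
    have e : Matrix.single k l (1 : ℂ) = toComplexMatrix ι p * Matrix.single l l 1 := by
      ext i j
      rw [Matrix.mul_apply, Finset.sum_eq_single l]
      · have : toComplexMatrix ι p i l = if i = k then 1 else 0 := by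
          simp only [toComplexMatrix, p, RingHom.mapMatrix_apply, Matrix.map_apply,
            Equiv.Perm.permMatrix, PEquiv.toMatrix_apply, Equiv.toPEquiv_apply,
            Option.mem_some_iff]
          by_cases hi : i = k
          · simp [hi]
          · have : Equiv.swap k l i ≠ l := fun h =>
              hi ((Equiv.swap k l).injective (h.trans (Equiv.swap_apply_left k l).symm))
            simp [hi, this]
        rw [this, Matrix.single_apply, Matrix.single_apply]
        by_cases hi : i = k <;> by_cases hj : l = j <;> simp [hi, hj, eq_comm (a := k)]
      · intro m _ hm
        rw [Matrix.single_apply, if_neg (fun h => hm h.1.symm), mul_zero]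
      · simp
    rw [e]
    exact M.mul_mem (h ⟨p, hp⟩) (hd l)
  rw [Matrix.matrix_eq_sum_single a]
  refine M.sum_mem fun k _ => M.sum_mem fun l _ => ?_
  have : Matrix.single k l (a k l) = a k l • Matrix.single k l 1 := by
    rw [Matrix.smul_single, smul_eq_mul, mul_one]
  rw [this]
  exact M.smul_mem (hs k l) _

/-- The finite group of signed permutation matrices at the site `i`. -/
abbrev SiteGroup (σ : ℤ → Type) [∀ j, Fintype (σ j)] [∀ j, DecidableEq (σ j)] (i : ℤ) :=
  SignedPerm (LocalConfig σ {i})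

/-- Signed permutation matrices as observables. -/
def siteUnitary (i : ℤ) (g : SiteGroup σ i) : SpinAlgebra σ :=
  localEmb {i} (toComplexMatrix _ g.1)

theorem siteUnitary_mem (i : ℤ) (g : SiteGroup σ i) : siteUnitary i g ∈ localAlg {i} :=
  localEmb_mem _ _

theorem siteUnitary_mul (i : ℤ) (g g' : SiteGroup σ i) :
    siteUnitary i (g * g') = siteUnitary i g * siteUnitary i g' := by
  simp [siteUnitary]

theorem siteUnitary_mem_unitary (i : ℤ) (g : SiteGroup σ i) :
    siteUnitary i g ∈ unitary (SpinAlgebra σ) := by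
  have h1 := g.2
  constructor
  · rw [siteUnitary, ← map_star, ← map_mul, star_toComplexMatrix, ← map_mul,
      Matrix.mem_unitaryGroup_iff'.1 g.2, map_one, map_one]
  · rw [siteUnitary, ← map_star, ← map_mul, star_toComplexMatrix, ← map_mul,
      Matrix.mem_unitaryGroup_iff.1 g.2, map_one, map_one]

theorem commute_site_of_siteUnitary {i : ℤ} {x : SpinAlgebra σ}
    (h : ∀ g : SiteGroup σ i, Commute x (siteUnitary i g)) : ∀ y ∈ localAlg {i}, Commute x y := by
  rintro _ ⟨a, rfl⟩
  have := mem_of_signedPerm_mem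
    ((Subalgebra.centralizer ℂ {x}).comap (localEmb (σ := σ) {i}).toAlgHom)
    (fun g => by
      rw [Subalgebra.mem_comap, Subalgebra.mem_centralizer_iff]
      rintro y rfl
      exact h g) a
  rw [Subalgebra.mem_comap, Subalgebra.mem_centralizer_iff] at this
  exact this x rfl

/-- The oscillation of `x` at the site `i`: the average norm of the commutators of `x` with the
signed permutation matrices at that site. -/
def osc (i : ℤ) (x : SpinAlgebra σ) : ℝ :=
  (Fintype.card (SiteGroup σ i) : ℝ)⁻¹ *
    ∑ g : SiteGroup σ i, ‖x * siteUnitary i g - siteUnitary i g * x‖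

theorem osc_nonneg (i : ℤ) (x : SpinAlgebra σ) : 0 ≤ osc i x := by
  unfold osc; positivity

theorem card_siteGroup_pos (i : ℤ) : (0 : ℝ) < Fintype.card (SiteGroup σ i) :=
  Nat.cast_pos.2 Fintype.card_pos

theorem osc_le_of_forall {i : ℤ} {x : SpinAlgebra σ} {C : ℝ}
    (h : ∀ g : SiteGroup σ i, ‖x * siteUnitary i g - siteUnitary i g * x‖ ≤ C) : osc i x ≤ C := by
  have h0 := card_siteGroup_pos (σ := σ) i
  unfold osc
  rw [inv_mul_le_iff₀ h0]
  refine (Finset.sum_le_sum fun g _ => h g).trans_eq ?_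
  simp

/-- The average of `x` over the conjugations with the signed permutation matrices at the site `i`,
a projection of norm one to the commutant of the site algebra. -/
def siteAverage (i : ℤ) (x : SpinAlgebra σ) : SpinAlgebra σ :=
  ((Fintype.card (SiteGroup σ i) : ℝ)⁻¹ : ℝ) •
    ∑ g : SiteGroup σ i, siteUnitary i g * x * star (siteUnitary i g)

theorem norm_unitary_conj {u : SpinAlgebra σ} (hu : u ∈ unitary (SpinAlgebra σ))
    (x : SpinAlgebra σ) : ‖u * x * star u‖ = ‖x‖ := by
  rw [CStarRing.norm_mul_mem_unitary _ (Unitary.star_mem hu), CStarRing.norm_mem_unitary_mul _ hu]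

theorem norm_siteAverage_le (i : ℤ) (x : SpinAlgebra σ) : ‖siteAverage i x‖ ≤ ‖x‖ := by
  have h0 := card_siteGroup_pos (σ := σ) i
  rw [siteAverage, norm_smul, Real.norm_of_nonneg (by positivity), inv_mul_le_iff₀ h0]
  refine (norm_sum_le _ _).trans ?_
  simp_rw [norm_unitary_conj (siteUnitary_mem_unitary i _)]
  simp

theorem siteAverage_sub (i : ℤ) (x y : SpinAlgebra σ) :
    siteAverage i (x - y) = siteAverage i x - siteAverage i y := by
  simp [siteAverage, mul_sub, sub_mul, Finset.sum_sub_distrib, smul_sub]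

theorem norm_sub_siteAverage_le (i : ℤ) (x : SpinAlgebra σ) : ‖x - siteAverage i x‖ ≤ osc i x := by
  have h0 := card_siteGroup_pos (σ := σ) i
  have e : x - siteAverage i x = ((Fintype.card (SiteGroup σ i) : ℝ)⁻¹ : ℝ) •
      ∑ g : SiteGroup σ i, (x * siteUnitary i g - siteUnitary i g * x) *
        star (siteUnitary i g) := by
    have : ∀ g : SiteGroup σ i, (x * siteUnitary i g - siteUnitary i g * x) *
        star (siteUnitary i g) = x - siteUnitary i g * x * star (siteUnitary i g) := by
      intro g
      rw [sub_mul, mul_assoc x, (siteUnitary_mem_unitary i g).2, mul_one]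
    simp_rw [this]
    rw [Finset.sum_sub_distrib, smul_sub, siteAverage]
    congr 1
    simp only [Finset.sum_const, Finset.card_univ, ← Nat.cast_smul_eq_nsmul ℝ, smul_smul]
    rw [inv_mul_cancel₀ h0.ne', one_smul]
  rw [e, norm_smul, Real.norm_of_nonneg (by positivity), osc]
  gcongr
  refine (norm_sum_le _ _).trans (Finset.sum_le_sum fun g _ => ?_)
  rw [CStarRing.norm_mul_mem_unitary _ (Unitary.star_mem (siteUnitary_mem_unitary i g))]

theorem commute_siteAverage (i : ℤ) (x : SpinAlgebra σ) :
    ∀ y ∈ localAlg {i}, Commute (siteAverage i x) y := by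
  refine commute_site_of_siteUnitary fun g => ?_
  have hu := siteUnitary_mem_unitary i g
  have hsum : siteUnitary i g * (∑ g' : SiteGroup σ i, siteUnitary i g' * x *
      star (siteUnitary i g')) * star (siteUnitary i g) =
      ∑ g' : SiteGroup σ i, siteUnitary i g' * x * star (siteUnitary i g') := by
    rw [Finset.mul_sum, Finset.sum_mul]
    rw [← Equiv.sum_comp (Equiv.mulLeft g)
      (fun g' => siteUnitary i g' * x * star (siteUnitary i g'))]
    refine Finset.sum_congr rfl fun g' _ => ?_
    rw [Equiv.coe_mulLeft, siteUnitary_mul, star_mul]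
    simp only [mul_assoc]
  have key : siteUnitary i g * siteAverage i x * star (siteUnitary i g) = siteAverage i x := by
    rw [siteAverage, mul_smul_comm, smul_mul_assoc, hsum]
  change siteAverage i x * siteUnitary i g = siteUnitary i g * siteAverage i x
  conv_lhs => rw [← key]
  rw [mul_assoc, hu.1, mul_one]

/-- If `x` oscillates little in `S`, then it is close to the commutant of the algebra of `S`. -/
theorem exists_commutant_approx (S : Finset ℤ) (x : SpinAlgebra σ) :
    ∃ x', (∀ y ∈ localAlg S, Commute x' y) ∧ ‖x - x'‖ ≤ ∑ i ∈ S, osc i x := by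
  suffices h : ∃ x', (∀ i ∈ S, ∀ y ∈ localAlg {i}, Commute x' y) ∧
      ‖x - x'‖ ≤ ∑ i ∈ S, osc i x by
    obtain ⟨x', h1, h2⟩ := h
    exact ⟨x', commute_localAlg_of_sites h1, h2⟩
  induction S using Finset.induction_on with
  | empty => exact ⟨x, by simp, by simp⟩
  | insert i S hi ih =>
    obtain ⟨x', h1, h2⟩ := ih
    refine ⟨siteAverage i x', ?_, ?_⟩
    · intro j hj y hy
      rcases Finset.mem_insert.1 hj with rfl | hjS
      · exact commute_siteAverage _ _ y hy
      · have hne : j ≠ i := fun h => hi (h ▸ hjS)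
        have hc : ∀ g : SiteGroup σ i, Commute (siteUnitary i g) y := fun g =>
          commute_of_disjoint (by simpa using hne.symm) (siteUnitary_mem i g) hy
        have hc' : ∀ g : SiteGroup σ i, Commute (star (siteUnitary i g)) y := fun g =>
          commute_of_disjoint (by simpa using hne.symm) (star_mem (siteUnitary_mem i g)) hy
        unfold siteAverage
        refine Commute.smul_left (Commute.sum_left _ _ _ fun g _ => ?_) _
        exact ((hc g).mul_left (h1 j hjS y hy)).mul_left (hc' g)
    · rw [Finset.sum_insert hi]
      calc ‖x - siteAverage i x'‖
          = ‖(x - siteAverage i x) + siteAverage i (x - x')‖ := by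
            rw [siteAverage_sub]; congr 1; abel
        _ ≤ _ := (norm_add_le _ _).trans (add_le_add (norm_sub_siteAverage_le i x)
            ((norm_siteAverage_le i _).trans h2))

/-- Commutators with observables in `S` are controlled by the oscillations in `S`. -/
theorem norm_commutator_le {S : Finset ℤ} (x : SpinAlgebra σ) {y : SpinAlgebra σ}
    (hy : y ∈ localAlg S) : ‖x * y - y * x‖ ≤ 2 * ‖y‖ * ∑ i ∈ S, osc i x := by
  obtain ⟨x', h1, h2⟩ := exists_commutant_approx S x
  have e : x * y - y * x = (x - x') * y - y * (x - x') := by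
    have h3 : x' * y = y * x' := h1 y hy
    rw [sub_mul, mul_sub, h3]
    abel
  rw [e]
  calc ‖(x - x') * y - y * (x - x')‖ ≤ ‖x - x'‖ * ‖y‖ + ‖y‖ * ‖x - x'‖ :=
        (norm_sub_le _ _).trans (add_le_add (norm_mul_le _ _) (norm_mul_le _ _))
    _ = 2 * ‖y‖ * ‖x - x'‖ := by ring
    _ ≤ _ := by gcongr

end Oscillation

/-! ### The Heisenberg equation -/

section Heisenberg

/-- The derivation `i [h, ·]`. -/
def adI {R : Type*} [CStarAlgebra R] (h a : R) : R := Complex.I • (h * a - a * h)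

theorem norm_adI_le {R : Type*} [CStarAlgebra R] (h a : R) : ‖adI h a‖ ≤ 2 * ‖h‖ * ‖a‖ := by
  rw [adI, norm_smul, Complex.norm_I, one_mul]
  have e1 := norm_mul_le h a
  have e2 := norm_mul_le a h
  linarith [norm_sub_le (h * a) (a * h), mul_comm ‖a‖ ‖h‖]

theorem adI_eq_iff {R : Type*} [CStarAlgebra R] {h h' a : R} :
    adI h a = adI h' a ↔ h * a - a * h = h' * a - a * h' :=
  (smul_right_injective R Complex.I_ne_zero).eq_iff

theorem norm_starAlgEquiv {R R' : Type*} [CStarAlgebra R] [CStarAlgebra R'] (e : R ≃⋆ₐ[ℂ] R')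
    (x : R) : ‖e x‖ = ‖x‖ := StarAlgEquiv.norm_map e x

theorem continuous_starAlgEquiv {R R' : Type*} [CStarAlgebra R] [CStarAlgebra R']
    (e : R ≃⋆ₐ[ℂ] R') : Continuous e :=
  (AddMonoidHomClass.isometry_of_norm e (norm_starAlgEquiv e)).continuous

variable {σ : ℤ → Type} [∀ j, Fintype (σ j)] [∀ j, DecidableEq (σ j)]

theorem IsHeisenbergSolution.isPrim {h : ℝ → SpinAlgebra σ}
    {β : ℝ → SpinAlgebra σ ≃⋆ₐ[ℂ] SpinAlgebra σ} (hβ : IsHeisenbergSolution h β)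
    {a : SpinAlgebra σ} {M : ℝ} (hM : ∀ u ∈ Icc (0 : ℝ) 1, ‖adI (h u) a‖ ≤ M) :
    IsPrim (fun s => β s a) (fun u => β u (adI (h u) a)) := by
  have he : ∀ u, β u (adI (h u) a) = Complex.I • β u (h u * a - a * h u) := fun u => by
    rw [adI, map_smul]
  have h0 : β 0 a = a := by simpa using ((hβ a).2 0 (by simp)).2
  refine ⟨.of_bdd (C := M) (fun u hu => ?_) ?_, fun s hs => ?_⟩
  · rw [norm_starAlgEquiv]; exact hM u hu
  · simp_rw [he]
    have := ((hβ a).2 1 (by simp)).1.1.aestronglyMeasurable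
    rw [restrict_Ioc_eq_restrict_Icc] at this
    exact this.const_smul Complex.I
  · simp_rw [h0, he]
    rw [intervalIntegral.integral_smul]
    exact ((hβ a).2 s hs).2

theorem isHeisenbergSolution_of_isPrim {h : ℝ → SpinAlgebra σ}
    {β : ℝ → SpinAlgebra σ ≃⋆ₐ[ℂ] SpinAlgebra σ} (h0 : ∀ a, β 0 a = a)
    (hβ : ∀ a, IsPrim (fun s => β s a) (fun u => β u (adI (h u) a))) :
    IsHeisenbergSolution h β := by
  intro a
  have he : ∀ u, β u (h u * a - a * h u) = -Complex.I • β u (adI (h u) a) := fun u => by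
    rw [adI, map_smul, smul_smul]
    simp
  refine ⟨(hβ a).continuousOn, fun s hs => ⟨?_, ?_⟩⟩
  · simp_rw [he]
    exact ((hβ a).toIsBddMeas.const_smul _).intervalIntegrable (by simp) hs
  · simp_rw [he]
    rw [intervalIntegral.integral_smul, smul_smul]
    simpa [h0] using (hβ a).eq s hs

/-- Only the derivation defined by the Hamiltonian matters. -/
theorem IsHeisenbergSolution.congr {h h' : ℝ → SpinAlgebra σ}
    {β : ℝ → SpinAlgebra σ ≃⋆ₐ[ℂ] SpinAlgebra σ} (hβ : IsHeisenbergSolution h β)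
    (hh : ∀ u ∈ Icc (0 : ℝ) 1, ∀ a, adI (h u) a = adI (h' u) a) :
    IsHeisenbergSolution h' β := by
  intro a
  refine ⟨(hβ a).1, fun s hs => ?_⟩
  have hc : ∀ u ∈ uIcc 0 s, β u (h u * a - a * h u) = β u (h' u * a - a * h' u) := by
    intro u hu
    rw [uIcc_of_le hs.1] at hu
    rw [adI_eq_iff.1 (hh u ⟨hu.1, hu.2.trans hs.2⟩ a)]
  refine ⟨((hβ a).2 s hs).1.congr fun u hu => hc u (uIoc_subset_uIcc hu), ?_⟩
  rw [← intervalIntegral.integral_congr hc]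
  exact ((hβ a).2 s hs).2

/-- Uniqueness for the Heisenberg equation, in a form that compares the solutions on two chains: if a
map `j` intertwines the derivations on an invariant set `P`, and the bounded linear maps `L` and `L'`
agree at time zero along `j`, then they agree along the two evolutions. -/
theorem IsHeisenbergSolution.comp_eq {τ : ℤ → Type} [∀ j, Fintype (τ j)] [∀ j, DecidableEq (τ j)]
    {Y : Type*} [NormedAddCommGroup Y] [NormedSpace ℝ Y] [CompleteSpace Y]
    {h : ℝ → SpinAlgebra σ} {β : ℝ → SpinAlgebra σ ≃⋆ₐ[ℂ] SpinAlgebra σ}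
    {h' : ℝ → SpinAlgebra τ} {β' : ℝ → SpinAlgebra τ ≃⋆ₐ[ℂ] SpinAlgebra τ}
    (hβ : IsHeisenbergSolution h β) (hβ' : IsHeisenbergSolution h' β')
    (L : SpinAlgebra σ →L[ℝ] Y) (L' : SpinAlgebra τ →L[ℝ] Y)
    (j : SpinAlgebra σ → SpinAlgebra τ) (hj : ∀ x, ‖j x‖ ≤ ‖x‖) (hL : ∀ x, L x = L' (j x))
    {M : ℝ} (hM0 : 0 ≤ M) (hM : ∀ u ∈ Icc (0 : ℝ) 1, ∀ a, ‖adI (h u) a‖ ≤ M * ‖a‖)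
    (P : Set (SpinAlgebra σ)) (hP : ∀ u ∈ Icc (0 : ℝ) 1, ∀ x ∈ P, adI (h u) x ∈ P)
    (hhj : ∀ u ∈ Icc (0 : ℝ) 1, ∀ x ∈ P, j (adI (h u) x) = adI (h' u) (j x)) :
    ∀ s ∈ Icc (0 : ℝ) 1, ∀ x ∈ P, L (β s x) = L' (β' s (j x)) := by
  intro s hs x hx
  have := volterra_eq_zero P (fun s x => L (β s x) - L' (β' s (j x))) (fun u x => adI (h u) x)
    (C := ‖L‖ + ‖L'‖) (M := M) ?_ (by positivity) hM0 hP (fun s hs x _ => hM s hs x) ?_ s hs x hx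
  · exact sub_eq_zero.1 this
  · intro s hs x _
    refine (norm_sub_le _ _).trans ?_
    rw [add_mul]
    refine add_le_add ((L.le_opNorm _).trans_eq ?_) ((L'.le_opNorm _).trans ?_)
    · rw [norm_starAlgEquiv]
    · rw [norm_starAlgEquiv]
      gcongr
      exact hj x
  · intro s hs x hx
    have h1 := (hβ.isPrim (fun u hu => hM u hu x)).clm_comp L
    have h2 := (hβ'.isPrim (a := j x) (M := M * ‖x‖) (fun u hu => by
      rw [← hhj u hu x hx]
      exact (hj _).trans (hM u hu x))).clm_comp L'
    have h3 := (h1.sub h2).eq s hs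
    have e0 : β 0 x = x := by simpa using ((hβ x).2 0 (by simp)).2
    have e0' : β' 0 (j x) = j x := by simpa using ((hβ' (j x)).2 0 (by simp)).2
    rw [h3, e0, e0', hL, sub_self, zero_add]
    refine intervalIntegral.integral_congr fun u hu => ?_
    rw [uIcc_of_le hs.1] at hu
    simp only [hhj u ⟨hu.1, hu.2.trans hs.2⟩ x hx]

theorem IsHeisenbergSolution.eqOn {h h' : ℝ → SpinAlgebra σ}
    {β β' : ℝ → SpinAlgebra σ ≃⋆ₐ[ℂ] SpinAlgebra σ}
    (hβ : IsHeisenbergSolution h β) (hβ' : IsHeisenbergSolution h' β')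
    {M : ℝ} (hM0 : 0 ≤ M) (hM : ∀ u ∈ Icc (0 : ℝ) 1, ∀ a, ‖adI (h u) a‖ ≤ M * ‖a‖)
    (P : Set (SpinAlgebra σ)) (hP : ∀ u ∈ Icc (0 : ℝ) 1, ∀ x ∈ P, adI (h u) x ∈ P)
    (hh : ∀ u ∈ Icc (0 : ℝ) 1, ∀ x ∈ P, adI (h u) x = adI (h' u) x) :
    ∀ s ∈ Icc (0 : ℝ) 1, ∀ x ∈ P, β s x = β' s x :=
  hβ.comp_eq hβ' (ContinuousLinearMap.id ℝ _) (ContinuousLinearMap.id ℝ _) id (fun _ => le_rfl)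
    (fun _ => rfl) hM0 hM P hP hh

theorem IsHeisenbergSolution.unique {h : ℝ → SpinAlgebra σ}
    {β β' : ℝ → SpinAlgebra σ ≃⋆ₐ[ℂ] SpinAlgebra σ}
    (hβ : IsHeisenbergSolution h β) (hβ' : IsHeisenbergSolution h β')
    {M : ℝ} (hM0 : 0 ≤ M) (hM : ∀ u ∈ Icc (0 : ℝ) 1, ∀ a, ‖adI (h u) a‖ ≤ M * ‖a‖) :
    ∀ s ∈ Icc (0 : ℝ) 1, ∀ x, β s x = β' s x := fun s hs x =>
  hβ.eqOn hβ' hM0 hM univ (by simp) (by simp) s hs x (mem_univ x)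

/-- A closed subspace that is invariant under the derivations is invariant under the evolution:
the image of the evolution in the quotient space solves the equation with initial value zero. -/
theorem IsHeisenbergSolution.mem_of_invariant {h : ℝ → SpinAlgebra σ}
    {β : ℝ → SpinAlgebra σ ≃⋆ₐ[ℂ] SpinAlgebra σ}
    (hβ : IsHeisenbergSolution h β)
    {M : ℝ} (hM0 : 0 ≤ M) (hM : ∀ u ∈ Icc (0 : ℝ) 1, ∀ a, ‖adI (h u) a‖ ≤ M * ‖a‖)
    (P : Submodule ℝ (SpinAlgebra σ)) (hPc : IsClosed (P : Set (SpinAlgebra σ)))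
    (hP : ∀ u ∈ Icc (0 : ℝ) 1, ∀ x ∈ P, adI (h u) x ∈ P) :
    ∀ s ∈ Icc (0 : ℝ) 1, ∀ x ∈ P, β s x ∈ P := by
  intro s hs x hx
  have hnorm : ∀ y, ‖P.mkQ y‖ ≤ 1 * ‖y‖ := fun y => by
    rw [one_mul]; exact Submodule.Quotient.norm_mk_le P y
  set Q : SpinAlgebra σ →L[ℝ] (SpinAlgebra σ ⧸ P) := P.mkQ.mkContinuous 1 hnorm
  have hQ : ∀ y, Q y = P.mkQ y := fun y => rfl
  have := volterra_eq_zero (P : Set (SpinAlgebra σ)) (fun s x => Q (β s x))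
    (fun u x => adI (h u) x) (C := 1) (M := M) ?_ zero_le_one hM0 hP
    (fun s hs x _ => hM s hs x) ?_ s hs x hx
  · rw [hQ, Submodule.mkQ_apply, Submodule.Quotient.mk_eq_zero] at this
    exact this
  · intro s hs x _
    refine (hnorm _).trans_eq ?_
    rw [norm_starAlgEquiv]
  · intro s hs x hx
    have h1 := ((hβ.isPrim (fun u hu => hM u hu x)).clm_comp Q).eq s hs
    have e0 : β 0 x = x := by simpa using ((hβ x).2 0 (by simp)).2
    have e1 : Q x = 0 := by
      rw [hQ, Submodule.mkQ_apply, Submodule.Quotient.mk_eq_zero]; exact hx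
    rw [h1, e0, e1, zero_add]

/-! ### Evolutions with bounded Hamiltonians -/

/-- Time-dependent Hamiltonians in the algebra: bounded, measurable and self-adjoint. -/
structure IsHamiltonian (h : ℝ → SpinAlgebra σ) : Prop extends IsBddMeas h where
  isSelfAdjoint : ∀ u ∈ Icc (0 : ℝ) 1, IsSelfAdjoint (h u)

theorem IsHamiltonian.exists_adI_bound {h : ℝ → SpinAlgebra σ} (hh : IsHamiltonian h) :
    ∃ M, 0 ≤ M ∧ ∀ u ∈ Icc (0 : ℝ) 1, ∀ a, ‖adI (h u) a‖ ≤ M * ‖a‖ := by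
  obtain ⟨M, hM0, hM⟩ := hh.bdd
  refine ⟨2 * M, by positivity, fun u hu a => (norm_adI_le _ _).trans ?_⟩
  gcongr
  exact hM u hu

/-- The time-ordered exponential: the unitary solution of `V' = i V h` with `V 0 = 1`. -/
def propagator (h : ℝ → SpinAlgebra σ) : ℝ → SpinAlgebra σ :=
  Classical.epsilon fun V => V 0 = 1 ∧ (∀ s ∈ Icc (0 : ℝ) 1, V s ∈ unitary (SpinAlgebra σ)) ∧
    IsPrim V (fun u => Complex.I • (V u * h u))

theorem propagator_spec {h : ℝ → SpinAlgebra σ} (hh : IsHamiltonian h) :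
    propagator h 0 = 1 ∧ (∀ s ∈ Icc (0 : ℝ) 1, propagator h s ∈ unitary (SpinAlgebra σ)) ∧
      IsPrim (propagator h) (fun u => Complex.I • (propagator h u * h u)) :=
  Classical.epsilon_spec (exists_unitary_isPrim hh.toIsBddMeas hh.isSelfAdjoint)

open Classical in
/-- The evolution `a ↦ V a V*` of a Hamiltonian in the algebra. -/
def innerEvolution (h : ℝ → SpinAlgebra σ) (s : ℝ) : SpinAlgebra σ ≃⋆ₐ[ℂ] SpinAlgebra σ :=
  Unitary.conjStarAlgAut ℂ (SpinAlgebra σ)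
    (if hs : propagator h s ∈ unitary (SpinAlgebra σ) then ⟨propagator h s, hs⟩ else 1)

theorem innerEvolution_apply {h : ℝ → SpinAlgebra σ} (hh : IsHamiltonian h) {s : ℝ}
    (hs : s ∈ Icc (0 : ℝ) 1) (a : SpinAlgebra σ) :
    innerEvolution h s a = propagator h s * a * star (propagator h s) := by
  have := (propagator_spec hh).2.1 s hs
  simp [innerEvolution, this]

theorem innerEvolution_symm_apply {h : ℝ → SpinAlgebra σ} (hh : IsHamiltonian h) {s : ℝ}
    (hs : s ∈ Icc (0 : ℝ) 1) (a : SpinAlgebra σ) :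
    (innerEvolution h s).symm a = star (propagator h s) * a * propagator h s := by
  have := (propagator_spec hh).2.1 s hs
  simp [innerEvolution, this]

theorem isHeisenbergSolution_innerEvolution {h : ℝ → SpinAlgebra σ} (hh : IsHamiltonian h) :
    IsHeisenbergSolution h (innerEvolution h) := by
  obtain ⟨h0, hu, hV⟩ := propagator_spec hh
  refine isHeisenbergSolution_of_isPrim (fun a => ?_) fun a => ?_
  · rw [innerEvolution_apply hh (by simp), h0]
    simp
  · have hp := (hV.mul (IsPrim.const a)).mul hV.star
    have hp' := hp.congr' (g := fun u => innerEvolution h u (adI (h u) a)) fun u hu => by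
      rw [innerEvolution_apply hh hu, star_smul, star_mul, (hh.isSelfAdjoint u hu).star_eq, adI]
      simp only [mul_zero, add_zero, smul_mul_assoc, mul_smul_comm, mul_sub, sub_mul, smul_sub,
        mul_assoc, Complex.star_def, Complex.conj_I, neg_smul, mul_neg]
      abel
    refine ⟨hp'.toIsBddMeas, fun s hs => ?_⟩
    rw [innerEvolution_apply hh hs, innerEvolution_apply hh (s := 0) (by simp)]
    exact hp'.eq s hs

/-- Duhamel's formula for the comparison of two evolutions, as an estimate: the perturbation acts
only through its commutators with the observable evolved back by the first evolution. -/
theorem norm_innerEvolution_comp_sub_le {h h' : ℝ → SpinAlgebra σ} (hh : IsHamiltonian h)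
    (hh' : IsHamiltonian h') (b : SpinAlgebra σ) {C : ℝ}
    (hC : ∀ u ∈ Icc (0 : ℝ) 1, ‖adI (h' u - h u) ((innerEvolution h u).symm b)‖ ≤ C) {s : ℝ}
    (hs : s ∈ Icc (0 : ℝ) 1) :
    ‖innerEvolution h' s ((innerEvolution h s).symm b) - b‖ ≤ C := by
  obtain ⟨h0, hu, hV⟩ := propagator_spec hh
  obtain ⟨h0', hu', hV'⟩ := propagator_spec hh'
  have hW := hV'.mul hV.star
  have hF := (hW.mul (IsPrim.const b)).mul hW.star
  have hF' := hF.congr' (g := fun u =>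
      propagator h' u * adI (h' u - h u) ((innerEvolution h u).symm b) *
        star (propagator h' u)) fun u hu' => by
    rw [innerEvolution_symm_apply hh hu', adI]
    have hsa := (hh.isSelfAdjoint u hu').star_eq
    have hsa' := (hh'.isSelfAdjoint u hu').star_eq
    have huu : star (propagator h u) * propagator h u = 1 := (hu u hu').1
    simp only [star_smul, star_mul, star_star, star_add, hsa, hsa', mul_zero, add_zero,
      smul_mul_assoc, mul_smul_comm, mul_sub, sub_mul, smul_sub, add_mul, mul_add, star_neg,
      mul_assoc, Complex.star_def, Complex.conj_I, neg_smul, neg_mul, mul_neg]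
    abel
  have hle := hF'.norm_sub_le (a := 0) (b := s) (C := C) (by simp) hs fun u hu'' => by
    have hmem := hu' u hu''
    rw [CStarRing.norm_mul_mem_unitary _ (Unitary.star_mem hmem),
      CStarRing.norm_mem_unitary_mul _ hmem]
    exact hC u hu''
  simpa [h0, h0', innerEvolution_apply hh' hs, innerEvolution_symm_apply hh hs, mul_assoc]
    using hle

end Heisenberg

/-! ### Diameters and weights -/

section Weights

theorem natAbs_sub_le_diam {S : Finset ℤ} {i j : ℤ} (hi : i ∈ S) (hj : j ∈ S) :
    (i - j).natAbs ≤ diam S :=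
  Finset.le_sup (f := fun p : ℤ × ℤ => (p.1 - p.2).natAbs)
    (Finset.mem_product.2 ⟨hi, hj⟩ : (i, j) ∈ S ×ˢ S)

theorem abs_sub_le_diam {S : Finset ℤ} {i j : ℤ} (hi : i ∈ S) (hj : j ∈ S) :
    |(i : ℝ) - j| ≤ diam S := by
  have h := natAbs_sub_le_diam hi hj
  have h2 : |i - j| ≤ (diam S : ℤ) := by
    rw [Int.abs_eq_natAbs]; exact_mod_cast h
  exact_mod_cast h2

theorem card_le_diam (S : Finset ℤ) : S.card ≤ diam S + 1 := by
  rcases S.eq_empty_or_nonempty with rfl | hS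
  · simp
  · have hsub : S ⊆ Finset.Icc (S.min' hS) (S.min' hS + diam S) := by
      intro i hi
      have h1 := S.min'_le i hi
      have h2 := natAbs_sub_le_diam hi (S.min'_mem hS)
      rw [Finset.mem_Icc]
      omega
    refine (Finset.card_le_card hsub).trans ?_
    rw [Int.card_Icc]
    omega

/-- The weight `1 + |i|` of the site `i`. -/
def siteWeight (i : ℤ) : ℝ := 1 + |(i : ℝ)|

theorem one_le_siteWeight (i : ℤ) : 1 ≤ siteWeight i := by
  unfold siteWeight
  linarith [abs_nonneg (i : ℝ)]

theorem siteWeight_pos (i : ℤ) : 0 < siteWeight i := zero_lt_one.trans_le (one_le_siteWeight i)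

theorem siteWeight_le {S : Finset ℤ} {i k : ℤ} (hi : i ∈ S) (hk : k ∈ S) :
    siteWeight i ≤ (1 + diam S) * siteWeight k := by
  have h := abs_sub_le_diam hi hk
  have h1 : |(i : ℝ)| ≤ |(i : ℝ) - k| + |(k : ℝ)| := by
    simpa using abs_add_le ((i : ℝ) - k) k
  unfold siteWeight
  nlinarith [abs_nonneg (k : ℝ), Nat.cast_nonneg (α := ℝ) (diam S)]

theorem sum_siteWeight_le {S : Finset ℤ} {k : ℤ} (hk : k ∈ S) :
    ∑ i ∈ S, siteWeight i ≤ (1 + diam S) ^ 2 * siteWeight k := by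
  calc ∑ i ∈ S, siteWeight i ≤ ∑ _i ∈ S, (1 + diam S) * siteWeight k :=
        Finset.sum_le_sum fun i hi => siteWeight_le hi hk
    _ = S.card * ((1 + diam S) * siteWeight k) := by rw [Finset.sum_const, nsmul_eq_mul]
    _ ≤ (1 + diam S) * ((1 + diam S) * siteWeight k) := by
        have := siteWeight_pos k
        have hc : (S.card : ℝ) ≤ 1 + diam S := by
          have := card_le_diam S
          have h : (S.card : ℝ) ≤ (diam S : ℝ) + 1 := by exact_mod_cast this
          linarith
        gcongr
    _ = _ := by ring

/-- Exchange of the sums over bonds and over their sites. -/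
theorem sum_bonds_comm {F : Finset (Finset ℤ)} {Y : Finset ℤ} (hY : ∀ S ∈ F, S ⊆ Y)
    (f : Finset ℤ → ℤ → ℝ) :
    ∑ S ∈ F, ∑ i ∈ S, f S i = ∑ i ∈ Y, ∑ S ∈ F with i ∈ S, f S i := by
  refine Finset.sum_comm' fun S i => ?_
  simp only [Finset.mem_filter]
  constructor
  · rintro ⟨h1, h2⟩
    exact ⟨⟨h1, h2⟩, hY S h1 h2⟩
  · rintro ⟨h1, _⟩
    exact h1

theorem sum_bonds_weighted_le {F : Finset (Finset ℤ)} {Y : Finset ℤ} (hY : ∀ S ∈ F, S ⊆ Y)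
    {a : Finset ℤ → ℝ} {K : ℝ}
    (hK : ∀ k, ∑ S ∈ F with k ∈ S, (1 + (diam S : ℝ)) ^ 2 * a S ≤ K) {g : ℤ → ℝ}
    (hg : ∀ i, 0 ≤ g i) :
    ∑ S ∈ F, ∑ k ∈ S, (1 + (diam S : ℝ)) ^ 2 * a S * g k ≤ K * ∑ k ∈ Y, g k := by
  rw [sum_bonds_comm hY, Finset.mul_sum]
  refine Finset.sum_le_sum fun k _ => ?_
  rw [← Finset.sum_mul]
  exact mul_le_mul_of_nonneg_right (hK k) (hg k)

end Weights

/-! ### Regular interactions -/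

section Regular

variable {σ : ℤ → Type} [∀ j, Fintype (σ j)] [∀ j, DecidableEq (σ j)]

/-- The sum of the terms of an interaction over a finite family of sets. -/
def partialHam (H : ℝ → Finset ℤ → SpinAlgebra σ) (F : Finset (Finset ℤ)) (s : ℝ) :
    SpinAlgebra σ := ∑ S ∈ F, H s S

/-- The nonempty subsets of `Λ`. -/
def bonds (Λ : Finset ℤ) : Finset (Finset ℤ) := Λ.powerset.erase ∅

theorem mem_bonds {Λ S : Finset ℤ} : S ∈ bonds Λ ↔ S.Nonempty ∧ S ⊆ Λ := by
  simp [bonds, Finset.nonempty_iff_ne_empty]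

/-- The decay of interactions that the existence of the dynamics needs: a uniform bound on
`∑_{S ∋ i} (1 + diam S)² ‖H_S(s)‖`. The constant term `H_∅`, which does not contribute to the
dynamics, is subject to no measurability condition. -/
structure IsRegular (K : ℝ) (H : ℝ → Finset ℤ → SpinAlgebra σ) : Prop where
  isSelfAdjoint : ∀ s ∈ Icc (0 : ℝ) 1, ∀ S, IsSelfAdjoint (H s S)
  mem_local : ∀ s ∈ Icc (0 : ℝ) 1, ∀ S, H s S ∈ localAlg S
  meas : ∀ S : Finset ℤ, S.Nonempty →
    AEStronglyMeasurable (fun s => H s S) (volume.restrict (Icc (0 : ℝ) 1))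
  bound : ∀ s ∈ Icc (0 : ℝ) 1, ∀ i, ∀ F : Finset (Finset ℤ), (∀ S ∈ F, i ∈ S) →
    ∑ S ∈ F, (1 + (diam S : ℝ)) ^ 2 * ‖H s S‖ ≤ K

variable {K : ℝ} {H : ℝ → Finset ℤ → SpinAlgebra σ}

theorem IsRegular.nonneg (hH : IsRegular K H) : 0 ≤ K := by
  simpa using hH.bound 0 (by simp) 0 ∅ (by simp)

theorem IsRegular.norm_le (hH : IsRegular K H) {s : ℝ} (hs : s ∈ Icc (0 : ℝ) 1) {S : Finset ℤ}
    (hS : S.Nonempty) : ‖H s S‖ ≤ K := by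
  obtain ⟨i, hi⟩ := hS
  have := hH.bound s hs i {S} (by simpa using hi)
  rw [Finset.sum_singleton] at this
  refine le_trans ?_ this
  have h1 : (1 : ℝ) ≤ (1 + (diam S : ℝ)) ^ 2 := by
    nlinarith [Nat.cast_nonneg (α := ℝ) (diam S)]
  exact le_mul_of_one_le_left (norm_nonneg _) h1

theorem IsRegular.isHamiltonian (hH : IsRegular K H) {F : Finset (Finset ℤ)}
    (hF : ∀ S ∈ F, S.Nonempty) : IsHamiltonian (partialHam H F) where
  toIsBddMeas := IsBddMeas.sum F fun S hS =>
    .of_bdd (fun _ hu => hH.norm_le hu (hF S hS)) (hH.meas S (hF S hS))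
  isSelfAdjoint u hu := isSelfAdjoint_sum F fun S _ => hH.isSelfAdjoint u hu S

theorem adI_partialHam (F : Finset (Finset ℤ)) (s : ℝ) (x : SpinAlgebra σ) :
    adI (partialHam H F s) x = ∑ S ∈ F, adI (H s S) x := by
  simp only [adI, partialHam, Finset.sum_mul, Finset.mul_sum]
  rw [← Finset.sum_sub_distrib, Finset.smul_sum]

theorem norm_adI_partialHam_le (hH : IsRegular K H) {s : ℝ} (hs : s ∈ Icc (0 : ℝ) 1)
    (F : Finset (Finset ℤ)) (x : SpinAlgebra σ) :
    ‖adI (partialHam H F s) x‖ ≤ ∑ S ∈ F, 2 * ‖H s S‖ * ∑ i ∈ S, osc i x := by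
  rw [adI_partialHam]
  refine norm_sum_le_of_le _ fun S _ => ?_
  rw [adI, norm_smul, Complex.norm_I, one_mul, ← norm_neg, neg_sub]
  exact norm_commutator_le x (hH.mem_local s hs S)

/-- Terms that reach far out act weakly on observables with rapidly decaying oscillations. -/
theorem norm_adI_partialHam_far_le (hH : IsRegular K H) {s : ℝ} (hs : s ∈ Icc (0 : ℝ) 1)
    {F : Finset (Finset ℤ)} {Y : Finset ℤ} (hY : ∀ S ∈ F, S ⊆ Y) {N : ℕ}
    (hN : ∀ S ∈ F, ∃ j ∈ S, (N : ℤ) < |j|) (x : SpinAlgebra σ) :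
    ‖adI (partialHam H F s) x‖ ≤ 2 * K / (N + 1) * ∑ i ∈ Y, siteWeight i * osc i x := by
  refine (norm_adI_partialHam_le hH hs F x).trans ?_
  have hK : ∀ k, ∑ S ∈ F with k ∈ S, (1 + (diam S : ℝ)) ^ 2 * ‖H s S‖ ≤ K := fun k =>
    hH.bound s hs k _ (by simp)
  have := sum_bonds_weighted_le hY hK (g := fun i => siteWeight i * osc i x)
    fun i => mul_nonneg (siteWeight_pos i).le (osc_nonneg i x)
  have hN0 : (0 : ℝ) < N + 1 := by positivity
  calc ∑ S ∈ F, 2 * ‖H s S‖ * ∑ i ∈ S, osc i x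
      ≤ ∑ S ∈ F, ∑ k ∈ S, 2 / (N + 1) *
          ((1 + (diam S : ℝ)) ^ 2 * ‖H s S‖ * (siteWeight k * osc k x)) := by
        refine Finset.sum_le_sum fun S hS => ?_
        rw [Finset.mul_sum]
        refine Finset.sum_le_sum fun k hk => ?_
        obtain ⟨j, hj, hjN⟩ := hN S hS
        have h1 : (N : ℝ) + 1 ≤ siteWeight j := by
          have : (N : ℤ) + 1 ≤ |j| := hjN
          have : (N : ℝ) + 1 ≤ |(j : ℝ)| := by exact_mod_cast this
          unfold siteWeight; linarith
        have h2 := siteWeight_le hj hk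
        have hw := siteWeight_pos k
        have h3 : (N : ℝ) + 1 ≤ (1 + (diam S : ℝ)) ^ 2 * siteWeight k := by
          refine (h1.trans h2).trans ?_
          gcongr
          nlinarith [Nat.cast_nonneg (α := ℝ) (diam S)]
        have h4 : 2 * ‖H s S‖ * osc k x =
            2 / (N + 1) * ((N + 1) * (‖H s S‖ * osc k x)) := by
          field_simp
        rw [h4]
        have h5 : (0 : ℝ) ≤ ‖H s S‖ * osc k x := mul_nonneg (norm_nonneg _) (osc_nonneg k x)
        refine mul_le_mul_of_nonneg_left ?_ (by positivity)
        calc ((N : ℝ) + 1) * (‖H s S‖ * osc k x)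
            ≤ ((1 + (diam S : ℝ)) ^ 2 * siteWeight k) * (‖H s S‖ * osc k x) := by gcongr
          _ = _ := by ring
    _ = 2 / (N + 1) * ∑ S ∈ F, ∑ k ∈ S,
          ((1 + (diam S : ℝ)) ^ 2 * ‖H s S‖ * (siteWeight k * osc k x)) := by
        simp_rw [Finset.mul_sum]
    _ ≤ 2 / (N + 1) * (K * ∑ k ∈ Y, siteWeight k * osc k x) := by gcongr
    _ = _ := by ring

/-! ### The Lieb–Robinson bound -/

theorem norm_le_one_of_mem_unitary {R : Type*} [CStarAlgebra R] {u : R} (hu : u ∈ unitary R) :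
    ‖u‖ ≤ 1 := by
  rcases subsingleton_or_nontrivial R with h | h
  · simp [Subsingleton.elim u 0]
  · exact (CStarRing.norm_of_mem_unitary hu).le

theorem norm_siteUnitary_le (i : ℤ) (g : SiteGroup σ i) : ‖siteUnitary i g‖ ≤ 1 :=
  norm_le_one_of_mem_unitary (siteUnitary_mem_unitary i g)

theorem osc_eq_zero {X : Finset ℤ} {a : SpinAlgebra σ} (ha : a ∈ localAlg X) {i : ℤ}
    (hi : i ∉ X) : osc i a = 0 := by
  refine le_antisymm (osc_le_of_forall fun g => ?_) (osc_nonneg i a)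
  have : a * siteUnitary i g = siteUnitary i g * a :=
    commute_of_disjoint (by simpa using hi) ha (siteUnitary_mem i g)
  rw [this, sub_self, norm_zero]

theorem osc_le (i : ℤ) (a : SpinAlgebra σ) : osc i a ≤ 2 * ‖a‖ := by
  refine osc_le_of_forall fun g => ?_
  have h := norm_siteUnitary_le i g
  have e1 := norm_mul_le a (siteUnitary i g)
  have e2 := norm_mul_le (siteUnitary i g) a
  have := norm_sub_le (a * siteUnitary i g) (siteUnitary i g * a)
  nlinarith [norm_nonneg a]

theorem sum_weight_osc_le {X : Finset ℤ} {a : SpinAlgebra σ} (ha : a ∈ localAlg X)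
    (Y : Finset ℤ) :
    ∑ i ∈ Y, siteWeight i * osc i a ≤ ∑ i ∈ X, siteWeight i * (2 * ‖a‖) := by
  have h0 : ∀ i, 0 ≤ siteWeight i * osc i a := fun i =>
    mul_nonneg (siteWeight_pos i).le (osc_nonneg i a)
  calc ∑ i ∈ Y, siteWeight i * osc i a ≤ ∑ i ∈ Y ∪ X, siteWeight i * osc i a :=
        Finset.sum_le_sum_of_subset_of_nonneg Finset.subset_union_left fun i _ _ => h0 i
    _ = ∑ i ∈ X, siteWeight i * osc i a := by
        refine (Finset.sum_subset Finset.subset_union_right fun i _ hi => ?_).symm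
        rw [osc_eq_zero ha hi, mul_zero]
    _ ≤ _ := Finset.sum_le_sum fun i _ =>
        mul_le_mul_of_nonneg_left (osc_le i a) (siteWeight_pos i).le

/-- A single term of the generator spreads commutators along bonds. -/
theorem norm_commutator_adI_le (hH : IsRegular K H) {s : ℝ} (hs : s ∈ Icc (0 : ℝ) 1)
    (F : Finset (Finset ℤ)) (x : SpinAlgebra σ) {i : ℤ} (g : SiteGroup σ i) :
    ‖x * adI (partialHam H F s) (siteUnitary i g) - adI (partialHam H F s) (siteUnitary i g) * x‖ ≤
      ∑ S ∈ F with i ∈ S, 4 * ‖H s S‖ * ∑ k ∈ S, osc k x := by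
  have h0 : ∀ S ∈ F, i ∉ S → adI (H s S) (siteUnitary i g) = 0 := by
    intro S _ hi
    have : H s S * siteUnitary i g = siteUnitary i g * H s S :=
      commute_of_disjoint (by simpa using hi) (hH.mem_local s hs S) (siteUnitary_mem i g)
    rw [adI, this, sub_self, smul_zero]
  have e : adI (partialHam H F s) (siteUnitary i g) =
      ∑ S ∈ F with i ∈ S, adI (H s S) (siteUnitary i g) := by
    rw [adI_partialHam, Finset.sum_filter]
    refine Finset.sum_congr rfl fun S hS => ?_
    by_cases hi : i ∈ S
    · rw [if_pos hi]
    · rw [if_neg hi, h0 S hS hi]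
  rw [e, Finset.mul_sum, Finset.sum_mul, ← Finset.sum_sub_distrib]
  refine norm_sum_le_of_le _ fun S hS => ?_
  have hiS : i ∈ S := (Finset.mem_filter.1 hS).2
  have hv : siteUnitary i g ∈ localAlg S :=
    localAlg_mono (by simpa using hiS) (siteUnitary_mem i g)
  have hmem : adI (H s S) (siteUnitary i g) ∈ localAlg S := by
    have hh := hH.mem_local s hs S
    exact (localAlg S).smul_mem (sub_mem (mul_mem hh hv) (mul_mem hv hh)) _
  refine (norm_commutator_le x hmem).trans ?_
  have h1 : ‖adI (H s S) (siteUnitary i g)‖ ≤ 2 * ‖H s S‖ :=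
    (norm_adI_le _ _).trans (mul_le_of_le_one_right (by positivity) (norm_siteUnitary_le i g))
  have h2 : 0 ≤ ∑ k ∈ S, osc k x := Finset.sum_nonneg fun k _ => osc_nonneg k x
  calc 2 * ‖adI (H s S) (siteUnitary i g)‖ * ∑ k ∈ S, osc k x
      ≤ 2 * (2 * ‖H s S‖) * ∑ k ∈ S, osc k x := by gcongr
    _ = _ := by ring

theorem norm_commutator_symm (e : SpinAlgebra σ ≃⋆ₐ[ℂ] SpinAlgebra σ) (b y : SpinAlgebra σ) :
    ‖e.symm b * y - y * e.symm b‖ = ‖b * e y - e y * b‖ := by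
  rw [← norm_starAlgEquiv e, map_sub, map_mul, map_mul, StarAlgEquiv.apply_symm_apply]

/-- A Lieb–Robinson bound: the weighted sum of the oscillations of an observable that is evolved
from a local one stays bounded, uniformly in the volume. Here the observable is local at time `t`,
and the bound is derived from Grönwall's inequality. -/
theorem sum_weight_osc_evolution_le (hH : IsRegular K H) {F : Finset (Finset ℤ)}
    (hF : ∀ S ∈ F, S.Nonempty) {Y : Finset ℤ} (hY : ∀ S ∈ F, S ⊆ Y)
    {β : ℝ → SpinAlgebra σ ≃⋆ₐ[ℂ] SpinAlgebra σ}
    (hβ : IsHeisenbergSolution (partialHam H F) β) {t : ℝ} (ht : t ∈ Icc (0 : ℝ) 1)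
    {X : Finset ℤ} {b : SpinAlgebra σ} (hb : (β t).symm b ∈ localAlg X) :
    ∀ u ∈ Icc (0 : ℝ) 1, ∑ i ∈ Y, siteWeight i * osc i ((β u).symm b) ≤
      (∑ i ∈ X, siteWeight i * (2 * ‖b‖)) * Real.exp (4 * K) := by
  have hh := hH.isHamiltonian hF
  obtain ⟨M, hM0, hM⟩ := hh.exists_adI_bound
  set L : SpinAlgebra σ →L[ℝ] SpinAlgebra σ :=
    ContinuousLinearMap.mul ℝ _ b - (ContinuousLinearMap.mul ℝ _).flip b with hL
  have hLa : ∀ y, L y = b * y - y * b := fun y => rfl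
  have hp : ∀ (i : ℤ) (g : SiteGroup σ i), IsPrim (fun u => L (β u (siteUnitary i g)))
      (fun u => L (β u (adI (partialHam H F u) (siteUnitary i g)))) := fun i g =>
    (hβ.isPrim (M := M * ‖siteUnitary i g‖) fun u hu => hM u hu _).clm_comp L
  set n : ∀ i : ℤ, SiteGroup σ i → ℝ → ℝ := fun i g u => ‖L (β u (siteUnitary i g))‖ with hn
  set m : ∀ i : ℤ, SiteGroup σ i → ℝ → ℝ := fun i g u =>
    ‖L (β u (adI (partialHam H F u) (siteUnitary i g)))‖ with hm
  have hosc : ∀ i u, osc i ((β u).symm b) =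
      (Fintype.card (SiteGroup σ i) : ℝ)⁻¹ * ∑ g, n i g u := fun i u => by
    simp only [osc, norm_commutator_symm, hn, hLa]
  have hnm : ∀ i g, ∀ u ∈ Icc (0 : ℝ) 1, n i g u ≤ n i g t + ∫ r in uIoc t u, m i g r := by
    intro i g u hu
    have h1 := (hp i g).sub_eq ht hu
    have h2 : L (β u (siteUnitary i g)) = L (β t (siteUnitary i g)) +
        ∫ r in t..u, L (β r (adI (partialHam H F r) (siteUnitary i g))) := by
      rw [← h1]; abel
    simp only [hn]
    rw [h2]
    exact (norm_add_le _ _).trans (add_le_add_right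
      intervalIntegral.norm_integral_le_integral_norm_uIoc _)
  have hmi : ∀ i g, ∀ u ∈ Icc (0 : ℝ) 1, IntegrableOn (m i g) (uIoc t u) := fun i g u hu =>
    ((hp i g).toIsBddMeas.norm.intervalIntegrable ht hu).def'
  -- Grönwall's inequality is applied to `φ`; `Q` bounds its rate of change
  set φ : ℝ → ℝ := fun u => ∑ i ∈ Y, siteWeight i * osc i ((β u).symm b) with hφ
  have hφc : ContinuousOn φ (Icc 0 1) := by
    simp only [hφ, hosc]
    refine continuousOn_finsetSum _ fun i _ => continuousOn_const.mul (continuousOn_const.mul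
      (continuousOn_finsetSum _ fun g _ => (hp i g).continuousOn.norm))
  have hφ0 : ∀ u, 0 ≤ φ u := fun u => Finset.sum_nonneg fun i _ =>
    mul_nonneg (siteWeight_pos i).le (osc_nonneg _ _)
  set Q : ℝ → ℝ := fun r => ∑ i ∈ Y, siteWeight i *
    ((Fintype.card (SiteGroup σ i) : ℝ)⁻¹ * ∑ g, m i g r) with hQ
  have hQφ : ∀ r ∈ Icc (0 : ℝ) 1, Q r ≤ 4 * K * φ r := by
    intro r hr
    set x := (β r).symm b with hx
    have hmle : ∀ i g, m i g r ≤ ∑ S ∈ F with i ∈ S, 4 * ‖H r S‖ * ∑ k ∈ S, osc k x := by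
      intro i g
      simp only [hm, hLa]
      rw [← norm_commutator_symm]
      exact norm_commutator_adI_le hH hr F x g
    have hK : ∀ k, ∑ S ∈ F with k ∈ S, (1 + (diam S : ℝ)) ^ 2 * ‖H r S‖ ≤ K := fun k =>
      hH.bound r hr k _ (by simp)
    have hgnn : ∀ S : Finset ℤ, 0 ≤ ∑ k ∈ S, osc k x := fun S =>
      Finset.sum_nonneg fun k _ => osc_nonneg k x
    calc Q r ≤ ∑ i ∈ Y, siteWeight i * ∑ S ∈ F with i ∈ S, 4 * ‖H r S‖ * ∑ k ∈ S, osc k x := by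
          refine Finset.sum_le_sum fun i _ =>
            mul_le_mul_of_nonneg_left ?_ (siteWeight_pos i).le
          rw [inv_mul_le_iff₀ (card_siteGroup_pos i)]
          refine (Finset.sum_le_sum fun g _ => hmle i g).trans_eq ?_
          simp
      _ = ∑ S ∈ F, ∑ i ∈ S, siteWeight i * (4 * ‖H r S‖ * ∑ k ∈ S, osc k x) := by
          rw [sum_bonds_comm hY]
          simp_rw [Finset.mul_sum]
      _ = ∑ S ∈ F, ∑ k ∈ S, (∑ i ∈ S, siteWeight i) * (4 * ‖H r S‖ * osc k x) := by
          refine Finset.sum_congr rfl fun S _ => ?_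
          simp_rw [← Finset.sum_mul, ← Finset.mul_sum]
      _ ≤ ∑ S ∈ F, ∑ k ∈ S, 4 * ((1 + (diam S : ℝ)) ^ 2 * ‖H r S‖ *
            (siteWeight k * osc k x)) := by
          refine Finset.sum_le_sum fun S _ => Finset.sum_le_sum fun k hk => ?_
          have h5 : 0 ≤ 4 * ‖H r S‖ * osc k x := by
            have := osc_nonneg k x
            positivity
          refine (mul_le_mul_of_nonneg_right (sum_siteWeight_le hk) h5).trans_eq ?_
          ring
      _ = 4 * ∑ S ∈ F, ∑ k ∈ S, ((1 + (diam S : ℝ)) ^ 2 * ‖H r S‖ *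
            (siteWeight k * osc k x)) := by simp_rw [Finset.mul_sum]
      _ ≤ 4 * (K * ∑ k ∈ Y, siteWeight k * osc k x) := by
          gcongr
          exact sum_bonds_weighted_le hY hK fun i =>
            mul_nonneg (siteWeight_pos i).le (osc_nonneg i x)
      _ = _ := by simp only [hφ]; ring
  have hφt : φ t ≤ ∑ i ∈ X, siteWeight i * (2 * ‖b‖) := by
    refine (sum_weight_osc_le hb Y).trans_eq ?_
    rw [norm_starAlgEquiv]
  have hc0 : 0 ≤ ∑ i ∈ X, siteWeight i * (2 * ‖b‖) := (hφ0 t).trans hφt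
  refine gronwall_Icc hφc (by linarith [hH.nonneg]) hc0 ht (fun u hu => ?_) fun u _ => hφ0 u
  have hsub : uIoc t u ⊆ Icc (0 : ℝ) 1 :=
    uIoc_subset_uIcc.trans ((convex_Icc (0 : ℝ) 1).ordConnected.uIcc_subset ht hu)
  have hQi : IntegrableOn Q (uIoc t u) := by
    refine integrable_finsetSum _ fun i _ => ((integrable_finsetSum _ fun g _ =>
      hmi i g u hu).const_mul _).const_mul _
  calc φ u ≤ φ t + ∫ r in uIoc t u, Q r := by
        have e : ∫ r in uIoc t u, Q r = ∑ i ∈ Y, siteWeight i *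
            ((Fintype.card (SiteGroup σ i) : ℝ)⁻¹ * ∑ g, ∫ r in uIoc t u, m i g r) := by
          simp only [hQ]
          rw [integral_finsetSum _ fun i _ => ((integrable_finsetSum _ fun g _ =>
            hmi i g u hu).const_mul _).const_mul _]
          refine Finset.sum_congr rfl fun i _ => ?_
          rw [integral_const_mul, integral_const_mul, integral_finsetSum _ fun g _ => hmi i g u hu]
        rw [e]
        simp only [hφ, hosc]
        rw [← Finset.sum_add_distrib]
        refine Finset.sum_le_sum fun i _ => ?_
        rw [← mul_add, ← mul_add, ← Finset.sum_add_distrib]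
        refine mul_le_mul_of_nonneg_left (mul_le_mul_of_nonneg_left
          (Finset.sum_le_sum fun g _ => hnm i g u hu) ?_) (siteWeight_pos i).le
        exact inv_nonneg.2 (card_siteGroup_pos i).le
    _ ≤ φ t + ∫ r in uIoc t u, 4 * K * φ r := by
        refine add_le_add_right (setIntegral_mono_on hQi ?_ measurableSet_uIoc
          fun r hr => hQφ r (hsub hr)) _
        exact ((IsBddMeas.of_continuousOn hφc).intervalIntegrable ht hu).def'.const_mul _
    _ ≤ (∑ i ∈ X, siteWeight i * (2 * ‖b‖)) + 4 * K * |∫ r in t..u, φ r| := by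
        rw [integral_const_mul, intervalIntegral.abs_intervalIntegral_eq, abs_of_nonneg]
        · gcongr
        · exact setIntegral_nonneg measurableSet_uIoc fun r _ => hφ0 r

end Regular

/-! ### Evolutions in infinite volume -/

section Infinite

variable {σ : ℤ → Type} [∀ j, Fintype (σ j)] [∀ j, DecidableEq (σ j)]
variable {K : ℝ} {H : ℝ → Finset ℤ → SpinAlgebra σ}

/-- The evolution that is generated by the terms of `H` in the finite volume `Λ`. -/
def volumeEvolution (H : ℝ → Finset ℤ → SpinAlgebra σ) (Λ : Finset ℤ) (s : ℝ) :
    SpinAlgebra σ ≃⋆ₐ[ℂ] SpinAlgebra σ :=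
  innerEvolution (partialHam H (bonds Λ)) s

theorem IsRegular.isHamiltonian_bonds (hH : IsRegular K H) (Λ : Finset ℤ) :
    IsHamiltonian (partialHam H (bonds Λ)) :=
  hH.isHamiltonian fun _ hS => (mem_bonds.1 hS).1

theorem IsRegular.isHeisenbergSolution (hH : IsRegular K H) (Λ : Finset ℤ) :
    IsHeisenbergSolution (partialHam H (bonds Λ)) (volumeEvolution H Λ) :=
  isHeisenbergSolution_innerEvolution (hH.isHamiltonian_bonds Λ)

/-- The generators of two volumes that contain `[-N, N]` differ by terms that reach further out
than `N`. -/
theorem norm_adI_sub_volume_le (hH : IsRegular K H) {N : ℕ} {Λ Λ' : Finset ℤ}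
    (hN : Finset.Icc (-(N : ℤ)) N ⊆ Λ) (hΛ : Λ ⊆ Λ') {u : ℝ} (hu : u ∈ Icc (0 : ℝ) 1)
    (x : SpinAlgebra σ) :
    ‖adI (partialHam H (bonds Λ') u - partialHam H (bonds Λ) u) x‖ ≤
      2 * K / (N + 1) * ∑ i ∈ Λ', siteWeight i * osc i x := by
  have hsub : bonds Λ ⊆ bonds Λ' := fun S hS => by
    rw [mem_bonds] at hS ⊢
    exact ⟨hS.1, hS.2.trans hΛ⟩
  have e : partialHam H (bonds Λ') u - partialHam H (bonds Λ) u =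
      partialHam H (bonds Λ' \ bonds Λ) u := by
    rw [sub_eq_iff_eq_add, partialHam, partialHam, partialHam, Finset.sum_sdiff hsub]
  rw [e]
  refine norm_adI_partialHam_far_le hH hu (fun S hS => ?_) (fun S hS => ?_) x
  · exact (mem_bonds.1 (Finset.mem_sdiff.1 hS).1).2
  · obtain ⟨h1, h2⟩ := Finset.mem_sdiff.1 hS
    have h3 : ¬ S ⊆ Λ := fun h => h2 (mem_bonds.2 ⟨(mem_bonds.1 h1).1, h⟩)
    obtain ⟨j, hj, hjΛ⟩ := Finset.not_subset.1 h3
    refine ⟨j, hj, ?_⟩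
    by_contra hle
    rw [not_lt, abs_le] at hle
    exact hjΛ (hN (Finset.mem_Icc.2 hle))

theorem norm_volumeEvolution_comp_sub_le (hH : IsRegular K H) {N : ℕ} {Λ Λ' : Finset ℤ}
    (hN : Finset.Icc (-(N : ℤ)) N ⊆ Λ) (hΛ : Λ ⊆ Λ') {s t : ℝ} (hs : s ∈ Icc (0 : ℝ) 1)
    (ht : t ∈ Icc (0 : ℝ) 1) {X : Finset ℤ} {b : SpinAlgebra σ}
    (hb : (volumeEvolution H Λ t).symm b ∈ localAlg X) :
    ‖volumeEvolution H Λ' s ((volumeEvolution H Λ s).symm b) - b‖ ≤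
      2 * K / (N + 1) * ((∑ i ∈ X, siteWeight i * (2 * ‖b‖)) * Real.exp (4 * K)) := by
  have hK := hH.nonneg
  refine norm_innerEvolution_comp_sub_le (hH.isHamiltonian_bonds Λ) (hH.isHamiltonian_bonds Λ') b
    (fun u hu => ?_) hs
  refine (norm_adI_sub_volume_le hH hN hΛ hu _).trans ?_
  refine mul_le_mul_of_nonneg_left ?_ (by positivity)
  exact sum_weight_osc_evolution_le hH (fun S hS => (mem_bonds.1 hS).1)
    (fun S hS => (mem_bonds.1 hS).2.trans hΛ) (hH.isHeisenbergSolution Λ) ht hb u hu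

theorem volumeEvolution_zero_symm (hH : IsRegular K H) (Λ : Finset ℤ) (a : SpinAlgebra σ) :
    (volumeEvolution H Λ 0).symm a = a := by
  rw [volumeEvolution, innerEvolution_symm_apply (hH.isHamiltonian_bonds Λ) (by simp),
    (propagator_spec (hH.isHamiltonian_bonds Λ)).1]
  simp

/-- Evolutions of a local observable in different large volumes are close to each other. -/
theorem exists_volumeEvolution_rate (hH : IsRegular K H) {X : Finset ℤ} {a : SpinAlgebra σ}
    (ha : a ∈ localAlg X) :
    ∃ C : ℝ, ∀ (N : ℕ) (Λ Λ' : Finset ℤ), Finset.Icc (-(N : ℤ)) N ⊆ Λ → Λ ⊆ Λ' →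
      ∀ s ∈ Icc (0 : ℝ) 1, ‖volumeEvolution H Λ' s a - volumeEvolution H Λ s a‖ ≤ C / (N + 1) ∧
        ‖(volumeEvolution H Λ' s).symm a - (volumeEvolution H Λ s).symm a‖ ≤ C / (N + 1) := by
  refine ⟨2 * K * ((∑ i ∈ X, siteWeight i * (2 * ‖a‖)) * Real.exp (4 * K)),
    fun N Λ Λ' hN hΛ s hs => ⟨?_, ?_⟩⟩
  · have := norm_volumeEvolution_comp_sub_le hH hN hΛ hs hs (X := X)
      (b := volumeEvolution H Λ s a) (by simpa using ha)
    rw [StarAlgEquiv.symm_apply_apply, norm_starAlgEquiv] at this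
    refine this.trans_eq ?_
    ring
  · have := norm_volumeEvolution_comp_sub_le hH hN hΛ hs (t := 0) (by simp) (X := X)
      (b := a) (by rw [volumeEvolution_zero_symm hH]; exact ha)
    rw [← norm_starAlgEquiv (volumeEvolution H Λ' s), map_sub, StarAlgEquiv.apply_symm_apply,
      norm_sub_rev]
    refine this.trans_eq ?_
    ring

/-- A net of isometries converges pointwise if it converges on the local observables. -/
theorem exists_tendsto_of_local {E : Finset ℤ → SpinAlgebra σ → SpinAlgebra σ}
    (hE : ∀ Λ x y, ‖E Λ x - E Λ y‖ = ‖x - y‖)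
    (h : ∀ X, ∀ a ∈ localAlg X, ∃ C : ℝ, ∀ (N : ℕ) (Λ Λ' : Finset ℤ),
      Finset.Icc (-(N : ℤ)) N ⊆ Λ → Λ ⊆ Λ' → ‖E Λ' a - E Λ a‖ ≤ C / (N + 1)) (a : SpinAlgebra σ) :
    ∃ x, Tendsto (fun Λ => E Λ a) atTop (𝓝 x) := by
  refine cauchySeq_tendsto_of_complete (Metric.cauchySeq_iff'.2 fun ε hε => ?_)
  obtain ⟨X, y, hy, hay⟩ := exists_local_approx a (ε := ε / 3) (by positivity)
  obtain ⟨C, hC⟩ := h X y hy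
  obtain ⟨N, hN⟩ := exists_nat_gt (3 * C / ε)
  refine ⟨Finset.Icc (-(N : ℤ)) N, fun Λ hΛ => ?_⟩
  have h1 := hC N _ Λ le_rfl hΛ
  have h2 : C / (N + 1) < ε / 3 := by
    rw [div_lt_iff₀ (by positivity)]
    rw [div_lt_iff₀ hε] at hN
    nlinarith
  rw [dist_eq_norm]
  set Λ₀ := Finset.Icc (-(N : ℤ)) N
  calc ‖E Λ a - E Λ₀ a‖ = ‖(E Λ a - E Λ y) + (E Λ y - E Λ₀ y) + (E Λ₀ y - E Λ₀ a)‖ := by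
        congr 1; abel
    _ ≤ ‖E Λ a - E Λ y‖ + ‖E Λ y - E Λ₀ y‖ + ‖E Λ₀ y - E Λ₀ a‖ := norm_add₃_le
    _ < ε := by
        rw [hE, hE, norm_sub_rev y a]
        linarith

/-- Pointwise limits of `*`-automorphisms are `*`-automorphisms if the inverses converge, too. -/
theorem exists_starAlgEquiv_tendsto {R ι : Type*} [CStarAlgebra R] {l : Filter ι} [l.NeBot]
    (e : ι → R ≃⋆ₐ[ℂ] R) (h : ∀ a, ∃ x, Tendsto (fun i => e i a) l (𝓝 x))
    (h' : ∀ a, ∃ x, Tendsto (fun i => (e i).symm a) l (𝓝 x)) :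
    ∃ α : R ≃⋆ₐ[ℂ] R, ∀ a, Tendsto (fun i => e i a) l (𝓝 (α a)) := by
  choose f hf using h
  choose g hg using h'
  have hfg : ∀ a, f (g a) = a := fun a => by
    have h1 : Tendsto (fun i => ‖e i (g a) - a‖) l (𝓝 0) := by
      have h2 : ∀ i, ‖e i (g a) - a‖ = ‖g a - (e i).symm a‖ := fun i => by
        rw [← norm_starAlgEquiv (e i) (g a - _), map_sub, StarAlgEquiv.apply_symm_apply]
      simp_rw [h2]
      simpa using ((tendsto_const_nhds (x := g a)).sub (hg a)).norm
    have h3 := ((hf (g a)).sub_const a).norm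
    exact sub_eq_zero.1 (norm_eq_zero.1 (tendsto_nhds_unique h3 h1))
  have hgf : ∀ a, g (f a) = a := fun a => by
    have h1 : Tendsto (fun i => ‖(e i).symm (f a) - a‖) l (𝓝 0) := by
      have h2 : ∀ i, ‖(e i).symm (f a) - a‖ = ‖f a - e i a‖ := fun i => by
        rw [← norm_starAlgEquiv (e i).symm (f a - _), map_sub, StarAlgEquiv.symm_apply_apply]
      simp_rw [h2]
      simpa using ((tendsto_const_nhds (x := f a)).sub (hf a)).norm
    have h3 := ((hg (f a)).sub_const a).norm
    exact sub_eq_zero.1 (norm_eq_zero.1 (tendsto_nhds_unique h3 h1))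
  refine ⟨⟨⟨⟨⟨f, g, hgf, hfg⟩, ?_, ?_⟩, ?_⟩, ?_⟩, hf⟩
  · intro a b
    refine tendsto_nhds_unique (hf (a * b)) ?_
    simp_rw [map_mul]
    exact (hf a).mul (hf b)
  · intro a b
    refine tendsto_nhds_unique (hf (a + b)) ?_
    simp_rw [map_add]
    exact (hf a).add (hf b)
  · intro a
    refine tendsto_nhds_unique (hf (star a)) ?_
    simp_rw [map_star]
    exact (hf a).star
  · intro c a
    refine tendsto_nhds_unique (hf (c • a)) ?_
    simp_rw [map_smul]
    exact (hf a).const_smul c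

theorem IsRegular.exists_limit (hH : IsRegular K H) :
    ∃ α : ℝ → SpinAlgebra σ ≃⋆ₐ[ℂ] SpinAlgebra σ, ∀ s ∈ Icc (0 : ℝ) 1, ∀ a,
      Tendsto (fun Λ => volumeEvolution H Λ s a) atTop (𝓝 (α s a)) := by
  have : ∀ s, ∃ α : SpinAlgebra σ ≃⋆ₐ[ℂ] SpinAlgebra σ, s ∈ Icc (0 : ℝ) 1 → ∀ a,
      Tendsto (fun Λ => volumeEvolution H Λ s a) atTop (𝓝 (α a)) := by
    intro s
    by_cases hs : s ∈ Icc (0 : ℝ) 1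
    · obtain ⟨α, hα⟩ := exists_starAlgEquiv_tendsto (l := atTop)
        (fun Λ => volumeEvolution H Λ s)
        (exists_tendsto_of_local (fun Λ x y => by rw [← map_sub, norm_starAlgEquiv])
          fun X a ha => by
            obtain ⟨C, hC⟩ := exists_volumeEvolution_rate hH ha
            exact ⟨C, fun N Λ Λ' h1 h2 => (hC N Λ Λ' h1 h2 s hs).1⟩)
        (exists_tendsto_of_local (E := fun Λ => (volumeEvolution H Λ s).symm)
          (fun Λ x y => by rw [← map_sub, norm_starAlgEquiv])
          fun X a ha => by
            obtain ⟨C, hC⟩ := exists_volumeEvolution_rate hH ha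
            exact ⟨C, fun N Λ Λ' h1 h2 => (hC N Λ Λ' h1 h2 s hs).2⟩)
      exact ⟨α, fun _ => hα⟩
    · exact ⟨StarAlgEquiv.refl _ _, fun h => absurd h hs⟩
  choose α hα using this
  exact ⟨α, fun s hs => hα s hs⟩

/-- The term `H_∅` is a scalar and drops out of the generator. -/
theorem adI_localHamiltonian (hH : IsRegular K H) (Λ : Finset ℤ) {u : ℝ}
    (hu : u ∈ Icc (0 : ℝ) 1) (a : SpinAlgebra σ) :
    adI (localHamiltonian H Λ u) a = adI (partialHam H (bonds Λ) u) a := by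
  have e : localHamiltonian H Λ u = H u ∅ + partialHam H (bonds Λ) u := by
    rw [localHamiltonian, partialHam, bonds, Finset.add_sum_erase]
    simp
  have hc : a * H u ∅ = H u ∅ * a := commute_of_mem_localAlg_empty (hH.mem_local u hu ∅) a
  rw [adI_eq_iff, e, add_mul, mul_add, hc]
  abel

theorem IsRegular.exists_isAlmostLocalEvolution (hH : IsRegular K H) :
    ∃ α, IsAlmostLocalEvolution H α := by
  obtain ⟨α, hα⟩ := hH.exists_limit
  exact ⟨α, volumeEvolution H, fun Λ => (hH.isHeisenbergSolution Λ).congr fun u hu a =>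
    (adI_localHamiltonian hH Λ hu a).symm, hα⟩

theorem IsRegular.isAlmostLocalEvolution (hH : IsRegular K H) :
    IsAlmostLocalEvolution H (evolution H) :=
  Classical.epsilon_spec hH.exists_isAlmostLocalEvolution

theorem IsRegular.tendsto_evolution (hH : IsRegular K H) {s : ℝ} (hs : s ∈ Icc (0 : ℝ) 1)
    (a : SpinAlgebra σ) :
    Tendsto (fun Λ => volumeEvolution H Λ s a) atTop (𝓝 (evolution H s a)) := by
  obtain ⟨β, hβ, hlim⟩ := hH.isAlmostLocalEvolution
  refine (hlim s hs a).congr fun Λ => ?_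
  obtain ⟨M, hM0, hM⟩ := (hH.isHamiltonian_bonds Λ).exists_adI_bound
  exact ((hβ Λ).congr fun u hu a => adI_localHamiltonian hH Λ hu a).unique
    (hH.isHeisenbergSolution Λ) hM0 hM s hs a

/-! ### Evolutions and regions -/

/-- Omitting terms from an interaction keeps it regular. -/
theorem IsRegular.of_sub {H' : ℝ → Finset ℤ → SpinAlgebra σ} (hH : IsRegular K H)
    (h : ∀ S, (∀ s, H' s S = H s S) ∨ ∀ s, H' s S = 0) : IsRegular K H' where
  isSelfAdjoint s hs S := by
    rcases h S with h | h <;> rw [h]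
    · exact hH.isSelfAdjoint s hs S
    · exact .zero _
  mem_local s hs S := by
    rcases h S with h | h <;> rw [h]
    · exact hH.mem_local s hs S
    · exact zero_mem _
  meas S hS := by
    rcases h S with h | h <;> simp_rw [h]
    · exact hH.meas S hS
    · exact aestronglyMeasurable_const
  bound s hs i F hF := by
    refine (Finset.sum_le_sum fun S _ => ?_).trans (hH.bound s hs i F hF)
    rcases h S with h | h <;> rw [h]
    rw [norm_zero]
    gcongr
    exact norm_nonneg _

/-- An evolution acts on the observables of a region `Z` like the evolution of any other
interaction with the same terms in `Z`, provided that no terms couple `Z` to its complement. -/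
theorem evolution_eqOn_region {K' : ℝ} {H' : ℝ → Finset ℤ → SpinAlgebra σ} (hH : IsRegular K H)
    (hH' : IsRegular K' H') (Z : Set ℤ)
    (h1 : ∀ s, ∀ S : Finset ℤ, S.Nonempty → (S : Set ℤ) ⊆ Z → H s S = H' s S)
    (h2 : ∀ s, ∀ S : Finset ℤ, ¬ (S : Set ℤ) ⊆ Z → ¬ Disjoint (S : Set ℤ) Z → H s S = 0)
    (h2' : ∀ s, ∀ S : Finset ℤ, ¬ (S : Set ℤ) ⊆ Z → ¬ Disjoint (S : Set ℤ) Z → H' s S = 0)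
    {s : ℝ} (hs : s ∈ Icc (0 : ℝ) 1) {x : SpinAlgebra σ} (hx : x ∈ regionAlg Z) :
    evolution H s x = evolution H' s x ∧ evolution H s x ∈ regionAlg Z := by
  have hcomm : ∀ {K : ℝ} {H : ℝ → Finset ℤ → SpinAlgebra σ}, IsRegular K H →
      (∀ s, ∀ S : Finset ℤ, ¬ (S : Set ℤ) ⊆ Z → ¬ Disjoint (S : Set ℤ) Z → H s S = 0) →
      ∀ s ∈ Icc (0 : ℝ) 1, ∀ S : Finset ℤ, ¬ (S : Set ℤ) ⊆ Z → ∀ x ∈ regionAlg Z,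
      adI (H s S) x = 0 := by
    intro K H hH h2 s hs S hS x hx
    by_cases hd : Disjoint (S : Set ℤ) Z
    · have hc : H s S * x = x * H s S :=
        commute_regionAlg hd (localAlg_le_regionAlg le_rfl (hH.mem_local s hs S)) hx
      rw [adI, hc, sub_self, smul_zero]
    · rw [h2 s S hS hd]
      simp [adI]
  have hmem : ∀ (Λ : Finset ℤ), ∀ u ∈ Icc (0 : ℝ) 1, ∀ x ∈ regionAlg Z,
      adI (partialHam H (bonds Λ) u) x ∈ regionAlg Z := by
    intro Λ u hu x hx
    rw [adI_partialHam]
    refine sum_mem fun S _ => ?_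
    by_cases hSZ : (S : Set ℤ) ⊆ Z
    · have hh := localAlg_le_regionAlg hSZ (hH.mem_local u hu S)
      exact (regionAlg Z).smul_mem (sub_mem (mul_mem hh hx) (mul_mem hx hh)) _
    · rw [hcomm hH h2 u hu S hSZ x hx]
      exact zero_mem _
  have heq : ∀ (Λ : Finset ℤ), ∀ u ∈ Icc (0 : ℝ) 1, ∀ x ∈ regionAlg Z,
      adI (partialHam H (bonds Λ) u) x = adI (partialHam H' (bonds Λ) u) x := by
    intro Λ u hu x hx
    rw [adI_partialHam, adI_partialHam]
    refine Finset.sum_congr rfl fun S hS => ?_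
    by_cases hSZ : (S : Set ℤ) ⊆ Z
    · rw [h1 u S (mem_bonds.1 hS).1 hSZ]
    · rw [hcomm hH h2 u hu S hSZ x hx, hcomm hH' h2' u hu S hSZ x hx]
  constructor
  · refine tendsto_nhds_unique (hH.tendsto_evolution hs x)
      ((hH'.tendsto_evolution hs x).congr fun Λ => ?_)
    obtain ⟨M, hM0, hM⟩ := (hH.isHamiltonian_bonds Λ).exists_adI_bound
    exact ((hH.isHeisenbergSolution Λ).eqOn (hH'.isHeisenbergSolution Λ) hM0 hM
      (regionAlg (σ := σ) Z : Set (SpinAlgebra σ)) (hmem Λ) (heq Λ) s hs x hx).symm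
  · refine (isClosed_regionAlg Z).mem_of_tendsto (hH.tendsto_evolution hs x)
      (Eventually.of_forall fun Λ => ?_)
    obtain ⟨M, hM0, hM⟩ := (hH.isHamiltonian_bonds Λ).exists_adI_bound
    exact (hH.isHeisenbergSolution Λ).mem_of_invariant hM0 hM
      ((regionAlg Z).toSubalgebra.toSubmodule.restrictScalars ℝ) (isClosed_regionAlg Z)
      (hmem Λ) s hs x hx

/-- An evolution acts trivially on the observables that commute with all terms. -/
theorem evolution_eq_self (hH : IsRegular K H) {x : SpinAlgebra σ}
    (h : ∀ s ∈ Icc (0 : ℝ) 1, ∀ S : Finset ℤ, S.Nonempty → adI (H s S) x = 0)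
    {s : ℝ} (hs : s ∈ Icc (0 : ℝ) 1) : evolution H s x = x := by
  refine tendsto_nhds_unique (hH.tendsto_evolution hs x)
    ((tendsto_const_nhds (x := x)).congr fun Λ => ?_)
  obtain ⟨M, hM0, hM⟩ := (hH.isHamiltonian_bonds Λ).exists_adI_bound
  have hid : IsHeisenbergSolution (fun _ => (0 : SpinAlgebra σ)) (fun _ => StarAlgEquiv.refl _ _) := by
    refine isHeisenbergSolution_of_isPrim (fun a => rfl) fun a => ?_
    simpa [adI] using IsPrim.const a
  have h0 : ∀ u ∈ Icc (0 : ℝ) 1, adI (partialHam H (bonds Λ) u) x = 0 := fun u hu => by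
    rw [adI_partialHam]
    exact Finset.sum_eq_zero fun S hS => h u hu S (mem_bonds.1 hS).1
  refine ((hH.isHeisenbergSolution Λ).eqOn hid hM0 hM {x, 0} ?_ ?_ s hs x (by simp)).symm
  · rintro u hu y (rfl | rfl)
    · simp [h0 u hu]
    · simp [adI]
  · rintro u hu y (rfl | rfl)
    · rw [h0 u hu]; simp [adI]
    · simp [adI]

end Infinite

/-! ### Time-dependent interactions are regular -/

section TDI

variable {σ : ℤ → Type} [∀ j, Fintype (σ j)] [∀ j, DecidableEq (σ j)]

theorem FastDecay.exists_le {f : ℕ+ → ℝ} (hf : FastDecay f) :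
    ∃ C, 0 < C ∧ ∀ r : ℕ+, (r : ℝ) ^ 2 * f r ≤ C := by
  have h := (hf.decay 2 (by norm_num)).eventually_le_const (u := 1) zero_lt_one
  obtain ⟨r₀, hr₀⟩ := eventually_atTop.1 h
  have hf1 := hf.pos 1
  refine ⟨1 + (r₀ : ℝ) ^ 2 * f 1, by positivity, fun r => ?_⟩
  rcases le_total r₀ r with hr | hr
  · have := hr₀ r hr
    rw [Real.rpow_two] at this
    have : 0 ≤ (r₀ : ℝ) ^ 2 * f 1 := by positivity
    linarith
  · have h1 : f r ≤ f 1 := hf.antitone one_le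
    have h2 : (r : ℝ) ≤ r₀ := by exact_mod_cast hr
    have h3 := hf.pos r
    calc (r : ℝ) ^ 2 * f r ≤ (r₀ : ℝ) ^ 2 * f 1 := by gcongr
      _ ≤ _ := by linarith

theorem sum_le_interactionNorm (f : ℕ+ → ℝ) (H : Finset ℤ → SpinAlgebra σ) (i : ℤ)
    (F : Finset (Finset ℤ)) (hF : ∀ S ∈ F, i ∈ S) :
    ∑ S ∈ F, ‖H S‖ₑ / ENNReal.ofReal (f (diam S).succPNat) ≤ interactionNorm f H := by
  refine le_trans ?_ (le_iSup (fun j : ℤ => ∑' S : {S : Finset ℤ // j ∈ S},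
    ‖H S‖ₑ / ENNReal.ofReal (f (diam S).succPNat)) i)
  rw [← Finset.sum_attach]
  let e : {S // S ∈ F} ↪ {S : Finset ℤ // i ∈ S} :=
    ⟨fun S => ⟨S.1, hF S.1 S.2⟩, fun S T h => Subtype.ext (congrArg (fun x => x.1) h)⟩
  refine le_trans (le_of_eq ?_) (ENNReal.sum_le_tsum (F.attach.map e))
  rw [Finset.sum_map]
  rfl

/-- A time-dependent interaction is regular. Of the fast decay, only the bound `(1 + r)² f(1 + r) ≤ C`
is used; the measurability of each term follows from convergence in the `f`-norm, which controls the
norm of every term with nonempty support. -/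
theorem IsTDI.exists_isRegular {H : ℝ → Finset ℤ → SpinAlgebra σ} (hH : IsTDI H) :
    ∃ K, IsRegular K H := by
  obtain ⟨f, hf, hint, hsup, u, hu, hlim⟩ := hH
  obtain ⟨C, hC0, hC⟩ := hf.exists_le
  set B := ⨆ s ∈ Icc (0 : ℝ) 1, interactionNorm f (H s) with hB
  refine ⟨C * B.toReal, fun s hs S => (hint s hs).isSelfAdjoint S,
    fun s hs S => (hint s hs).mem_local S, fun S hS => ?_, fun s hs i F hF => ?_⟩
  · obtain ⟨i, hi⟩ := hS
    refine aestronglyMeasurable_of_tendsto_ae atTop (f := fun n s => u n s S)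
      (fun n => (((u n).map fun G : Finset ℤ → SpinAlgebra σ =>
        G S).stronglyMeasurable).aestronglyMeasurable) ?_
    filter_upwards [hlim] with s hs
    have hfp : 0 < ENNReal.ofReal (f (diam S).succPNat) := ENNReal.ofReal_pos.2 (hf.pos _)
    have hle : ∀ n, ‖u n s S - H s S‖ₑ ≤
        interactionNorm f (H s - u n s) * ENNReal.ofReal (f (diam S).succPNat) := by
      intro n
      have := sum_le_interactionNorm f (H s - u n s) i {S} (by simpa using hi)
      rw [Finset.sum_singleton] at this
      rw [← ENNReal.div_le_iff hfp.ne' ENNReal.ofReal_ne_top, enorm_sub_rev]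
      exact this
    have h0 : Tendsto (fun n => interactionNorm f (H s - u n s) *
        ENNReal.ofReal (f (diam S).succPNat)) atTop (𝓝 0) := by
      simpa using ENNReal.Tendsto.mul_const hs (Or.inr ENNReal.ofReal_ne_top)
    have h1 := tendsto_of_tendsto_of_tendsto_of_le_of_le tendsto_const_nhds h0
      (fun n => zero_le) hle
    rw [tendsto_iff_edist_tendsto_0]
    simpa [edist_eq_enorm_sub] using h1
  · have h1 := sum_le_interactionNorm f (H s) i F hF
    have h2 : interactionNorm f (H s) ≤ B := le_iSup₂ (f := fun s _ => interactionNorm f (H s)) s hs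
    have h3 : ∀ S : Finset ℤ, (1 + (diam S : ℝ)) ^ 2 * ‖H s S‖ ≤
        C * (‖H s S‖ / f (diam S).succPNat) := by
      intro S
      have hp := hf.pos (diam S).succPNat
      have := hC (diam S).succPNat
      rw [Nat.succPNat_coe] at this
      push_cast at this
      rw [mul_div_assoc', le_div_iff₀ hp]
      calc (1 + (diam S : ℝ)) ^ 2 * ‖H s S‖ * f (diam S).succPNat
          = (((diam S : ℝ) + 1) ^ 2 * f (diam S).succPNat) * ‖H s S‖ := by ring
        _ ≤ _ := by gcongr
    refine (Finset.sum_le_sum fun S _ => h3 S).trans ?_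
    rw [← Finset.mul_sum]
    refine mul_le_mul_of_nonneg_left ?_ hC0.le
    have h4 : ENNReal.ofReal (∑ S ∈ F, ‖H s S‖ / f (diam S).succPNat) ≤ B := by
      rw [ENNReal.ofReal_sum_of_nonneg fun S _ => div_nonneg (norm_nonneg _) (hf.pos _).le]
      refine le_trans (le_of_eq ?_) (h1.trans h2)
      refine Finset.sum_congr rfl fun S _ => ?_
      rw [ENNReal.ofReal_div_of_pos (hf.pos _), ofReal_norm]
    exact (ENNReal.ofReal_le_iff_le_toReal hsup.ne).1 h4

/-! ### Removing the terms across the cut -/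

/-- The bond `S` crosses the cut between the sites `0` and `1`. -/
def Crosses (S : Finset ℤ) : Prop := (∃ i ∈ S, i ≤ 0) ∧ ∃ j ∈ S, 0 < j

open Classical in
/-- The interaction without the terms that cross the cut. -/
def decouple (H : ℝ → Finset ℤ → SpinAlgebra σ) : ℝ → Finset ℤ → SpinAlgebra σ :=
  fun s S => if Crosses S then 0 else H s S

open Classical in
/-- The terms of the interaction that cross the cut. -/
def crossing (H : ℝ → Finset ℤ → SpinAlgebra σ) : ℝ → Finset ℤ → SpinAlgebra σ :=
  fun s S => if Crosses S then H s S else 0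

variable {K : ℝ} {H : ℝ → Finset ℤ → SpinAlgebra σ}

theorem IsRegular.decouple (hH : IsRegular K H) : IsRegular K (decouple H) :=
  hH.of_sub fun S => by
    by_cases h : Crosses S
    · right; intro s; simp [SpinChain.decouple, h]
    · left; intro s; simp [SpinChain.decouple, h]

theorem IsRegular.crossing (hH : IsRegular K H) : IsRegular K (crossing H) :=
  hH.of_sub fun S => by
    by_cases h : Crosses S
    · left; intro s; simp [SpinChain.crossing, h]
    · right; intro s; simp [SpinChain.crossing, h]

theorem IsRegular.truncate (hH : IsRegular K H) : IsRegular K (truncate H) :=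
  hH.of_sub fun S => by
    by_cases h : ∀ j ∈ S, j ≤ 0
    · left; intro s; simp only [SpinChain.truncate]; rw [if_pos h]
    · right; intro s; simp only [SpinChain.truncate]; rw [if_neg h]

theorem decouple_add_crossing (s : ℝ) (S : Finset ℤ) : decouple H s S + crossing H s S = H s S := by
  by_cases h : Crosses S <;> simp [decouple, crossing, h]

theorem partialHam_sub_decouple (F : Finset (Finset ℤ)) (s : ℝ) :
    partialHam H F s - partialHam (decouple H) F s = partialHam (crossing H) F s := by
  rw [sub_eq_iff_eq_add', partialHam, partialHam, partialHam, ← Finset.sum_add_distrib]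
  exact Finset.sum_congr rfl fun S _ => (decouple_add_crossing s S).symm

theorem summable_siteWeight_inv_sq : Summable fun i : ℤ => (siteWeight i ^ 2)⁻¹ := by
  have h : Summable fun n : ℕ => (((n : ℝ) + 1) ^ 2)⁻¹ := by
    have := (summable_nat_add_iff 1).2 (Real.summable_nat_pow_inv (p := 2).2 (by norm_num))
    simpa using this
  refine Summable.of_nat_of_neg ?_ ?_
  · refine h.congr fun n => ?_
    simp [siteWeight, add_comm]
  · refine h.congr fun n => ?_
    simp [siteWeight, add_comm]

/-- The terms that cross the cut are absolutely summable: a bond that contains the site `i ≤ 0`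
and crosses the cut has diameter at least `1 + |i|`. -/
theorem sum_norm_crossing_le (hH : IsRegular K H) {s : ℝ} (hs : s ∈ Icc (0 : ℝ) 1)
    (F : Finset (Finset ℤ)) :
    ∑ S ∈ F, ‖crossing H s S‖ ≤ K * ∑' i : ℤ, (siteWeight i ^ 2)⁻¹ := by
  classical
  have hc := hH.crossing
  set Y : Finset ℤ := F.biUnion id
  have hY : ∀ S ∈ F, S ⊆ Y := fun S hS => Finset.subset_biUnion_of_mem id hS
  calc ∑ S ∈ F, ‖crossing H s S‖
      ≤ ∑ S ∈ F, ∑ i ∈ S, (1 + (diam S : ℝ)) ^ 2 * ‖crossing H s S‖ * (siteWeight i ^ 2)⁻¹ := by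
        refine Finset.sum_le_sum fun S _ => ?_
        have hnn : ∀ i ∈ S,
            0 ≤ (1 + (diam S : ℝ)) ^ 2 * ‖crossing H s S‖ * (siteWeight i ^ 2)⁻¹ := by
          intro i _; positivity
        by_cases hS : Crosses S
        · obtain ⟨⟨i, hi, hi0⟩, j, hj, hj0⟩ := hS
          refine le_trans ?_ (Finset.single_le_sum hnn hi)
          have hw := siteWeight_pos i
          have hd : siteWeight i ≤ 1 + (diam S : ℝ) := by
            have := abs_sub_le_diam hj hi
            have h1 : (i : ℝ) ≤ 0 := by exact_mod_cast hi0
            have h2 : (0 : ℝ) < j := by exact_mod_cast hj0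
            unfold siteWeight
            rw [abs_of_nonpos h1]
            linarith [le_abs_self ((j : ℝ) - i)]
          have h3 : siteWeight i ^ 2 ≤ (1 + (diam S : ℝ)) ^ 2 := by gcongr
          rw [← div_eq_mul_inv, le_div_iff₀ (by positivity), mul_comm]
          gcongr
        · rw [crossing, if_neg hS, norm_zero]
          exact Finset.sum_nonneg fun i hi => by positivity
    _ ≤ K * ∑ i ∈ Y, (siteWeight i ^ 2)⁻¹ :=
        sum_bonds_weighted_le hY (fun k => hc.bound s hs k _ (by simp)) fun i => by positivity
    _ ≤ _ := by
        refine mul_le_mul_of_nonneg_left ?_ hH.nonneg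
        exact summable_siteWeight_inv_sq.sum_le_tsum _ fun i _ => by positivity

/-- The propagator in the interaction picture. -/
theorem isPrim_interactionPicture {h h0 : ℝ → SpinAlgebra σ} (hh : IsHamiltonian h)
    (hh0 : IsHamiltonian h0) :
    IsPrim (fun s => propagator h s * star (propagator h0 s))
      (fun u => Complex.I • (propagator h u * star (propagator h0 u) *
        innerEvolution h0 u (h u - h0 u))) := by
  obtain ⟨-, hu, hV⟩ := propagator_spec hh
  obtain ⟨-, hu0, hV0⟩ := propagator_spec hh0
  refine (hV.mul hV0.star).congr' fun u hu' => ?_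
  have h1 : star (propagator h0 u) * propagator h0 u = 1 := (hu0 u hu').1
  rw [innerEvolution_apply hh0 hu', star_smul, star_mul, (hh0.isSelfAdjoint u hu').star_eq]
  have h2 : propagator h u * star (propagator h0 u) *
      (propagator h0 u * (h u - h0 u) * star (propagator h0 u)) =
      propagator h u * ((star (propagator h0 u) * propagator h0 u) * (h u - h0 u) *
        star (propagator h0 u)) := by
    simp only [mul_assoc]
  rw [h2, h1, one_mul]
  simp only [smul_mul_assoc, mul_smul_comm, mul_sub, sub_mul, smul_sub, mul_assoc,
    Complex.star_def, Complex.conj_I, neg_smul, mul_neg]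
  abel

/-- Solutions of `W' = i W d` with nearby generators are close to each other: the derivative of
`W₁ W₂*` is `i W₁ (d₁ - d₂) W₂*`. -/
theorem norm_sub_le_integral {W W' d d' : ℝ → SpinAlgebra σ}
    (hW : IsPrim W fun u => Complex.I • (W u * d u))
    (hW' : IsPrim W' fun u => Complex.I • (W' u * d' u)) (h0 : W 0 = 1) (h0' : W' 0 = 1)
    (hu : ∀ u ∈ Icc (0 : ℝ) 1, W u ∈ unitary (SpinAlgebra σ))
    (hu' : ∀ u ∈ Icc (0 : ℝ) 1, W' u ∈ unitary (SpinAlgebra σ))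
    (hd : IsBddMeas d) (hd' : IsBddMeas d')
    (hsa : ∀ u ∈ Icc (0 : ℝ) 1, IsSelfAdjoint (d' u)) :
    ‖W 1 - W' 1‖ ≤ ∫ u in Icc (0 : ℝ) 1, ‖d u - d' u‖ := by
  have hF := (hW.mul hW'.star).congr' (g := fun u => Complex.I • (W u * (d u - d' u) *
      star (W' u))) fun u hmem => by
    rw [star_smul, star_mul, (hsa u hmem).star_eq]
    simp only [smul_mul_assoc, mul_smul_comm, mul_sub, sub_mul, smul_sub, mul_assoc,
      Complex.star_def, Complex.conj_I, neg_smul, mul_neg]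
    abel
  have h1 : (1 : ℝ) ∈ Icc (0 : ℝ) 1 := by simp
  have e : W 1 - W' 1 = (W 1 * star (W' 1) - W 0 * star (W' 0)) * W' 1 := by
    rw [h0, h0', sub_mul, mul_assoc, (hu' 1 h1).1]
    simp
  rw [e, CStarRing.norm_mul_mem_unitary _ (hu' 1 h1), hF.sub_eq (by simp) h1]
  refine (intervalIntegral.norm_integral_le_integral_norm_uIoc).trans ?_
  rw [uIoc_of_le zero_le_one, integral_Icc_eq_integral_Ioc]
  refine setIntegral_mono_on ?_ ?_ measurableSet_Ioc fun u hmem => ?_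
  · exact (hF.toIsBddMeas.norm.integrableOn).mono_set Ioc_subset_Icc_self
  · exact ((hd.sub hd').norm.integrableOn).mono_set Ioc_subset_Icc_self
  · have hmem' := Ioc_subset_Icc_self hmem
    rw [norm_smul, Complex.norm_I, one_mul,
      CStarRing.norm_mul_mem_unitary _ (Unitary.star_mem (hu' u hmem')),
      CStarRing.norm_mem_unitary_mul _ (hu u hmem')]

theorem partialHam_crossing_bonds (Λ : Finset ℤ) (u : ℝ) :
    partialHam (crossing H) (bonds Λ) u = ∑ S ∈ Λ.powerset, crossing H u S := by
  rw [partialHam, bonds]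
  refine Finset.sum_erase _ ?_
  simp [crossing, Crosses]

/-- Removing the terms that cross the cut changes an evolution only by an inner automorphism. -/
theorem exists_unitary_evolution_decouple (hH : IsRegular K H) :
    ∃ U ∈ unitary (SpinAlgebra σ), ∀ a,
      evolution H 1 a = U * evolution (decouple H) 1 a * star U := by
  have hH0 := hH.decouple
  have hc := hH.crossing
  set C := K * ∑' i : ℤ, (siteWeight i ^ 2)⁻¹ with hC
  set d : Finset ℤ → ℝ → SpinAlgebra σ := fun Λ u =>
    volumeEvolution (decouple H) Λ u (partialHam (crossing H) (bonds Λ) u) with hd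
  set W : Finset ℤ → ℝ → SpinAlgebra σ := fun Λ s =>
    propagator (partialHam H (bonds Λ)) s *
      star (propagator (partialHam (decouple H) (bonds Λ)) s) with hW
  have hWp : ∀ Λ, IsPrim (W Λ) fun u => Complex.I • (W Λ u * d Λ u) := fun Λ => by
    have := isPrim_interactionPicture (hH.isHamiltonian_bonds Λ) (hH0.isHamiltonian_bonds Λ)
    simp_rw [partialHam_sub_decouple] at this
    exact this
  have hWu : ∀ Λ, ∀ u ∈ Icc (0 : ℝ) 1, W Λ u ∈ unitary (SpinAlgebra σ) := fun Λ u hu =>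
    mul_mem ((propagator_spec (hH.isHamiltonian_bonds Λ)).2.1 u hu)
      (Unitary.star_mem ((propagator_spec (hH0.isHamiltonian_bonds Λ)).2.1 u hu))
  have hW0 : ∀ Λ, W Λ 0 = 1 := fun Λ => by
    simp [hW, (propagator_spec (hH.isHamiltonian_bonds Λ)).1,
      (propagator_spec (hH0.isHamiltonian_bonds Λ)).1]
  have hdC : ∀ Λ, ∀ u ∈ Icc (0 : ℝ) 1, ‖d Λ u‖ ≤ C := fun Λ u hu => by
    simp only [hd]
    rw [norm_starAlgEquiv]
    exact (norm_sum_le _ _).trans (sum_norm_crossing_le hH hu _)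
  have hdsa : ∀ Λ, ∀ u ∈ Icc (0 : ℝ) 1, IsSelfAdjoint (d Λ u) := fun Λ u hu =>
    ((hc.isHamiltonian_bonds Λ).isSelfAdjoint u hu).map (volumeEvolution (decouple H) Λ u)
  have hdm : ∀ Λ, IsBddMeas (d Λ) := fun Λ => by
    have h1 := (propagator_spec (hH0.isHamiltonian_bonds Λ)).2.2
    have h2 := ((IsBddMeas.of_continuousOn h1.continuousOn).mul
      (hc.isHamiltonian_bonds Λ).toIsBddMeas).mul (.of_continuousOn h1.star.continuousOn)
    refine .of_bdd (hdC Λ) (h2.meas.congr ?_)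
    refine (ae_restrict_iff' measurableSet_Icc).2 (Eventually.of_forall fun u hu => ?_)
    exact (innerEvolution_apply (hH0.isHamiltonian_bonds Λ) hu _).symm
  -- the crossing terms in the interaction picture converge as the volume grows
  have hlim : ∀ u, ∃ x, u ∈ Icc (0 : ℝ) 1 → Tendsto (fun Λ => d Λ u) atTop (𝓝 x) := by
    intro u
    by_cases hu : u ∈ Icc (0 : ℝ) 1
    swap
    · exact ⟨0, fun h => absurd h hu⟩
    have hs : Summable fun S => ‖crossing H u S‖ :=
      summable_of_sum_le (fun S => norm_nonneg _) fun F => sum_norm_crossing_le hH hu F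
    obtain ⟨k, hk⟩ := hs.of_norm
    have hk' : Tendsto (fun Λ => partialHam (crossing H) (bonds Λ) u) atTop (𝓝 k) := by
      simp_rw [partialHam_crossing_bonds]
      exact hk.comp tendsto_finset_powerset_atTop_atTop
    refine ⟨evolution (decouple H) u k, fun _ => ?_⟩
    have h1 := hH0.tendsto_evolution hu k
    have h2 : Tendsto (fun Λ => volumeEvolution (decouple H) Λ u
        (partialHam (crossing H) (bonds Λ) u - k)) atTop (𝓝 0) := by
      rw [tendsto_zero_iff_norm_tendsto_zero]
      simp_rw [norm_starAlgEquiv]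
      simpa using (hk'.sub_const k).norm
    refine (h2.add h1).congr' ?_ |>.trans (by rw [zero_add])
    refine Eventually.of_forall fun Λ => ?_
    simp only [hd]
    rw [map_sub, sub_add_cancel]
  choose dlim hdlim using hlim
  have hdlm : AEStronglyMeasurable dlim (volume.restrict (Icc (0 : ℝ) 1)) :=
    aestronglyMeasurable_of_tendsto_ae atTop (fun Λ => (hdm Λ).meas)
      ((ae_restrict_iff' measurableSet_Icc).2 (Eventually.of_forall hdlim))
  have hdl : IsBddMeas dlim := .of_bdd (C := C) (fun u hu =>
    le_of_tendsto (hdlim u hu).norm (Eventually.of_forall fun Λ => hdC Λ u hu)) hdlm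
  set ε : Finset ℤ → ℝ := fun Λ => ∫ u in Icc (0 : ℝ) 1, ‖d Λ u - dlim u‖ with hε
  have hε0 : Tendsto ε atTop (𝓝 0) := by
    have : Tendsto ε atTop (𝓝 (∫ u in Icc (0 : ℝ) 1, (0 : ℝ))) := by
      refine tendsto_integral_filter_of_dominated_convergence (fun _ => C + C) ?_ ?_ ?_ ?_
      · exact Eventually.of_forall fun Λ => ((hdm Λ).sub hdl).norm.meas
      · refine Eventually.of_forall fun Λ => (ae_restrict_iff' measurableSet_Icc).2
          (Eventually.of_forall fun u hu => ?_)
        rw [norm_norm]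
        exact (norm_sub_le _ _).trans (add_le_add (hdC Λ u hu)
          (le_of_tendsto (hdlim u hu).norm (Eventually.of_forall fun Λ => hdC Λ u hu)))
      · exact integrable_const _
      · refine (ae_restrict_iff' measurableSet_Icc).2 (Eventually.of_forall fun u hu => ?_)
        simpa using ((hdlim u hu).sub_const (dlim u)).norm
    simpa using this
  -- hence so do the propagators of the interaction picture
  have hWε : ∀ Λ Λ', ‖W Λ 1 - W Λ' 1‖ ≤ ε Λ + ε Λ' := by
    intro Λ Λ'
    refine (norm_sub_le_integral (hWp Λ) (hWp Λ') (hW0 Λ) (hW0 Λ') (hWu Λ) (hWu Λ') (hdm Λ)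
      (hdm Λ') (hdsa Λ')).trans ?_
    have hi : ∀ Λ, IntegrableOn (fun u => ‖d Λ u - dlim u‖) (Icc (0 : ℝ) 1) := fun Λ =>
      ((hdm Λ).sub hdl).norm.integrableOn
    simp only [hε]
    rw [← integral_add (hi Λ) (hi Λ')]
    refine integral_mono ((hdm Λ).sub (hdm Λ')).norm.integrableOn ((hi Λ).add (hi Λ')) fun u => ?_
    simp only
    rw [norm_sub_rev (d Λ' u)]
    exact norm_sub_le_norm_sub_add_norm_sub _ _ _
  have hcs : CauchySeq fun Λ => W Λ 1 := by
    refine Metric.cauchySeq_iff'.2 fun δ hδ => ?_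
    obtain ⟨N, hN⟩ := eventually_atTop.1 (hε0.eventually_lt_const (u := δ / 2) (by positivity))
    refine ⟨N, fun Λ hΛ => ?_⟩
    rw [dist_eq_norm]
    linarith [hWε Λ N, hN Λ hΛ, hN N le_rfl]
  obtain ⟨U, hU⟩ := cauchySeq_tendsto_of_complete hcs
  have h1 : (1 : ℝ) ∈ Icc (0 : ℝ) 1 := by simp
  refine ⟨U, ⟨?_, ?_⟩, fun a => ?_⟩
  · exact tendsto_nhds_unique (hU.star.mul hU)
      (tendsto_const_nhds.congr fun Λ => (hWu Λ 1 h1).1.symm)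
  · exact tendsto_nhds_unique (hU.mul hU.star)
      (tendsto_const_nhds.congr fun Λ => (hWu Λ 1 h1).2.symm)
  · refine tendsto_nhds_unique (hH.tendsto_evolution h1 a) ?_
    refine ((hU.mul (hH0.tendsto_evolution h1 a)).mul hU.star).congr fun Λ => ?_
    have hu0 := (propagator_spec (hH0.isHamiltonian_bonds Λ)).2.1 1 h1
    rw [volumeEvolution, volumeEvolution, innerEvolution_apply (hH.isHamiltonian_bonds Λ) h1,
      innerEvolution_apply (hH0.isHamiltonian_bonds Λ) h1]
    simp only [hW, star_mul, star_star]
    set P := propagator (partialHam (decouple H) (bonds Λ)) 1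
    have e : ∀ X Y : SpinAlgebra σ, X * star P * (P * a * star P) * (P * Y) =
        X * ((star P * P) * a * (star P * P)) * Y := fun X Y => by simp only [mul_assoc]
    rw [e, hu0.1]
    simp

end TDI

/-! ### The embedding of a spin chain in a tensor product of chains -/

section Ampliation

variable {σ τ : ℤ → Type}

/-- The configuration of the pair chain that is given by configurations of the two factors. -/
def pairConfig (x : Config σ) (z : Config τ) : Config (fun j => σ j × τ j) := fun j => (x j, z j)

/-- The configuration of the first factor. -/
def fstConfig (m : Config (fun j => σ j × τ j)) : Config σ := fun j => (m j).1

/-- The configuration of the second factor. -/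
def sndConfig (m : Config (fun j => σ j × τ j)) : Config τ := fun j => (m j).2

/-- Configurations of the pair chain are pairs of configurations. -/
def configProdEquiv : Config τ × Config σ ≃ Config (fun j => σ j × τ j) where
  toFun p := pairConfig p.2 p.1
  invFun m := (sndConfig m, fstConfig m)
  left_inv _ := rfl
  right_inv _ := rfl

theorem summable_norm_sq (ξ : ConfigSpace σ) : Summable fun m => ‖ξ m‖ ^ 2 := by
  simpa using (lp.memℓp ξ).summable (by simp)

theorem norm_sq_eq_tsum (ξ : ConfigSpace σ) : ‖ξ‖ ^ 2 = ∑' m, ‖ξ m‖ ^ 2 := by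
  simpa using lp.norm_rpow_eq_tsum (p := 2) (by simp) ξ

/-- The slice `x ↦ ξ (x, z)` of a vector of the pair chain. -/
def slice (z : Config τ) (ξ : ConfigSpace (fun j => σ j × τ j)) : ConfigSpace σ :=
  ⟨fun x => ξ (pairConfig x z), memℓp_gen (by
    have h : Function.Injective fun x : Config σ => pairConfig x z := fun x x' h =>
      funext fun j => congrArg Prod.fst (congrFun h j)
    simpa [Function.comp_def] using (summable_norm_sq ξ).comp_injective h)⟩

theorem slice_apply (z : Config τ) (ξ : ConfigSpace (fun j => σ j × τ j)) (x : Config σ) :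
    slice z ξ x = ξ (pairConfig x z) := rfl

theorem slice_ext {ξ η : ConfigSpace (fun j => σ j × τ j)} (h : ∀ z : Config τ, slice z ξ = slice z η) :
    ξ = η := by
  ext m
  exact congrArg (fun v : ConfigSpace σ => v (fstConfig m)) (h (sndConfig m))

theorem slice_add (z : Config τ) (ξ η : ConfigSpace (fun j => σ j × τ j)) :
    slice z (ξ + η) = slice z ξ + slice z η := rfl

theorem slice_smul (z : Config τ) (c : ℂ) (ξ : ConfigSpace (fun j => σ j × τ j)) :
    slice z (c • ξ) = c • slice z ξ := rfl

theorem hasSum_slice_norm_sq (ξ : ConfigSpace (fun j => σ j × τ j)) :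
    HasSum (fun z : Config τ => ‖slice z ξ‖ ^ 2) (‖ξ‖ ^ 2) := by
  have h := (summable_norm_sq ξ).hasSum
  rw [← norm_sq_eq_tsum, ← configProdEquiv.hasSum_iff] at h
  refine h.prod_fiberwise fun z => ?_
  rw [norm_sq_eq_tsum]
  exact (summable_norm_sq (slice z ξ)).hasSum

theorem hasSum_slice_inner (ξ η : ConfigSpace (fun j => σ j × τ j)) :
    HasSum (fun z : Config τ => ⟪slice z ξ, slice z η⟫_ℂ) ⟪ξ, η⟫_ℂ := by
  have h := lp.hasSum_inner (𝕜 := ℂ) ξ η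
  rw [← configProdEquiv.hasSum_iff] at h
  exact h.prod_fiberwise fun z => lp.hasSum_inner (𝕜 := ℂ) (slice z ξ) (slice z η)

theorem summable_slicewise (T : ConfigSpace σ →L[ℂ] ConfigSpace σ)
    (ξ : ConfigSpace (fun j => σ j × τ j)) :
    Summable (fun m : Config (fun j => σ j × τ j) =>
      ‖T (slice (sndConfig m) ξ) (fstConfig m)‖ ^ 2) ∧
    ∑' m : Config (fun j => σ j × τ j), ‖T (slice (sndConfig m) ξ) (fstConfig m)‖ ^ 2 ≤
      (‖T‖ * ‖ξ‖) ^ 2 := by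
  have hle : ∀ z : Config τ, ∑' x, ‖T (slice z ξ) x‖ ^ 2 ≤ ‖T‖ ^ 2 * ‖slice z ξ‖ ^ 2 := fun z => by
    rw [← norm_sq_eq_tsum, ← mul_pow]
    gcongr
    exact T.le_opNorm _
  have h2 := (hasSum_slice_norm_sq ξ).mul_left (‖T‖ ^ 2)
  have hz : Summable fun z : Config τ => ∑' x, ‖T (slice z ξ) x‖ ^ 2 :=
    Summable.of_nonneg_of_le (fun z => tsum_nonneg fun x => by positivity) hle h2.summable
  have h1 : Summable fun p : Config τ × Config σ => ‖T (slice p.1 ξ) p.2‖ ^ 2 :=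
    (summable_prod_of_nonneg fun p => by positivity).2
      ⟨fun z => summable_norm_sq (T (slice z ξ)), hz⟩
  constructor
  · rw [← configProdEquiv.summable_iff]
    exact h1
  · rw [← configProdEquiv.tsum_eq]
    refine (h1.tsum_prod' fun z => summable_norm_sq (T (slice z ξ))).trans_le ?_
    rw [mul_pow, ← h2.tsum_eq]
    exact hz.tsum_le_tsum hle h2.summable

/-- The operator `T ⊗ 1`, which acts by `T` on every slice. -/
def amplOp (T : ConfigSpace σ →L[ℂ] ConfigSpace σ) :
    ConfigSpace (fun j => σ j × τ j) →L[ℂ] ConfigSpace (fun j => σ j × τ j) :=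
  LinearMap.mkContinuous
    { toFun := fun ξ => ⟨fun m => T (slice (sndConfig m) ξ) (fstConfig m),
        memℓp_gen (by simpa using (summable_slicewise T ξ).1)⟩
      map_add' := fun ξ η => by
        ext m
        change T (slice (sndConfig m) (ξ + η)) (fstConfig m) = _
        rw [slice_add, map_add]
        rfl
      map_smul' := fun c ξ => by
        ext m
        change T (slice (sndConfig m) (c • ξ)) (fstConfig m) = _
        rw [slice_smul, map_smul]
        rfl } ‖T‖ (fun ξ => by
    refine le_of_sq_le_sq ?_ (by positivity)
    rw [norm_sq_eq_tsum]
    exact (summable_slicewise T ξ).2)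

theorem slice_amplOp (T : ConfigSpace σ →L[ℂ] ConfigSpace σ) (z : Config τ)
    (ξ : ConfigSpace (fun j => σ j × τ j)) : slice z (amplOp T ξ) = T (slice z ξ) := rfl

/-- The ampliation `T ↦ T ⊗ 1` as a homomorphism. -/
def amplHom : (ConfigSpace σ →L[ℂ] ConfigSpace σ) →⋆ₐ[ℂ]
    (ConfigSpace (fun j => σ j × τ j) →L[ℂ] ConfigSpace (fun j => σ j × τ j)) where
  toFun := amplOp
  map_one' := by ext1 ξ; exact slice_ext fun z => rfl
  map_mul' S T := by ext1 ξ; exact slice_ext fun z => rfl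
  map_zero' := by ext1 ξ; exact slice_ext fun z => rfl
  map_add' S T := by ext1 ξ; exact slice_ext fun z => rfl
  commutes' r := by ext1 ξ; exact slice_ext fun z => rfl
  map_star' T := by
    rw [ContinuousLinearMap.star_eq_adjoint, ContinuousLinearMap.star_eq_adjoint,
      ContinuousLinearMap.eq_adjoint_iff]
    intro ξ η
    refine (hasSum_slice_inner _ _).unique ?_
    simp_rw [slice_amplOp, ContinuousLinearMap.adjoint_inner_left]
    exact hasSum_slice_inner ξ (amplOp T η)

variable [∀ j, Fintype (σ j)] [∀ j, DecidableEq (σ j)] [∀ j, Fintype (τ j)]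
  [∀ j, DecidableEq (τ j)]

/-- Entries of a Kronecker product, stated for `Matrix.kronecker`; the library lemmas are stated for
`Matrix.kroneckerMap`, to which it unfolds. -/
theorem kronecker_apply_eq {n p : Type} (A : Matrix n n ℂ) (B : Matrix p p ℂ) (i j : n × p) :
    Matrix.kronecker A B i j = A i.1 j.1 * B i.2 j.2 := rfl

theorem kronecker_mul_kronecker {n p : Type} [Fintype n] [Fintype p] (A A' : Matrix n n ℂ)
    (B B' : Matrix p p ℂ) :
    Matrix.kronecker A B * Matrix.kronecker A' B' = Matrix.kronecker (A * A') (B * B') :=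
  (Matrix.mul_kronecker_mul A A' B B').symm

theorem kronecker_one_one {n p : Type} [DecidableEq n] [DecidableEq p] :
    Matrix.kronecker (1 : Matrix n n ℂ) (1 : Matrix p p ℂ) = 1 :=
  Matrix.one_kronecker_one

theorem amplHom_elemTensor (S : Finset ℤ) (a : ∀ j, Matrix (σ j) (σ j) ℂ) :
    amplHom (τ := τ) (toOp (elemTensor S a)) =
      toOp (elemTensor S fun j => Matrix.kronecker (a j) (1 : Matrix (τ j) (τ j) ℂ)) := by
  ext ξ m
  change toOp (elemTensor S a) (slice (sndConfig m) ξ) (fstConfig m) = _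
  rw [toOp_elemTensor_apply, toOp_elemTensor_apply]
  -- the terms on the right vanish unless the second labels agree with those of `m`
  refine Fintype.sum_of_injective
    (fun l : LocalConfig σ S => fun j : S => ((l j, (m j).2) : σ j × τ j)) ?_ _ _ ?_ ?_
  · intro l l' h
    funext j
    exact congrArg Prod.fst (congrFun h j)
  · intro l hl
    rw [mul_eq_zero]
    left
    by_contra hne
    refine hl ⟨fun j => (l j).1, funext fun j => ?_⟩
    have := Finset.prod_ne_zero_iff.1 hne j (Finset.mem_univ _)
    refine Prod.ext rfl ?_
    by_contra hc
    exact this ((kronecker_apply_eq ..).trans (by rw [Matrix.one_apply_ne hc, mul_zero]))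
  · intro l
    congr 1
    · refine Finset.prod_congr rfl fun j _ => ?_
      rw [kronecker_apply_eq]
      simp [fstConfig]
    · rw [slice_apply]
      refine congrArg (fun c => ξ c) (funext fun j => ?_)
      by_cases hj : j ∈ S <;> simp [pairConfig, override, hj, fstConfig, sndConfig]

theorem amplHom_mem (x : SpinAlgebra σ) : amplHom (τ := τ) (toOp x) ∈ quasiLocal (fun j => σ j × τ j) := by
  have hc : Continuous (amplHom (σ := σ) (τ := τ)) :=
    AddMonoidHomClass.continuous_of_bound amplHom 1 fun T => by
      rw [one_mul]
      exact NonUnitalStarAlgHom.norm_apply_le amplHom T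
  have hcl : IsClosed {x : SpinAlgebra σ |
      amplHom (τ := τ) (toOp x) ∈ quasiLocal (fun j => σ j × τ j)} :=
    (StarSubalgebra.isClosed_topologicalClosure _).preimage
      (hc.comp (continuous_subtype_val (p := fun T => T ∈ quasiLocal σ)))
  refine spinAlgebra_induction hcl (fun S => localAlg_induction ?_ ?_ ?_ ?_) x
  · intro a
    rw [amplHom_elemTensor]
    exact Subtype.property (p := fun T => T ∈ quasiLocal (fun j => σ j × τ j)) _
  · rw [map_zero, map_zero]
    exact zero_mem _
  · intro x y hx hy
    rw [map_add, map_add]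
    exact add_mem hx hy
  · intro c x hx
    rw [map_smul, map_smul]
    exact (quasiLocal _).smul_mem hx c

/-- The embedding `a ↦ a ⊗ 1` of a spin chain algebra in the algebra of the pair chain. -/
def ampl : SpinAlgebra σ →⋆ₐ[ℂ] SpinAlgebra (fun j => σ j × τ j) :=
  (amplHom.comp toOp).codRestrict (quasiLocal _) amplHom_mem

theorem norm_ampl_le (x : SpinAlgebra σ) : ‖ampl (τ := τ) x‖ ≤ ‖x‖ :=
  NonUnitalStarAlgHom.norm_apply_le ampl x

theorem continuous_ampl : Continuous (ampl (σ := σ) (τ := τ)) :=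
  AddMonoidHomClass.continuous_of_bound ampl 1 fun x => by
    rw [one_mul]
    exact norm_ampl_le x

theorem ampl_elemTensor (S : Finset ℤ) (a : ∀ j, Matrix (σ j) (σ j) ℂ) :
    ampl (elemTensor S a) =
      elemTensor S fun j => Matrix.kronecker (a j) (1 : Matrix (τ j) (τ j) ℂ) :=
  toOp_injective (amplHom_elemTensor S a)

theorem ampl_mem_localAlg {S : Finset ℤ} {x : SpinAlgebra σ} (hx : x ∈ localAlg S) :
    ampl (τ := τ) x ∈ localAlg S := by
  refine localAlg_induction (p := fun x => ampl (τ := τ) x ∈ localAlg S) ?_ ?_ ?_ ?_ x hx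
  · intro a
    rw [ampl_elemTensor]
    exact elemTensor_mem _ _
  · rw [map_zero]
    exact zero_mem _
  · intro x y hx hy
    rw [map_add]
    exact add_mem hx hy
  · intro c x hx
    rw [map_smul]
    exact (localAlg S).smul_mem hx c

/-- The observable `⨂_{j ∈ S} (1 ⊗ b j)` of the second factor. -/
def sndTensor (S : Finset ℤ) (b : ∀ j, Matrix (τ j) (τ j) ℂ) : SpinAlgebra (fun j => σ j × τ j) :=
  elemTensor S fun j => Matrix.kronecker (1 : Matrix (σ j) (σ j) ℂ) (b j)

theorem ampl_elemTensor_mul_sndTensor (S : Finset ℤ) (a : ∀ j, Matrix (σ j) (σ j) ℂ)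
    (b : ∀ j, Matrix (τ j) (τ j) ℂ) :
    ampl (elemTensor S a) * sndTensor S b = elemTensor S fun j => Matrix.kronecker (a j) (b j) := by
  rw [ampl_elemTensor, sndTensor, elemTensor_mul]
  congr 1
  funext j
  rw [kronecker_mul_kronecker, one_mul, mul_one]

theorem sndTensor_mul_ampl_elemTensor (S : Finset ℤ) (a : ∀ j, Matrix (σ j) (σ j) ℂ)
    (b : ∀ j, Matrix (τ j) (τ j) ℂ) :
    sndTensor S b * ampl (elemTensor S a) = elemTensor S fun j => Matrix.kronecker (a j) (b j) := by
  rw [ampl_elemTensor, sndTensor, elemTensor_mul]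
  congr 1
  funext j
  rw [kronecker_mul_kronecker, one_mul, mul_one]

theorem exists_elemTensor_eq {S T : Finset ℤ} (h : S ⊆ T) (a : ∀ j, Matrix (σ j) (σ j) ℂ) :
    ∃ a', elemTensor T a' = elemTensor S a :=
  ⟨fun j => if j ∈ S then a j else 1, by
    rw [elemTensor_subset h _ fun j hj => if_neg hj, elemTensor_congr fun j hj => if_pos hj]⟩

theorem exists_sndTensor_eq {S T : Finset ℤ} (h : S ⊆ T) (b : ∀ j, Matrix (τ j) (τ j) ℂ) :
    ∃ b', elemTensor T b' = elemTensor S b ∧ sndTensor (σ := σ) T b' = sndTensor S b := by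
  refine ⟨fun j => if j ∈ S then b j else 1, ?_, ?_⟩
  · rw [elemTensor_subset h _ fun j hj => if_neg hj, elemTensor_congr fun j hj => if_pos hj]
  · rw [sndTensor, elemTensor_subset h _ fun j hj => by simp only [if_neg hj, kronecker_one_one]]
    exact elemTensor_congr fun j hj => by simp only [if_pos hj]

/-- A closed linear property that holds for the elementary tensors with support containing `T`
holds for all observables. -/
theorem ampl_induction {p : SpinAlgebra σ → Prop} (hp : IsClosed {x | p x}) (T : Finset ℤ)
    (h : ∀ S : Finset ℤ, T ⊆ S → ∀ a, p (elemTensor S a)) (h0 : p 0)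
    (hadd : ∀ x y, p x → p y → p (x + y)) (hsmul : ∀ (c : ℂ) x, p x → p (c • x))
    (x : SpinAlgebra σ) : p x := by
  refine spinAlgebra_induction hp (fun S => localAlg_induction ?_ h0 hadd hsmul) x
  intro a
  obtain ⟨a', ha'⟩ := exists_elemTensor_eq (Finset.subset_union_left (s₁ := S) (s₂ := T)) a
  rw [← ha']
  exact h _ Finset.subset_union_right _

theorem commute_ampl_sndTensor (x : SpinAlgebra σ) (S : Finset ℤ)
    (b : ∀ j, Matrix (τ j) (τ j) ℂ) : Commute (ampl x) (sndTensor S b) := by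
  have hc := continuous_ampl (σ := σ) (τ := τ)
  refine ampl_induction (p := fun x => Commute (ampl x) (sndTensor S b)) ?_ S ?_ ?_ ?_ ?_ x
  · exact isClosed_eq (by fun_prop) (by fun_prop)
  · intro T hT a
    obtain ⟨b', -, hb'⟩ := exists_sndTensor_eq (σ := σ) hT b
    rw [← hb']
    exact (ampl_elemTensor_mul_sndTensor T a b').trans (sndTensor_mul_ampl_elemTensor T a b').symm
  · rw [map_zero]
    exact Commute.zero_left _
  · intro x y hx hy
    rw [map_add]
    exact hx.add_left hy
  · intro c x hx
    rw [map_smul]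
    exact hx.smul_left c

/-- The products of observables of the two factors span the local algebras of the pair chain. -/
theorem localAlg_pair_induction {S : Finset ℤ} {p : SpinAlgebra (fun j => σ j × τ j) → Prop}
    (h : ∀ (x : SpinAlgebra σ) (b : ∀ j, Matrix (τ j) (τ j) ℂ), p (ampl x * sndTensor S b))
    (h0 : p 0) (hadd : ∀ x y, p x → p y → p (x + y)) (hsmul : ∀ (c : ℂ) x, p x → p (c • x)) :
    ∀ x ∈ localAlg S, p x := by
  rintro _ ⟨a, rfl⟩
  change p (localEmb S a)
  rw [localEmb_eq_sum]
  have hs : ∀ (s : Finset (LocalConfig (fun j => σ j × τ j) S))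
      (f : LocalConfig (fun j => σ j × τ j) S → SpinAlgebra (fun j => σ j × τ j)),
      (∀ i ∈ s, p (f i)) → p (∑ i ∈ s, f i) := fun s f hf =>
    Finset.sum_induction f p hadd h0 hf
  refine hs _ _ fun k _ => hs _ _ fun l _ => hsmul _ _ ?_
  have e : localEmb S (Matrix.single k l 1) =
      ampl (localEmb S (Matrix.single (fun j => (k j).1) (fun j => (l j).1) 1)) * sndTensor S
        fun j => if h : j ∈ S then Matrix.single (k ⟨j, h⟩).2 (l ⟨j, h⟩).2 1 else 1 := by
    rw [← elemTensor_single, ← elemTensor_single, ampl_elemTensor_mul_sndTensor]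
    congr 1
    funext j
    by_cases hj : j ∈ S
    · simp only [hj, dite_true]
      ext ⟨x, z⟩ ⟨x', z'⟩
      refine Eq.trans ?_ (kronecker_apply_eq ..).symm
      refine (Matrix.single_apply ..).trans ?_
      rw [Matrix.single_apply, Matrix.single_apply, mul_ite, mul_one, mul_zero, ← ite_and]
      simp only [Prod.ext_iff]
      congr 1
      simp only [eq_iff_iff]
      tauto
    · simp only [hj, dite_false, kronecker_one_one]
  rw [e]
  exact h _ _

end Ampliation

/-! ### Evolutions of the first factor -/

section AmplEvolution

variable {σ τ : ℤ → Type} [∀ j, Fintype (σ j)] [∀ j, DecidableEq (σ j)] [∀ j, Fintype (τ j)]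
  [∀ j, DecidableEq (τ j)] {K : ℝ} {H : ℝ → Finset ℤ → SpinAlgebra σ}

variable (τ) in
/-- The interaction `H_S ⊗ 1` on the pair chain. -/
def amplInteraction (H : ℝ → Finset ℤ → SpinAlgebra σ) :
    ℝ → Finset ℤ → SpinAlgebra (fun j => σ j × τ j) := fun s S => ampl (H s S)

theorem IsRegular.ampl (hH : IsRegular K H) : IsRegular K (amplInteraction τ H) where
  isSelfAdjoint s hs S := (hH.isSelfAdjoint s hs S).map SpinChain.ampl
  mem_local s hs S := ampl_mem_localAlg (hH.mem_local s hs S)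
  meas S hS := continuous_ampl.comp_aestronglyMeasurable (hH.meas S hS)
  bound s hs i F hF := by
    refine (Finset.sum_le_sum fun S _ => ?_).trans (hH.bound s hs i F hF)
    gcongr
    exact norm_ampl_le _

theorem truncate_amplInteraction : truncate (amplInteraction τ H) = amplInteraction τ (truncate H) := by
  funext s S
  simp only [truncate, amplInteraction]
  split_ifs <;> simp

/-- The evolution of `H ⊗ 1` extends the evolution of `H`. -/
theorem evolution_ampl (hH : IsRegular K H) {s : ℝ} (hs : s ∈ Icc (0 : ℝ) 1) (x : SpinAlgebra σ) :
    evolution (amplInteraction τ H) s (ampl x) = ampl (evolution H s x) := by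
  refine tendsto_nhds_unique (hH.ampl.tendsto_evolution hs (ampl x)) ?_
  refine ((continuous_ampl (τ := τ)).tendsto _ |>.comp (hH.tendsto_evolution hs x)).congr fun Λ => ?_
  obtain ⟨M, hM0, hM⟩ := (hH.isHamiltonian_bonds Λ).exists_adI_bound
  let L : SpinAlgebra σ →L[ℝ] SpinAlgebra (fun j => σ j × τ j) :=
    LinearMap.mkContinuous ((ampl (σ := σ) (τ := τ)).toAlgHom.toLinearMap.restrictScalars ℝ) 1
      fun x => by rw [one_mul]; exact norm_ampl_le x
  refine (hH.isHeisenbergSolution Λ).comp_eq (hH.ampl.isHeisenbergSolution Λ) L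
    (ContinuousLinearMap.id ℝ _) ampl norm_ampl_le (fun _ => rfl) hM0 hM univ (by simp) ?_ s hs x
    (mem_univ x)
  intro u hu x _
  simp only [adI, partialHam, amplInteraction, map_smul, map_sub, map_mul, map_sum]

theorem evolution_sndTensor (hH : IsRegular K H) {s : ℝ} (hs : s ∈ Icc (0 : ℝ) 1) (S : Finset ℤ)
    (b : ∀ j, Matrix (τ j) (τ j) ℂ) :
    evolution (amplInteraction τ H) s (sndTensor S b) = sndTensor S b := by
  refine evolution_eq_self hH.ampl (fun u _ T _ => ?_) hs
  rw [adI, amplInteraction, (commute_ampl_sndTensor (H u T) S b).eq, sub_self, smul_zero]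

end AmplEvolution

/-! ### Vectors and subrepresentations -/

section Representations

variable {R : Type*} [CStarAlgebra R] {E : Type*} [NormedAddCommGroup E] [InnerProductSpace ℂ E]
  [CompleteSpace E] (π : R →⋆ₐ[ℂ] (E →L[ℂ] E))

theorem inner_rep_star_mul (a b : R) (ξ ζ : E) : ⟪ξ, π (star a * b) ζ⟫_ℂ = ⟪π a ξ, π b ζ⟫_ℂ := by
  rw [map_mul, map_star, mul_apply_eq_comp, ContinuousLinearMap.star_eq_adjoint,
    ContinuousLinearMap.adjoint_inner_right]

theorem inner_rep_star_mul_self (a : R) (ξ : E) :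
    ⟪ξ, π (star a * a) ξ⟫_ℂ = ((‖π a ξ‖ ^ 2 : ℝ) : ℂ) := by
  rw [inner_rep_star_mul, inner_self_eq_norm_sq_to_K]
  norm_cast

/-- The positive functional given by a linear functional with nonnegative values at the elements
`star a * a`. -/
def positiveOfStarMul [PartialOrder R] [StarOrderedRing R] (f : R →ₗ[ℂ] ℂ)
    (h : ∀ a, 0 ≤ f (star a * a)) : R →ₚ[ℂ] ℂ :=
  PositiveLinearMap.mk₀ f fun x hx => by
    obtain ⟨a, rfl⟩ := CStarAlgebra.nonneg_iff_eq_star_mul_self.1 hx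
    exact h a

/-- The vector functional `a ↦ ⟪ξ, π a ξ⟫`. -/
def vectorFunctional [PartialOrder R] [StarOrderedRing R] (ξ : E) : R →ₚ[ℂ] ℂ :=
  positiveOfStarMul
    ((innerSL ℂ ξ).toLinearMap ∘ₗ (ContinuousLinearMap.apply ℂ E ξ).toLinearMap ∘ₗ
      π.toAlgHom.toLinearMap) fun a => by
    change 0 ≤ ⟪ξ, π (star a * a) ξ⟫_ℂ
    rw [inner_rep_star_mul_self]
    exact Complex.zero_le_real.2 (sq_nonneg _)

theorem vectorFunctional_apply [PartialOrder R] [StarOrderedRing R] (ξ : E) (a : R) :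
    vectorFunctional π ξ a = ⟪ξ, π a ξ⟫_ℂ := rfl

/-- The projection onto a subspace that is invariant under an operator and its adjoint commutes
with the operator. -/
theorem starProjection_apply_of_invariant {K : Submodule ℂ E} [K.HasOrthogonalProjection]
    {T : E →L[ℂ] E} (h : ∀ x ∈ K, T x ∈ K) (h' : ∀ x ∈ K, star T x ∈ K) (v : E) :
    K.starProjection (T v) = T (K.starProjection v) := by
  refine Submodule.eq_starProjection_of_mem_of_inner_eq_zero
    (h _ (Submodule.starProjection_apply_mem K v)) fun w hw => ?_
  rw [← map_sub, ← ContinuousLinearMap.adjoint_inner_right, ← ContinuousLinearMap.star_eq_adjoint]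
  exact Submodule.starProjection_inner_eq_zero _ _ (h' w hw)

/-- Let `N` be a subalgebra and `M` a set of elements that commute with `N`, such that `M` and `N`
jointly act cyclically on `Ω`. Then every representation vector `ζ ≠ 0` has a nonzero component
`κ` in the subspace generated by `N` from `Ω`, after applying some element of `M`; on `N`, the
functional of `κ` is dominated by that of `ζ`. -/
theorem exists_compression (N : StarSubalgebra ℂ R) (M : Set R) (hM : ∀ y ∈ M, star y ∈ M)
    (hc : ∀ x ∈ N, ∀ y ∈ M, Commute x y) (Ω : E)
    (hd : ∀ v, (∀ y ∈ M, ∀ x ∈ N, ⟪π (y * x) Ω, v⟫_ℂ = 0) → v = 0) {ζ : E} (hζ : ζ ≠ 0) :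
    ∃ κ, κ ≠ 0 ∧ ∃ C, (∀ x ∈ N, ‖π x κ‖ ≤ C * ‖π x ζ‖) ∧
      ∃ a : ℕ → R, (∀ n, a n ∈ N) ∧ Tendsto (fun n => π (a n) Ω) atTop (𝓝 κ) := by
  let f : R →ₗ[ℂ] E := (ContinuousLinearMap.apply ℂ E Ω).toLinearMap ∘ₗ π.toAlgHom.toLinearMap
  let K : Submodule ℂ E := (N.toSubalgebra.toSubmodule.map f).topologicalClosure
  have hKc : IsClosed (K : Set E) := Submodule.isClosed_topologicalClosure _
  have hinv : ∀ x ∈ N, ∀ v ∈ K, π x v ∈ K := by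
    intro x hx v hv
    have hsub : (N.toSubalgebra.toSubmodule.map f : Set E) ⊆ (π x) ⁻¹' (K : Set E) := by
      rintro _ ⟨a, ha, rfl⟩
      refine Submodule.le_topologicalClosure _ ⟨x * a, mul_mem (S := StarSubalgebra ℂ R) hx ha, ?_⟩
      change π (x * a) Ω = π x (π a Ω)
      rw [map_mul]
      rfl
    exact closure_minimal hsub (hKc.preimage (π x).continuous) hv
  have : CompleteSpace K := hKc.completeSpace_coe
  have hcomm : ∀ x ∈ N, ∀ v, K.starProjection (π x v) = π x (K.starProjection v) := fun x hx =>
    starProjection_apply_of_invariant (hinv x hx) fun v hv => by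
      rw [← map_star]
      exact hinv _ (star_mem hx) v hv
  have hex : ∃ y ∈ M, K.starProjection (π y ζ) ≠ 0 := by
    by_contra! hcon
    refine hζ (hd ζ fun y hy x hx => ?_)
    have h1 := hcon _ (hM y hy)
    rw [Submodule.starProjection_apply_eq_zero_iff] at h1
    have h2 := h1 (π x Ω) (Submodule.le_topologicalClosure _ ⟨x, hx, rfl⟩)
    rw [map_star, ContinuousLinearMap.star_eq_adjoint,
      ContinuousLinearMap.adjoint_inner_right] at h2
    rw [map_mul]
    exact h2
  obtain ⟨y, hy, hne⟩ := hex
  refine ⟨_, hne, ‖π y‖, fun x hx => ?_, ?_⟩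
  · have e : π x (π y ζ) = π y (π x ζ) := by
      rw [← mul_apply_eq_comp, ← mul_apply_eq_comp, ← map_mul, ← map_mul, (hc x hx y hy).eq]
    rw [← hcomm x hx, e]
    exact (Submodule.norm_starProjection_apply_le K _).trans ((π y).le_opNorm _)
  · have hmem := Submodule.starProjection_apply_mem K (π y ζ)
    obtain ⟨u, hu, hlim⟩ := mem_closure_iff_seq_limit.1 hmem
    choose a ha hau using hu
    refine ⟨a, ha, ?_⟩
    exact hlim.congr fun n => (hau n).symm

end Representations

/-! ### Domination of product functionals -/

section Schur

variable {R : Type*} [CStarAlgebra R]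

theorem posSemidef_gram (δ : R →ₗ[ℂ] ℂ) (hδ : ∀ a, δ (star a) = star (δ a)) (N : Submodule ℂ R)
    (hpos : ∀ a ∈ N, 0 ≤ δ (star a * a)) {n : ℕ} (x : Fin n → R) (hx : ∀ i, x i ∈ N) :
    (Matrix.of fun i j => δ (star (x i) * x j)).PosSemidef := by
  refine .of_dotProduct_mulVec_nonneg ?_ fun c => ?_
  · ext i j
    simp [Matrix.conjTranspose_apply, ← hδ]
  · refine (hpos (∑ i, c i • x i) (sum_mem fun i _ => N.smul_mem _ (hx i))).trans_eq ?_
    simp only [star_sum, star_smul, Finset.sum_mul, Finset.mul_sum, map_sum, smul_mul_assoc,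
      mul_smul_comm, map_smul, smul_eq_mul, dotProduct, Matrix.mulVec, Matrix.of_apply,
      Pi.star_apply]
    rw [Finset.sum_comm]
    refine Finset.sum_congr rfl fun i _ => Finset.sum_congr rfl fun j _ => ?_
    ring

/-- Domination of functionals with a common second factor, from domination of the first factors:
the difference is a product of positive functionals, which is positive by the Schur product
theorem. -/
theorem product_domination [PartialOrder R] [StarOrderedRing R] (χ θ g : R →ₚ[ℂ] ℂ) (C : ℝ) (N M : StarSubalgebra ℂ R)
    (hc : ∀ x ∈ N, ∀ y ∈ M, Commute x y) (hχ : ∀ x ∈ N, ∀ y ∈ M, χ (x * y) = χ x * g y)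
    (hθ : ∀ x ∈ N, ∀ y ∈ M, θ (x * y) = θ x * g y)
    (hle : ∀ x ∈ N, χ (star x * x) ≤ C * θ (star x * x))
    (hspan : ∀ z : R, z ∈ (Submodule.span ℂ {z | ∃ x ∈ N, ∃ y ∈ M, z = x * y}).topologicalClosure)
    (a : R) : χ (star a * a) ≤ C * θ (star a * a) := by
  have hχc : Continuous χ := map_continuous χ
  have hθc : Continuous θ := map_continuous θ
  have hcl : IsClosed {a : R | χ (star a * a) ≤ C * θ (star a * a)} :=
    isClosed_le (by fun_prop) (by fun_prop)
  refine closure_minimal (s := (Submodule.span ℂ {z | ∃ x ∈ N, ∃ y ∈ M, z = x * y} : Set R)) ?_ hcl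
    (hspan a)
  intro z hz
  obtain ⟨n, f, w, rfl⟩ := Submodule.mem_span_set'.1 hz
  choose x hx y hy hxy using fun i => (w i).2
  let δ : R →ₗ[ℂ] ℂ := (C : ℂ) • θ.toLinearMap - χ.toLinearMap
  have hδ : ∀ a, δ a = C * θ a - χ a := fun a => rfl
  have hA := posSemidef_gram δ (fun a => by simp [hδ, map_star]) N.toSubalgebra.toSubmodule
    (fun a ha => by rw [hδ]; exact sub_nonneg.2 (hle a ha)) (fun i => f i • x i)
    fun i => N.smul_mem (hx i) _
  have hB := posSemidef_gram g.toLinearMap (fun a => map_star g a) M.toSubalgebra.toSubmodule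
    (fun a _ => g.map_nonneg (star_mul_self_nonneg a)) y hy
  have hAB := (hA.hadamard hB).dotProduct_mulVec_nonneg 1
  rw [mem_ofPred_eq, ← sub_nonneg, ← hδ]
  refine hAB.trans_eq ?_
  simp only [dotProduct, Matrix.mulVec, Matrix.hadamard_apply, Matrix.of_apply, Pi.star_apply,
    Pi.one_apply, star_one, one_mul, mul_one, star_sum, Finset.sum_mul, map_sum, Finset.mul_sum, hxy]
  rw [Finset.sum_comm]
  refine Finset.sum_congr rfl fun j _ => Finset.sum_congr rfl fun i _ => ?_
  set p := f i • x i with hp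
  set q := f j • x j with hq
  have hpN : p ∈ N := N.smul_mem (hx i) _
  have hqN : q ∈ N := N.smul_mem (hx j) _
  have e : star (f i • (x i * y i)) * (f j • (x j * y j)) =
      (star p * q) * (star (y i) * y j) := by
    rw [← smul_mul_assoc, ← smul_mul_assoc, ← hp, ← hq, star_mul]
    have h1 : Commute (star p * q) (star (y i)) :=
      hc _ (mul_mem (star_mem hpN) hqN) _ (star_mem (hy i))
    rw [mul_assoc (star (y i)), ← mul_assoc (star p), ← mul_assoc (star (y i)), ← h1.eq, mul_assoc]
  rw [e]
  have hm := mul_mem (star_mem hpN) hqN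
  have hm' := mul_mem (star_mem (hy i)) (hy j)
  rw [hδ, hδ (_ * _), hχ _ hm _ hm', hθ _ hm _ hm']
  change (C * θ _ - χ _) * g _ = _
  ring

end Schur

/-! ### Pure states and normality -/

section Normality

variable {σ : ℤ → Type} [∀ j, Fintype (σ j)] [∀ j, DecidableEq (σ j)]

/-- A pure state composed with an automorphism is pure. -/
theorem IsPureState.comp_equiv {ψ : SpinAlgebra σ →ₚ[ℂ] ℂ} (hψ : IsPureState ψ)
    (e : SpinAlgebra σ ≃⋆ₐ[ℂ] SpinAlgebra σ) :
    IsPureState (ψ.comp (PositiveLinearMap.ofClass e)) := by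
  refine ⟨?_, fun φ₁ φ₂ h₁ h₂ t ht h => ?_⟩
  · change ψ (e 1) = 1
    rw [map_one]
    exact hψ.1
  · have hs : ∀ φ : SpinAlgebra σ →ₚ[ℂ] ℂ, IsState φ →
        IsState (φ.comp (PositiveLinearMap.ofClass e.symm)) := fun φ hφ => by
      change φ (e.symm 1) = 1
      rw [map_one]
      exact hφ
    obtain ⟨k₁, k₂⟩ := hψ.2 _ _ (hs φ₁ h₁) (hs φ₂ h₂) t ht fun a => by
      have := h (e.symm a)
      change ψ (e (e.symm a)) = _ at this
      rw [e.apply_symm_apply] at this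
      exact this
    constructor
    · ext a
      change _ = ψ (e a)
      rw [← k₁]
      change _ = φ₁ (e.symm (e a))
      rw [e.symm_apply_apply]
    · ext a
      change _ = ψ (e a)
      rw [← k₂]
      change _ = φ₂ (e.symm (e a))
      rw [e.symm_apply_apply]

/-- A positive functional that is dominated by a multiple of a pure state is a multiple of it. -/
theorem IsPureState.eq_smul_of_le {ψ ω : SpinAlgebra σ →ₚ[ℂ] ℂ} (hψ : IsPureState ψ) {c C : ℝ}
    (hc : 0 < c) (hωc : ω 1 = c) (h : ∀ a, ω (star a * a) ≤ C * ψ (star a * a)) (a : SpinAlgebra σ) :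
    ω a = c * ψ a := by
  have h1 : ψ 1 = 1 := hψ.1
  have hcC : c ≤ C := by
    have := h 1
    rw [star_one, one_mul, hωc, h1, mul_one] at this
    exact_mod_cast this
  -- a constant strictly above `c`, so that both functionals in the convex combination are states
  have hD0 : 0 < C + 1 - c := by linarith
  let φ₁ : SpinAlgebra σ →ₚ[ℂ] ℂ := positiveOfStarMul ((c⁻¹ : ℂ) • ω.toLinearMap) fun a => by
    change 0 ≤ (c⁻¹ : ℂ) * ω (star a * a)
    exact mul_nonneg (by exact_mod_cast (inv_pos.2 hc).le) (ω.map_nonneg (star_mul_self_nonneg a))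
  let φ₂ : SpinAlgebra σ →ₚ[ℂ] ℂ := positiveOfStarMul
      (((C + 1 - c : ℝ) : ℂ)⁻¹ • (((C + 1 : ℝ) : ℂ) • ψ.toLinearMap - ω.toLinearMap)) fun a => by
    change 0 ≤ ((C + 1 - c : ℝ) : ℂ)⁻¹ * (((C + 1 : ℝ) : ℂ) * ψ (star a * a) - ω (star a * a))
    refine mul_nonneg (by exact_mod_cast (inv_pos.2 hD0).le) (sub_nonneg.2 ((h a).trans ?_))
    refine mul_le_mul_of_nonneg_right ?_ (ψ.map_nonneg (star_mul_self_nonneg a))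
    exact_mod_cast (by linarith : C ≤ C + 1)
  have e₁ : ∀ a, φ₁ a = (c⁻¹ : ℂ) * ω a := fun a => rfl
  have e₂ : ∀ a, φ₂ a = ((C + 1 - c : ℝ) : ℂ)⁻¹ * (((C + 1 : ℝ) : ℂ) * ψ a - ω a) := fun a => rfl
  have hc' : (c : ℂ) ≠ 0 := by exact_mod_cast hc.ne'
  have hD' : ((C + 1 - c : ℝ) : ℂ) ≠ 0 := by exact_mod_cast hD0.ne'
  have hC' : ((C + 1 : ℝ) : ℂ) ≠ 0 := by exact_mod_cast (by linarith : C + 1 ≠ 0)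
  have key := hψ.2 φ₁ φ₂ ?_ ?_ (c / (C + 1)) ⟨div_pos hc (by linarith), ?_⟩ ?_
  · have := congrArg (fun φ : SpinAlgebra σ →ₚ[ℂ] ℂ => φ a) key.1
    simp only [e₁] at this
    rw [← this, mul_inv_cancel_left₀ hc']
  · rw [IsState, e₁, hωc, inv_mul_cancel₀ hc']
  · rw [IsState, e₂, hωc, h1, mul_one, ← Complex.ofReal_sub, inv_mul_cancel₀ hD']
  · rw [div_lt_one (by linarith)]
    linarith
  · intro a
    have hx : (1 - ((c / (C + 1) : ℝ) : ℂ)) = ((C + 1 - c : ℝ) : ℂ) / ((C + 1 : ℝ) : ℂ) := by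
      rw [← Complex.ofReal_one, ← Complex.ofReal_sub, ← Complex.ofReal_div]
      congr 1
      have : C + 1 ≠ 0 := by linarith
      field_simp
    rw [e₁, e₂, hx, Complex.ofReal_div]
    field_simp
    ring

/-- A functional that is given by a vector, in the subspace generated from a vector that implements
`ψ`, is normal with respect to `ψ`: the subspace is a copy of the GNS space, and the density matrix
has rank one. -/
theorem isNormalWrt_of_vector {E : Type*} [NormedAddCommGroup E] [InnerProductSpace ℂ E]
    [CompleteSpace E] {ψ : SpinAlgebra σ →ₚ[ℂ] ℂ} (π : SpinAlgebra σ →⋆ₐ[ℂ] (E →L[ℂ] E)) {Ω κ : E}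
    (hΩ : ∀ a, ⟪Ω, π a Ω⟫_ℂ = ψ a) (hκ : κ ≠ 0) {a : ℕ → SpinAlgebra σ}
    (ha : Tendsto (fun n => π (a n) Ω) atTop (𝓝 κ)) {ω : SpinAlgebra σ → ℂ}
    (hω : ∀ x, ⟪κ, π x κ⟫_ℂ = ((‖κ‖ ^ 2 : ℝ) : ℂ) * ω x) : IsNormalWrt ω ψ := by
  let v : SpinAlgebra σ → ψ.GNS := fun a => (ψ.toPreGNS a : ψ.GNS)
  have hv : ∀ x y, ⟪v x, v y⟫_ℂ = ⟪π x Ω, π y Ω⟫_ℂ := fun x y => by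
    rw [← inner_rep_star_mul, hΩ, UniformSpace.Completion.inner_coe,
      PositiveLinearMap.preGNS_inner_def]
    rfl
  have hvsub : ∀ x y, ‖v x - v y‖ = ‖π x Ω - π y Ω‖ := fun x y => by
    have e1 : v x - v y = v (x - y) := by
      simp only [v, map_sub, UniformSpace.Completion.coe_sub]
    have e2 : π x Ω - π y Ω = π (x - y) Ω := by rw [map_sub, sub_apply]
    rw [e1, e2, @norm_eq_sqrt_re_inner ℂ, hv, ← @norm_eq_sqrt_re_inner ℂ]
  have hcs : CauchySeq fun n => v (a n) := by
    refine Metric.cauchySeq_iff.2 fun ε hε => ?_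
    obtain ⟨N, hN⟩ := Metric.cauchySeq_iff.1 ha.cauchySeq ε hε
    refine ⟨N, fun m hm n hn => ?_⟩
    have := hN m hm n hn
    rwa [dist_eq_norm, ← hvsub, ← dist_eq_norm] at this
  obtain ⟨k, hk⟩ := cauchySeq_tendsto_of_complete hcs
  have hkx : ∀ x, ⟪k, ψ.gnsStarAlgHom x k⟫_ℂ = ⟪κ, π x κ⟫_ℂ := fun x => by
    refine tendsto_nhds_unique
      (hk.inner (((ψ.gnsStarAlgHom x).continuous.tendsto k).comp hk)) ?_
    refine (ha.inner (((π x).continuous.tendsto κ).comp ha)).congr fun n => ?_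
    have e1 : ψ.gnsStarAlgHom x (v (a n)) = v (x * a n) := by
      exact ψ.gnsNonUnitalStarAlgHom_apply_coe (a := x) (b := ψ.toPreGNS (a n))
    simp only [Function.comp_apply]
    rw [e1, hv, map_mul, mul_apply_eq_comp]
  have hκ2 : (0 : ℝ) < ‖κ‖ ^ 2 := by positivity
  have hκ' : ((‖κ‖ ^ 2 : ℝ) : ℂ) ≠ 0 := by exact_mod_cast hκ2.ne'
  set c : ℂ := ((‖κ‖ ^ 2 : ℝ) : ℂ)⁻¹ with hc
  let ρ : ψ.GNS →L[ℂ] ψ.GNS := c • InnerProductSpace.rankOne ℂ k k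
  have htr : ∀ x, HasTrace (ρ * ψ.gnsStarAlgHom x) (ω x) := by
    intro x ι b
    have h1 := (b.hasSum_inner_mul_inner (star (ψ.gnsStarAlgHom x) k) k).mul_left c
    have e : c * ⟪star (ψ.gnsStarAlgHom x) k, k⟫_ℂ = ω x := by
      rw [ContinuousLinearMap.star_eq_adjoint, ContinuousLinearMap.adjoint_inner_left, hkx, hω, hc,
        inv_mul_cancel_left₀ hκ']
    rw [e] at h1
    have e2 : (fun i => ⟪b i, (ρ * ψ.gnsStarAlgHom x) (b i)⟫_ℂ) =
        fun i => c * (⟪star (ψ.gnsStarAlgHom x) k, b i⟫_ℂ * ⟪b i, k⟫_ℂ) := by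
      funext i
      rw [mul_apply_eq_comp, smul_apply, InnerProductSpace.rankOne_apply, inner_smul_right,
        inner_smul_right, ContinuousLinearMap.star_eq_adjoint,
        ContinuousLinearMap.adjoint_inner_left]
    rw [e2]
    exact h1
  refine ⟨ρ, ⟨?_, ?_⟩, htr⟩
  · exact (InnerProductSpace.isPositive_rankOne_self k).smul_of_nonneg
      (by rw [hc, ← Complex.ofReal_inv]; exact Complex.zero_le_real.2 (inv_pos.2 hκ2).le)
  · have := htr 1
    rw [map_one, mul_one] at this
    have h1 : ω 1 = 1 := by
      have := hω 1
      rw [map_one, one_apply_eq_self, inner_self_eq_norm_sq_to_K] at this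
      refine mul_left_cancel₀ hκ' ?_
      rw [← this, mul_one]
      norm_cast
    rwa [h1] at this

end Normality

/-! ### The two half-lines -/

section HalfLines

variable {σ : ℤ → Type} [∀ j, Fintype (σ j)] [∀ j, DecidableEq (σ j)]
  {K : ℝ} {H : ℝ → Finset ℤ → SpinAlgebra σ}

theorem commute_halfLines {x y : SpinAlgebra σ} (hx : x ∈ regionAlg (Iic 0))
    (hy : y ∈ regionAlg (Ioi 0)) : Commute x y :=
  commute_regionAlg (Set.Iic_disjoint_Ioi le_rfl) hx hy

/-- The products of observables of the two half-lines span a dense subspace. -/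
theorem mem_closure_span_halfLines (z : SpinAlgebra σ) :
    z ∈ (Submodule.span ℂ {z : SpinAlgebra σ | ∃ x ∈ regionAlg (Iic 0), ∃ y ∈ regionAlg (Ioi 0),
      z = x * y}).topologicalClosure := by
  refine spinAlgebra_induction (p := (· ∈ Submodule.topologicalClosure _))
    (Submodule.isClosed_topologicalClosure _) (fun S => localAlg_induction (fun a => ?_)
      (zero_mem _) (fun _ _ => add_mem) fun c _ => Submodule.smul_mem _ c) z
  refine Submodule.le_topologicalClosure _ (Submodule.subset_span ?_)
  refine ⟨elemTensor (S.filter (· ≤ 0)) (fun j => if j ≤ 0 then a j else 1), ?_,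
    elemTensor (S.filter (0 < ·)) (fun j => if 0 < j then a j else 1), ?_, ?_⟩
  · exact localAlg_le_regionAlg (fun j hj => by simpa using (Finset.mem_filter.1 hj).2)
      (elemTensor_mem _ _)
  · exact localAlg_le_regionAlg (fun j hj => by simpa using (Finset.mem_filter.1 hj).2)
      (elemTensor_mem _ _)
  · have hpad : ∀ (p : ℤ → Prop) [DecidablePred p],
        elemTensor (S.filter p) (fun j => if p j then a j else 1) =
          elemTensor S (fun j => if p j then a j else 1) := fun p _ => by
      rw [elemTensor_congr (b := fun j => if p j ∧ j ∈ S then a j else 1) fun j hj => by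
        simp [(Finset.mem_filter.1 hj).1],
        ← elemTensor_subset (Finset.filter_subset p S) _ fun j hj => by
          rw [Finset.mem_filter, and_comm] at hj
          exact if_neg hj]
      exact elemTensor_congr fun j hj => by simp [hj]
    rw [hpad (· ≤ 0), hpad (0 < ·), elemTensor_mul]
    refine elemTensor_congr fun j _ => ?_
    rcases le_or_gt j 0 with hj | hj
    · simp [hj, hj.not_gt]
    · simp [hj, hj.not_ge]

/-- A vector that is orthogonal to all `π (y * x) Ω`, with `x` and `y` in the two half-lines, is
orthogonal to all `π z Ω`. -/
theorem inner_eq_zero_of_halfLines {E : Type*} [NormedAddCommGroup E] [InnerProductSpace ℂ E]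
    [CompleteSpace E] (π : SpinAlgebra σ →⋆ₐ[ℂ] (E →L[ℂ] E)) {Ω v : E}
    (h : ∀ y ∈ regionAlg (σ := σ) (Ioi 0), ∀ x ∈ regionAlg (σ := σ) (Iic 0),
      ⟪π (y * x) Ω, v⟫_ℂ = 0) (z : SpinAlgebra σ) : ⟪π z Ω, v⟫_ℂ = 0 := by
  have hπ : Continuous π := map_continuous π
  refine closure_minimal ?_ (isClosed_eq (f := fun z => ⟪π z Ω, v⟫_ℂ) (g := fun _ => 0)
    (by fun_prop) continuous_const) (mem_closure_span_halfLines z)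
  intro z hz
  refine Submodule.span_induction (p := fun z _ => ⟪π z Ω, v⟫_ℂ = 0) ?_ ?_ ?_ ?_ hz
  · rintro _ ⟨x, hx, y, hy, rfl⟩
    rw [(commute_halfLines hx hy).eq]
    exact h y hy x hx
  · simp
  · intro x y _ _ hx hy
    rw [map_add, add_apply, inner_add_left, hx, hy, add_zero]
  · intro c x _ hx
    rw [map_smul, smul_apply, inner_smul_left, hx, mul_zero]

theorem crosses_of_not_subset_left {S : Finset ℤ} (h : ¬ (S : Set ℤ) ⊆ Iic 0)
    (h' : ¬ Disjoint (S : Set ℤ) (Iic 0)) : Crosses S := by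
  obtain ⟨j, hj, hj0⟩ := Set.not_subset.1 h
  obtain ⟨i, hi, hi0⟩ := Set.not_disjoint_iff.1 h'
  exact ⟨⟨i, hi, hi0⟩, j, hj, not_le.1 hj0⟩

theorem crosses_of_not_subset_right {S : Finset ℤ} (h : ¬ (S : Set ℤ) ⊆ Ioi 0)
    (h' : ¬ Disjoint (S : Set ℤ) (Ioi 0)) : Crosses S := by
  obtain ⟨j, hj, hj0⟩ := Set.not_subset.1 h
  obtain ⟨i, hi, hi0⟩ := Set.not_disjoint_iff.1 h'
  exact ⟨⟨j, hj, not_lt.1 hj0⟩, i, hi, hi0⟩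

theorem evolution_decouple_mem_left (hH : IsRegular K H) {s : ℝ} (hs : s ∈ Icc (0 : ℝ) 1)
    {x : SpinAlgebra σ} (hx : x ∈ regionAlg (Iic 0)) :
    evolution (decouple H) s x ∈ regionAlg (Iic 0) :=
  have h2 : ∀ s, ∀ S : Finset ℤ, ¬ (S : Set ℤ) ⊆ Iic 0 → ¬ Disjoint (S : Set ℤ) (Iic 0) →
      decouple H s S = 0 := fun _ _ h h' => if_pos (crosses_of_not_subset_left h h')
  (evolution_eqOn_region hH.decouple hH.decouple _ (fun _ _ _ _ => rfl) h2 h2 hs hx).2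

theorem evolution_decouple_mem_right (hH : IsRegular K H) {s : ℝ} (hs : s ∈ Icc (0 : ℝ) 1)
    {x : SpinAlgebra σ} (hx : x ∈ regionAlg (Ioi 0)) :
    evolution (decouple H) s x ∈ regionAlg (Ioi 0) :=
  have h2 : ∀ s, ∀ S : Finset ℤ, ¬ (S : Set ℤ) ⊆ Ioi 0 → ¬ Disjoint (S : Set ℤ) (Ioi 0) →
      decouple H s S = 0 := fun _ _ h h' => if_pos (crosses_of_not_subset_right h h')
  (evolution_eqOn_region hH.decouple hH.decouple _ (fun _ _ _ _ => rfl) h2 h2 hs hx).2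

/-- On the left half-line, the truncated evolution is the decoupled evolution. -/
theorem evolution_decouple_eq_truncate (hH : IsRegular K H) {s : ℝ} (hs : s ∈ Icc (0 : ℝ) 1)
    {x : SpinAlgebra σ} (hx : x ∈ regionAlg (Iic 0)) :
    evolution (decouple H) s x = evolution (truncate H) s x := by
  refine (evolution_eqOn_region hH.decouple hH.truncate (Iic 0) ?_ ?_ ?_ hs hx).1
  · intro s S _ hS
    have h1 : ¬ Crosses S := fun ⟨_, j, hj, hj0⟩ => not_le.2 hj0 (hS hj)
    have h2 : ∀ j ∈ S, j ≤ 0 := fun j hj => hS hj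
    simp only [decouple, truncate, if_neg h1, if_pos h2]
  · exact fun _ _ h h' => if_pos (crosses_of_not_subset_left h h')
  · exact fun _ S h _ => if_neg fun h2 => h fun j hj => h2 j hj

/-- On the right half-line, the truncated evolution is trivial. -/
theorem evolution_truncate_right (hH : IsRegular K H) {s : ℝ} (hs : s ∈ Icc (0 : ℝ) 1)
    {y : SpinAlgebra σ} (hy : y ∈ regionAlg (Ioi 0)) : evolution (truncate H) s y = y := by
  refine evolution_eq_self hH.truncate (fun u hu S _ => ?_) hs
  by_cases hS : ∀ j ∈ S, j ≤ 0
  · have hc := commute_halfLines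
      (localAlg_le_regionAlg (fun j hj => hS j hj) (hH.truncate.mem_local u hu S)) hy
    rw [adI, hc.eq, sub_self, smul_zero]
  · simp [truncate, hS, adI]

/-- A product state factorises over the two half-lines. -/
theorem IsProductState.map_mul {φ : SpinAlgebra σ →ₚ[ℂ] ℂ} (hφ : IsProductState φ)
    {x y : SpinAlgebra σ} (hx : x ∈ regionAlg (Iic 0)) (hy : y ∈ regionAlg (Ioi 0)) :
    φ (x * y) = φ x * φ y := by
  have hc : Continuous φ := map_continuous φ
  refine regionAlg_induction (p := fun x => φ (x * y) = φ x * φ y)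
    (isClosed_eq (by fun_prop) (by fun_prop)) (fun S hS => localAlg_induction (fun a => ?_) ?_ ?_ ?_)
    x hx
  · refine regionAlg_induction (p := fun y => φ (elemTensor S a * y) = φ (elemTensor S a) * φ y)
      (isClosed_eq (by fun_prop) (by fun_prop)) (fun T hT => localAlg_induction (fun b => ?_) ?_ ?_ ?_)
      y hy
    · have hST : Disjoint S T := by
        rw [← Finset.disjoint_coe]
        exact (Set.Iic_disjoint_Ioi le_rfl).mono hS hT
      have e1 : elemTensor S a = elemTensor (S ∪ T) fun j => if j ∈ S then a j else 1 := by
        rw [elemTensor_subset Finset.subset_union_left _ fun j hj => if_neg hj,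
          elemTensor_congr fun j hj => if_pos hj]
      have e2 : elemTensor T b = elemTensor (S ∪ T) fun j => if j ∈ T then b j else 1 := by
        rw [elemTensor_subset Finset.subset_union_right _ fun j hj => if_neg hj,
          elemTensor_congr fun j hj => if_pos hj]
      rw [hφ.2 S a, hφ.2 T b, e1, e2, elemTensor_mul, hφ.2, Finset.prod_union hST]
      congr 1
      · refine Finset.prod_congr rfl fun j hj => congrArg φ (elemTensor_congr fun i hi => ?_)
        rw [Finset.mem_singleton.1 hi]
        simp [hj, Finset.disjoint_left.1 hST hj]
      · refine Finset.prod_congr rfl fun j hj => congrArg φ (elemTensor_congr fun i hi => ?_)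
        rw [Finset.mem_singleton.1 hi]
        simp [hj, Finset.disjoint_right.1 hST hj]
    · simp
    · intro x y hx hy
      rw [mul_add, map_add, map_add, hx, hy, mul_add]
    · intro c x hx
      rw [mul_smul_comm, map_smul, map_smul, hx, smul_eq_mul, smul_eq_mul, mul_left_comm]
  · simp
  · intro x y hx hy
    rw [add_mul, map_add, map_add, hx, hy, add_mul]
  · intro c x hx
    rw [smul_mul_assoc, map_smul, map_smul, hx, smul_eq_mul, smul_eq_mul, mul_assoc]

end HalfLines

/-! ### Splitting an invariant state with short-range entanglement -/

section Splitting

variable {σ : ℤ → Type} [∀ j, Fintype (σ j)] [∀ j, DecidableEq (σ j)]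

/-- The cyclic vector of the GNS representation. -/
def gnsVacuum (Ψ : SpinAlgebra σ →ₚ[ℂ] ℂ) : Ψ.GNS := (Ψ.toPreGNS 1 : Ψ.GNS)

theorem gns_apply_vacuum (Ψ : SpinAlgebra σ →ₚ[ℂ] ℂ) (a : SpinAlgebra σ) :
    Ψ.gnsStarAlgHom a (gnsVacuum Ψ) = (Ψ.toPreGNS a : Ψ.GNS) := by
  refine (Ψ.gnsNonUnitalStarAlgHom_apply_coe (a := a) (b := Ψ.toPreGNS 1)).trans ?_
  rw [PositiveLinearMap.leftMulMapPreGNS_apply]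
  simp

theorem inner_gnsVacuum (Ψ : SpinAlgebra σ →ₚ[ℂ] ℂ) (a : SpinAlgebra σ) :
    ⟪gnsVacuum Ψ, Ψ.gnsStarAlgHom a (gnsVacuum Ψ)⟫_ℂ = Ψ a := by
  rw [gns_apply_vacuum, gnsVacuum, UniformSpace.Completion.inner_coe,
    PositiveLinearMap.preGNS_inner_def]
  simp

theorem eq_zero_of_inner_gns (Ψ : SpinAlgebra σ →ₚ[ℂ] ℂ) {v : Ψ.GNS}
    (h : ∀ a, ⟪Ψ.gnsStarAlgHom a (gnsVacuum Ψ), v⟫_ℂ = 0) : v = 0 := by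
  have h1 : ∀ w : Ψ.GNS, ⟪w, v⟫_ℂ = 0 := fun w => by
    induction w using UniformSpace.Completion.induction_on with
    | hp => exact isClosed_eq (by fun_prop) continuous_const
    | ih w =>
      have := h (Ψ.ofPreGNS w)
      rwa [gns_apply_vacuum] at this
  exact inner_self_eq_zero.1 (h1 v)

theorem map_conj_symm (e : SpinAlgebra σ ≃⋆ₐ[ℂ] SpinAlgebra σ) (w x : SpinAlgebra σ) :
    e (star (e.symm w) * x * e.symm w) = star w * e x * w := by
  rw [map_mul, map_mul, map_star, e.apply_symm_apply]

/-- Let `Ψ` be a state that is invariant under the evolution generated by `H`, and that arises from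
a product state by another evolution. Then some vector of the GNS representation of `Ψ` gives a
functional that is dominated by the pumped state `Ψ ∘ λ`, where `λ` is the evolution generated by
the truncation of `H` to the left half-line. -/
theorem exists_vector_dominated_by_pumped {K K' : ℝ} {H E : ℝ → Finset ℤ → SpinAlgebra σ}
    (hH : IsRegular K H) (hE : IsRegular K' E) {Ψ φ : SpinAlgebra σ →ₚ[ℂ] ℂ}
    (hinv : ∀ x, Ψ (evolution H 1 x) = Ψ x) (hφ : IsProductState φ)
    (hΨ : ∀ x, Ψ x = φ (evolution E 1 x)) :
    ∃ ζ : Ψ.GNS, ζ ≠ 0 ∧ ∃ C : ℝ, ∀ a, ⟪ζ, Ψ.gnsStarAlgHom (star a * a) ζ⟫_ℂ ≤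
      C * Ψ (evolution (truncate H) 1 (star a * a)) := by
  have h1 : (1 : ℝ) ∈ Icc (0 : ℝ) 1 := by simp
  set π := Ψ.gnsStarAlgHom with hπ
  set Ω := gnsVacuum Ψ with hΩ
  have hvec : ∀ w x, ⟪π w Ω, π x (π w Ω)⟫_ℂ = Ψ (star w * x * w) := fun w x => by
    rw [← inner_gnsVacuum, ← hπ, ← hΩ, mul_assoc, inner_rep_star_mul, map_mul, mul_apply_eq_comp]
  obtain ⟨U, hU, hUe⟩ := exists_unitary_evolution_decouple hH
  obtain ⟨V, hV, hVe⟩ := exists_unitary_evolution_decouple hE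
  set τ := evolution (decouple H) 1 with hτ
  set τ' := evolution (decouple E) 1 with hτ'
  set l := evolution (truncate H) 1 with hl
  -- the decoupled evolutions act on the states like inner automorphisms
  set u := τ.symm U with hu
  set v := τ'.symm V with hv
  have hvv : star v * v = 1 ∧ v * star v = 1 := by
    rw [hv, ← map_star, ← map_mul, ← map_mul, hV.1, hV.2, map_one]
    exact ⟨rfl, rfl⟩
  have hΨτ : ∀ x, Ψ (τ x) = Ψ (star u * x * u) := fun x => by
    rw [← hinv (star u * x * u), hUe, hu, map_conj_symm]
    have e : U * (star U * τ x * U) * star U = (U * star U) * τ x * (U * star U) := by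
      simp only [mul_assoc]
    rw [e, hU.2, one_mul, mul_one]
  have hΘ : ∀ x, ⟪π v Ω, π x (π v Ω)⟫_ℂ = φ (τ' x) := fun x => by
    rw [hvec, hΨ, hVe, hv, map_conj_symm]
    have e : V * (star V * τ' x * V) * star V = (V * star V) * τ' x * (V * star V) := by
      simp only [mul_assoc]
    rw [e, hV.2, one_mul, mul_one]
  have hΘmul : ∀ x ∈ regionAlg (σ := σ) (Iic 0), ∀ y ∈ regionAlg (σ := σ) (Ioi 0),
      φ (τ' (x * y)) = φ (τ' x) * φ (τ' y) := fun x hx y hy => by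
    rw [map_mul, hφ.map_mul (evolution_decouple_mem_left hE h1 hx)
      (evolution_decouple_mem_right hE h1 hy)]
  -- the vector `η = π w Ω` implements `φ ∘ τ' ∘ τ`
  set w := τ.symm v * u with hw
  have hη : ∀ x, ⟪π w Ω, π x (π w Ω)⟫_ℂ = φ (τ' (τ x)) := fun x => by
    rw [hvec, ← hΘ, hvec, hw, star_mul]
    have e : star u * star (τ.symm v) * x * (τ.symm v * u) =
        star u * (star (τ.symm v) * x * τ.symm v) * u := by simp only [mul_assoc]
    rw [e, ← hΨτ, map_conj_symm]
  have hη0 : π w Ω ≠ 0 := fun h => by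
    have := hη 1
    rw [h, inner_zero_left, map_one, map_one, hφ.1] at this
    exact zero_ne_one this
  -- compression to the subspace generated from `π v Ω` by the left half-line
  obtain ⟨ξ, hξ, C, hC, a, ha, hlim⟩ := exists_compression π (regionAlg (Iic 0))
    (regionAlg (σ := σ) (Ioi 0) : Set (SpinAlgebra σ)) (fun y hy => star_mem hy)
    (fun x hx y hy => commute_halfLines hx hy) (π v Ω) (fun z hz => by
      refine eq_zero_of_inner_gns Ψ fun b => ?_
      have := inner_eq_zero_of_halfLines π hz (b * star v)
      rwa [map_mul, mul_apply_eq_comp, ← mul_apply_eq_comp (π (star v)), ← map_mul, hvv.1, map_one,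
        one_apply_eq_self] at this) hη0
  -- the functional of `ξ` factorises, with the right factor of `Θ = φ ∘ τ'`
  have hξprod : ∀ x ∈ regionAlg (σ := σ) (Iic 0), ∀ y ∈ regionAlg (σ := σ) (Ioi 0),
      ⟪ξ, π (x * y) ξ⟫_ℂ = ⟪ξ, π x ξ⟫_ℂ * φ (τ' y) := fun x hx y hy => by
    have ht : ∀ z, Tendsto (fun n => φ (τ' (star (a n) * z * a n))) atTop (𝓝 ⟪ξ, π z ξ⟫_ℂ) :=
      fun z => by
      refine (hlim.inner (((π z).continuous.tendsto ξ).comp hlim)).congr fun n => ?_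
      rw [← hΘ, mul_assoc, inner_rep_star_mul, map_mul, mul_apply_eq_comp]
      rfl
    refine tendsto_nhds_unique (ht (x * y)) (((ht x).mul_const _).congr fun n => ?_)
    have hm := mul_mem (mul_mem (star_mem (ha n)) hx) (ha n)
    rw [← hΘmul _ hm y hy]
    congr 2
    rw [mul_assoc (star (a n) * x), (commute_halfLines (ha n) hy).eq]
    simp only [mul_assoc]
  have hdom := product_domination (vectorFunctional π ξ)
    ((vectorFunctional π (π v Ω)).comp (PositiveLinearMap.ofClass l)) (vectorFunctional π (π v Ω))
    (C ^ 2) (regionAlg (Iic 0)) (regionAlg (Ioi 0)) (fun x hx y hy => commute_halfLines hx hy)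
    (fun x hx y hy => by
      simp only [vectorFunctional_apply, hΘ]
      exact hξprod x hx y hy)
    (fun x hx y hy => by
      change vectorFunctional π (π v Ω) (l (x * y)) = vectorFunctional π (π v Ω) (l x) * _
      simp only [vectorFunctional_apply, hΘ]
      rw [map_mul, evolution_truncate_right hH h1 hy, hΘmul _ _ _ hy]
      rw [hl, ← evolution_decouple_eq_truncate hH h1 hx]
      exact evolution_decouple_mem_left hH h1 hx)
    (fun x hx => by
      change _ ≤ _ * vectorFunctional π (π v Ω) (l (star x * x))
      have hxx := mul_mem (star_mem hx) hx
      simp only [vectorFunctional_apply]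
      rw [hΘ, hl, ← evolution_decouple_eq_truncate hH h1 hxx, ← hτ, ← hη, inner_rep_star_mul_self,
        inner_rep_star_mul_self, ← Complex.ofReal_mul, ← mul_pow]
      exact Complex.real_le_real.2 (pow_le_pow_left₀ (norm_nonneg _) (hC x hx) 2))
    mem_closure_span_halfLines
  -- undo the conjugation with `v`
  set v₂ := l.symm v with hv₂
  have hvv₂ : v₂ * star v₂ = 1 := by
    rw [hv₂, ← map_star, ← map_mul, hvv.2, map_one]
  refine ⟨π (star v₂) ξ, fun h => hξ ?_, C ^ 2, fun b => ?_⟩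
  · have := congrArg (π v₂) h
    rwa [← mul_apply_eq_comp, ← map_mul, hvv₂, map_one, one_apply_eq_self, map_zero] at this
  · have hb := hdom (b * star v₂)
    change ⟪ξ, π _ ξ⟫_ℂ ≤ _ * ⟪π v Ω, π (l _) (π v Ω)⟫_ℂ at hb
    have e1 : ⟪π (star v₂) ξ, π (star b * b) (π (star v₂) ξ)⟫_ℂ =
        ⟪ξ, π (star (b * star v₂) * (b * star v₂)) ξ⟫_ℂ := by
      rw [inner_rep_star_mul, inner_rep_star_mul, map_mul, mul_apply_eq_comp]
    have e2 : star v * l (star (b * star v₂) * (b * star v₂)) * v = l (star b * b) := by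
      rw [star_mul, star_star, map_mul, map_mul, map_mul, map_star l v₂, hv₂, l.apply_symm_apply]
      have e : star v * (v * l (star b) * (l b * star v)) * v =
          (star v * v) * (l (star b) * l b) * (star v * v) := by simp only [mul_assoc]
      rw [e, hvv.1, one_mul, mul_one, map_mul]
    rw [e1]
    refine hb.trans_eq ?_
    rw [hvec, e2]

end Splitting

/-! ### Loops with an invertible basepoint -/

section Loops

variable {σ : ℤ → Type} [∀ j, Fintype (σ j)] [∀ j, DecidableEq (σ j)]
  {τ : ℤ → Type} [∀ j, Fintype (τ j)] [∀ j, DecidableEq (τ j)]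
  {ψ : SpinAlgebra σ →ₚ[ℂ] ℂ} {ψ' : SpinAlgebra τ →ₚ[ℂ] ℂ}
  {Ψ : SpinAlgebra (fun j => σ j × τ j) →ₚ[ℂ] ℂ}

theorem IsTensorState.map_ampl_mul (h : IsTensorState ψ ψ' Ψ) (x : SpinAlgebra σ) (S : Finset ℤ)
    (b : ∀ j, Matrix (τ j) (τ j) ℂ) :
    Ψ (ampl x * sndTensor S b) = ψ x * ψ' (elemTensor S b) := by
  have hc := continuous_ampl (σ := σ) (τ := τ)
  have hψ : Continuous ψ := map_continuous ψ
  have hΨ : Continuous Ψ := map_continuous Ψ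
  refine ampl_induction (p := fun x => Ψ (ampl x * sndTensor S b) = ψ x * ψ' (elemTensor S b))
    (isClosed_eq (by fun_prop) (by fun_prop)) S ?_ (by simp) ?_ ?_ x
  · intro T hT a
    obtain ⟨b', hb, hb'⟩ := exists_sndTensor_eq (σ := σ) hT b
    rw [← hb, ← hb', ampl_elemTensor_mul_sndTensor, h]
  · intro x y hx hy
    rw [map_add, add_mul, map_add, hx, hy, map_add, add_mul]
  · intro c x hx
    rw [map_smul, smul_mul_assoc, map_smul, hx, map_smul, smul_eq_mul, smul_eq_mul, mul_assoc]

theorem IsTensorState.map_ampl (h : IsTensorState ψ ψ' Ψ) (hψ' : IsState ψ') (x : SpinAlgebra σ) :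
    Ψ (ampl x) = ψ x := by
  have := h.map_ampl_mul x ∅ fun _ => 1
  have e : sndTensor (σ := σ) (τ := τ) ∅ (fun _ => 1) = 1 := by
    rw [sndTensor]
    simp only [kronecker_one_one]
    exact elemTensor_one ∅
  rwa [e, mul_one, elemTensor_one, hψ', mul_one] at this

/-- If `ψ` is invariant under the evolution of `H`, then `ψ ⊗ ψ'` is invariant under the evolution of
`H ⊗ 1`. -/
theorem IsTensorState.invariant (h : IsTensorState ψ ψ' Ψ) {K : ℝ}
    {H : ℝ → Finset ℤ → SpinAlgebra σ} (hH : IsRegular K H)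
    (hinv : ∀ x, ψ (evolution H 1 x) = ψ x) (z : SpinAlgebra (fun j => σ j × τ j)) :
    Ψ (evolution (amplInteraction τ H) 1 z) = Ψ z := by
  have hΨ : Continuous Ψ := map_continuous Ψ
  have he := continuous_starAlgEquiv (evolution (amplInteraction τ H) 1)
  have h1 : (1 : ℝ) ∈ Icc (0 : ℝ) 1 := by simp
  refine spinAlgebra_induction
    (p := fun z => Ψ (evolution (amplInteraction τ H) 1 z) = Ψ z)
    (isClosed_eq (by fun_prop) (by fun_prop))
    (fun S => localAlg_pair_induction (fun x b => ?_) (by simp) ?_ ?_) z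
  · rw [map_mul, evolution_ampl hH h1, evolution_sndTensor hH h1, h.map_ampl_mul, h.map_ampl_mul,
      hinv]
  · intro x y hx hy
    rw [map_add, map_add, hx, hy, map_add]
  · intro c x hx
    rw [map_smul, map_smul, hx, map_smul]

/-- The pumped state of an invertible state that is invariant under the evolution of `H` is normal:
the vector that `exists_vector_dominated_by_pumped` provides on the doubled chain is compressed to
the copy of the GNS space of `ψ`, where purity of the pumped state turns domination into equality. -/
theorem isNormalWrt_evolution_truncate {H : ℝ → Finset ℤ → SpinAlgebra σ} {K : ℝ}
    (hH : IsRegular K H) (hinv : ∀ x, ψ (evolution H 1 x) = ψ x) (hψ : IsInvertible ψ) :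
    IsNormalWrt (fun a => ψ (evolution (truncate H) 1 a)) ψ := by
  have h1 : (1 : ℝ) ∈ Icc (0 : ℝ) 1 := by simp
  obtain ⟨hpure, d, -, ψ', hψ', Ψ, hΨ, E, hE, φ, hφ, hΨφ⟩ := hψ
  obtain ⟨K', hE⟩ := hE.exists_isRegular
  obtain ⟨ζ, hζ, C, hC⟩ :=
    exists_vector_dominated_by_pumped hH.ampl hE (hΨ.invariant hH hinv) hφ hΨφ
  rw [truncate_amplInteraction] at hC
  set π := Ψ.gnsStarAlgHom with hπ
  let ι := ampl (σ := σ) (τ := fun j => Fin (d j))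
  let πA := π.comp ι
  obtain ⟨κ, hκ, C', hC', a, ha, hlim⟩ := exists_compression π ι.range
    {y | ∀ x, Commute (ι x) y} (fun y hy x => by
      have := (hy (star x)).star_star
      rwa [← map_star, star_star] at this)
    (by rintro _ ⟨x, rfl⟩ y hy; exact hy x) (gnsVacuum Ψ) (fun v hv => by
      refine eq_zero_of_inner_gns Ψ fun z => ?_
      have hcπ : Continuous π := map_continuous π
      refine spinAlgebra_induction (p := fun z => ⟪π z (gnsVacuum Ψ), v⟫_ℂ = 0)
        (isClosed_eq (by fun_prop) (by fun_prop))
        (fun S => localAlg_pair_induction (fun x b => ?_) (by simp) ?_ ?_) z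
      · rw [(commute_ampl_sndTensor x S b).eq]
        exact hv _ (fun x => commute_ampl_sndTensor x S b) _ ⟨x, rfl⟩
      · intro x y hx hy
        rw [map_add, add_apply, inner_add_left, hx, hy, add_zero]
      · intro c x hx
        rw [map_smul, smul_apply, inner_smul_left, hx, mul_zero]) hζ
  choose a' ha' using ha
  have hκ2 : (0 : ℝ) < ‖κ‖ ^ 2 := by positivity
  refine isNormalWrt_of_vector πA (Ω := gnsVacuum Ψ) (κ := κ) (a := a') (fun x => ?_) hκ ?_ fun x => ?_
  · exact (inner_gnsVacuum Ψ (ι x)).trans (hΨ.map_ampl hψ'.1 x)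
  · exact hlim.congr fun n => by rw [← ha' n]; rfl
  · refine (hpure.comp_equiv (evolution (truncate H) 1)).eq_smul_of_le (ω := vectorFunctional πA κ)
      (C := C' ^ 2 * C) hκ2 ?_ (fun b => ?_) x
    · have := inner_rep_star_mul_self πA 1 κ
      rw [star_one, one_mul, map_one, one_apply_eq_self] at this
      rw [vectorFunctional_apply, map_one, one_apply_eq_self, this]
    · change ⟪κ, πA (star b * b) κ⟫_ℂ ≤ _ * ψ (evolution (truncate H) 1 (star b * b))
      have hb := hC (ι b)
      rw [← map_star, ← map_mul, evolution_ampl hH.truncate h1, hΨ.map_ampl hψ'.1, map_mul, map_star,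
        inner_rep_star_mul_self] at hb
      rw [inner_rep_star_mul_self]
      have h2 : ‖πA b κ‖ ^ 2 ≤ C' ^ 2 * ‖π (ι b) ζ‖ ^ 2 := by
        rw [← mul_pow]
        exact pow_le_pow_left₀ (norm_nonneg _) (hC' (ι b) ⟨b, rfl⟩) 2
      refine (Complex.real_le_real.2 h2).trans ?_
      rw [Complex.ofReal_mul, Complex.ofReal_mul, mul_assoc]
      exact mul_le_mul_of_nonneg_left hb (Complex.zero_le_real.2 (sq_nonneg _))

end Loops

end SpinChain

end

theorem mainTheorem9 (σ : ℤ → Type) [∀ j, Fintype (σ j)] [∀ j, DecidableEq (σ j)]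
    [∀ j, Nonempty (σ j)] (H : ℝ → Finset ℤ → SpinChain.SpinAlgebra σ)
    (ψ : ℝ → SpinChain.SpinAlgebra σ →ₚ[ℂ] ℂ) (hψ : SpinChain.IsLoopGeneratedBy ψ H)
    (hinv : SpinChain.IsInvertible (ψ 0)) :
    SpinChain.IsAlmostLocalEvolution (SpinChain.truncate H)
        (SpinChain.evolution (SpinChain.truncate H)) ∧
      SpinChain.IsNormalWrt
        (fun a => ψ 0 (SpinChain.evolution (SpinChain.truncate H) 1 a)) (ψ 0) := by
  obtain ⟨K, hH⟩ := hψ.isTDI.exists_isRegular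
  refine ⟨hH.truncate.isAlmostLocalEvolution,
    SpinChain.isNormalWrt_evolution_truncate hH (fun x => ?_) hinv⟩
  rw [← hψ.path 1 (by simp), ← hψ.closed]
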